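/- Let $d,\ell\ge 1$ be integers. Let $\mathcal T$ be a finite conforming mesh of closed nondegenerate $d$-simplices in $\mathbb R^d$ (any two elements intersect in a, possibly empty, common subsimplex) with at least two elements, and suppose that the interior $\Omega$ of the union of the elements is connected. Let $\mathcal F$ be the set of $(d-1)$-dimensional faces of elements that are not contained in $\partial\Omega$, and for a face $E$ let $\omega_E$ be the union of the elements having $E$ as a face. Let $S=S^{\ell,0}(\mathcal T)$ be the space of functions that are continuous on $\Omega$ and coincide on every element with a polynomial of total degree at most $\ell$; its nodes are the points of the elements whose barycentric coordinates are integer multiples of $1/\ell$. Assume that $\mathcal T$ is face-connected: any two elements $K,\widetilde K$ sharing a node $z$ are joined by a finite sequence of distinct elements $K=K_1,\dots,K_n=\widetilde K$ such that every $K_j\cap K_{j+1}$ is a face in $\mathcal F$ containing $z$. Let $$\sigma_{\mathcal T}:=\max\Big\{\frac{\operatorname{diam}\widetilde K}{\rho_K}: K,\widetilde K\in\mathcal T,\ K\cap\widetilde K\neq\emptyset\Big\},$$ where $\rho_K$ is the maximal diameter of a ball contained in $K$. Put $S_0:=S\cap H^1_0(\Omega)$ and, for $E\in\mathcal F$, $$S_E:=\begin{cases}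 S_0|_{\omega_E} & \text{if one of the elements in } \omega_E \text{ has a face contained in } \partial\Omega,\\ S|_{\omega_E} & \text{otherwise.}\end{cases}$$ For $\varepsilon>0$ write $|||w|||_\omega^2:=\|w\|_{L^2(\omega)}^2+\varepsilon\|\nabla w\|_{L^2(\omega)}^2$. **Theorem (Robust localization with boundary condition).** For all $d,\ell$ and every $\sigma$ there is a constant $C>0$ depending only on $\ell$, $d$ and $\sigma$ such that, for every mesh $\mathcal T$ as above with $\sigma_{\mathcal T}\le\sigma$, every $\varepsilon>0$ and every $u\in H^1_0(\Omega)$, $$\inf_{v\in S_0}|||u-v|||_\Omega\le C\Big(\sum_{E\in\mathcal F}\inf_{P\in S_E}|||u-P|||_{\omega_E}^2\Big)^{1/2}$$ and $$\Big(\sum_{E\in\mathcal F}\inf_{P\in S_E}|||u-P|||_{\omega_E}^2\Big)^{1/2}\le C\inf_{v\in S_0}|||u-v|||_\Omega .$$ In particular $C$ does not depend on $\varepsilon$. -/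

import Mathlib

open MeasureTheory Filter Topology
open scoped ContDiff

noncomputable section

/-- The Euclidean space `ℝ^d`. -/
abbrev Euc (d : ℕ) := EuclideanSpace ℝ (Fin d)

/-! ### Sobolev spaces and the reaction-diffusion norm -/

/-- `φ` is a test function on `U`, i.e. `φ ∈ C_c^∞(U)`. -/
def IsTestFunction {d : ℕ} (U : Set (Euc d)) (φ : Euc d → ℝ) : Prop :=
  ContDiff ℝ ∞ φ ∧ HasCompactSupport φ ∧ tsupport φ ⊆ U

/-- `g` is a square integrable weak gradient of `u` on the open set `U`. -/
def IsWeakGradient {d : ℕ} (U : Set (Euc d)) (u : Euc d → ℝ) (g : Euc d → Euc d) : Prop :=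
  MemLp g 2 (volume.restrict U) ∧
    ∀ φ : Euc d → ℝ, IsTestFunction U φ →
      ∫ x in U, u x • gradient φ x = - ∫ x in U, φ x • g x

/-- `u ∈ H¹(U)`; only the values of `u` on `U` (up to null sets) matter. -/
def MemH1 {d : ℕ} (U : Set (Euc d)) (u : Euc d → ℝ) : Prop :=
  MemLp u 2 (volume.restrict U) ∧ ∃ g : Euc d → Euc d, IsWeakGradient U u g

open Classical in
/-- The weak gradient on `U` of `u ∈ H¹(U)`; it is unique almost everywhere in `U`. -/
def weakGradient {d : ℕ} (U : Set (Euc d)) (u : Euc d → ℝ) : Euc d → Euc d :=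
  if h : ∃ g : Euc d → Euc d, IsWeakGradient U u g then h.choose else 0

/-- The reaction-diffusion norm `(‖w‖²_U + ε ‖∇w‖²_U)^{1/2}` of `w ∈ H¹(U)`. -/
def rdNorm {d : ℕ} (ε : ℝ) (U : Set (Euc d)) (w : Euc d → ℝ) : ℝ :=
  √((∫ x in U, w x ^ 2) + ε * ∫ x in U, ‖weakGradient U w x‖ ^ 2)

/-- `u ∈ H¹₀(U)`, the closure of `C_c^∞(U)` in `H¹(U)` (for `ε = 1` the reaction-diffusion norm
is the standard norm of `H¹(U)`). -/
def MemH10 {d : ℕ} (U : Set (Euc d)) (u : Euc d → ℝ) : Prop :=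
  MemH1 U u ∧ ∃ φ : ℕ → Euc d → ℝ, (∀ n, IsTestFunction U (φ n)) ∧
    Tendsto (fun n => rdNorm 1 U (u - φ n)) atTop (𝓝 0)

/-! ### Conforming simplicial meshes -/

/-- A finite conforming mesh of nondegenerate `d`-simplices in `ℝ^d`. An element is represented by
the set `K` of its `d + 1` vertices; the closed simplex itself is `convexHull ℝ K`. Conforming
means that two elements intersect in a (possibly empty) common subsimplex. -/
structure SimplicialMesh (d : ℕ) where
  elems : Finset (Finset (Euc d))
  card_eq : ∀ K ∈ elems, K.card = d + 1
  indep : ∀ K ∈ elems, AffineIndependent ℝ ((↑) : K → Euc d)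
  conforming : ∀ K ∈ elems, ∀ K' ∈ elems,
    convexHull ℝ (K : Set (Euc d)) ∩ convexHull ℝ (K' : Set (Euc d)) =
      convexHull ℝ ((K : Set (Euc d)) ∩ (K' : Set (Euc d)))

namespace SimplicialMesh

variable {d : ℕ} (T : SimplicialMesh d)

/-- The meshed open set `Ω`, the interior of the union of the closed elements. -/
def domain : Set (Euc d) := interior (⋃ K ∈ T.elems, convexHull ℝ (K : Set (Euc d)))

open Classical in
/-- All faces, i.e. the `(d-1)`-dimensional subsimplices of elements (as sets of `d` vertices). -/
def faces : Finset (Finset (Euc d)) := T.elems.biUnion fun K => K.powersetCard d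

open Classical in
/-- The faces that are not contained in the boundary `∂Ω`. -/
def interiorFaces : Finset (Finset (Euc d)) :=
  T.faces.filter fun F => ¬ convexHull ℝ (F : Set (Euc d)) ⊆ frontier T.domain

/-- The pair `ω_F`: the union of the closed elements that have `F` as a face. -/
def pair (F : Finset (Euc d)) : Set (Euc d) :=
  ⋃ K ∈ T.elems.filter (fun K => F ⊆ K), convexHull ℝ (K : Set (Euc d))

/-- `ω_F` has a face on `∂Ω`: one of its elements has a face that is contained in `∂Ω`. -/
def PairHasBoundaryFace (F : Finset (Euc d)) : Prop :=
  ∃ K ∈ T.elems, F ⊆ K ∧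
    ∃ F' ∈ T.faces, F' ⊆ K ∧ convexHull ℝ (F' : Set (Euc d)) ⊆ frontier T.domain

/-- The nodes of the Lagrange element of degree `ℓ`: the points of the elements whose barycentric
coordinates are multiples of `1/ℓ`. -/
def nodes (ℓ : ℕ) : Set (Euc d) :=
  {z | ∃ K ∈ T.elems, ∃ a : Euc d → ℕ,
    ∑ x ∈ K, a x = ℓ ∧ z = ∑ x ∈ K, ((a x : ℝ) / (ℓ : ℝ)) • x}

/-- Face-connectedness: any two elements that share a node `z` are joined by a sequence of distinct
elements such that consecutive elements intersect in an interelement face containing `z`. -/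
def FaceConnected (ℓ : ℕ) : Prop :=
  ∀ z ∈ T.nodes ℓ, ∀ K ∈ T.elems, ∀ K' ∈ T.elems,
    z ∈ convexHull ℝ (K : Set (Euc d)) → z ∈ convexHull ℝ (K' : Set (Euc d)) →
      ∃ (n : ℕ) (p : Fin (n + 1) → Finset (Euc d)), Function.Injective p ∧
        (∀ i, p i ∈ T.elems) ∧ p 0 = K ∧ p (Fin.last n) = K' ∧
        ∀ i : Fin n, ∃ F ∈ T.interiorFaces, z ∈ convexHull ℝ (F : Set (Euc d)) ∧
          (p i.castSucc : Set (Euc d)) ∩ (p i.succ : Set (Euc d)) = (F : Set (Euc d))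

/-- `ρ_K`, the maximal diameter of a ball inscribed in the simplex with vertex set `K`. -/
def inscribedDiam (K : Finset (Euc d)) : ℝ :=
  sSup {t : ℝ | ∃ (c : Euc d) (r : ℝ), 0 ≤ r ∧ t = 2 * r ∧
    Metric.closedBall c r ⊆ convexHull ℝ (K : Set (Euc d))}

/-- The shape parameter `σ_T`: the maximum of `h_{K'} / ρ_K` over all elements `K` and all elements
`K'` touching `K`, where `h_{K'}` is the diameter of `K'`. -/
def shapeParam : ℝ :=
  sSup {t : ℝ | ∃ K ∈ T.elems, ∃ K' ∈ T.elems,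
    (convexHull ℝ (K : Set (Euc d)) ∩ convexHull ℝ (K' : Set (Euc d))).Nonempty ∧
      t = Metric.diam (convexHull ℝ (K' : Set (Euc d))) / inscribedDiam K}

/-! ### Finite element spaces -/

/-- `S^{ℓ,0}(T)`: continuous functions on `Ω` that coincide on every closed element with a polynomial
of total degree at most `ℓ` (values outside the mesh are irrelevant). -/
def feSpace (ℓ : ℕ) : Set (Euc d → ℝ) :=
  {v | ContinuousOn v T.domain ∧ ∀ K ∈ T.elems, ∃ p : MvPolynomial (Fin d) ℝ,
    p.totalDegree ≤ ℓ ∧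
      ∀ x ∈ convexHull ℝ (K : Set (Euc d)), v x = MvPolynomial.eval (fun i => x i) p}

/-- `S₀ = S^{ℓ,0}(T) ∩ H¹₀(Ω)`. -/
def feSpaceZero (ℓ : ℕ) : Set (Euc d → ℝ) := {v ∈ T.feSpace ℓ | MemH10 T.domain v}

open Classical in
/-- The local space `S_F` on `ω_F`: the restrictions to `ω_F` of functions in `S₀` if `ω_F` has a face
on `∂Ω`, and of functions in `S^{ℓ,0}(T)` otherwise. -/
def localSpace (ℓ : ℕ) (F : Finset (Euc d)) : Set (Euc d → ℝ) :=
  {v | ∃ w ∈ (if T.PairHasBoundaryFace F then T.feSpaceZero ℓ else T.feSpace ℓ),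
    Set.EqOn v w (T.pair F)}

end SimplicialMesh

end

/-! ### Barycentric coordinates of a simplex -/

/-! The second inequality is a counting argument. A function of $S_0$ restricts to an admissible
competitor for every pair, whichever local space is used there. Squared errors are additive over
elements, and an element has at most $d+1$ faces. So the sum of local errors is at most $d+1$ times
the global one (`sum_interiorFaces_sum_le`).

For the first inequality, near-best local functions $w_E$ must be merged into one $v\in S_0$.
Merging compares values of different $w_E$ at common nodes, and turning such differences into
energies costs $(1+\varepsilon h^{-2})\|\cdot\|^2_{L^2}$ through inverse estimates. The factor
$\varepsilon h^{-2}$ is the obstacle to robustness. It disappears once the error $u-w_E$ also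
satisfies $h^{-1}\|u-w_E\|\lesssim\|\nabla(u-w_E)\|$ on the pair. If no element of the pair has a
boundary face, constants may be added to $w_E$, and subtracting the mean of $u-w_E$ over one element
gives this bound by Poincaré. The mean itself is bounded by the $L^2$ norm, so the $L^2$ part of the
error survives. If some element does have a boundary face, constants are not available, but $u-w_E$
vanishes on that face and Friedrichs applies to $w_E$ as it stands. In both cases the bound passes
to the other elements of the pair across the common face by an affine map. This is
`exists_scaledEnergy_le`, whose constant is free of $\varepsilon$.

The merging is `exists_global_approximation`. Every element $K$ owns an interior face `face K`,
because $\Omega$ is connected and there are at least two elements. Every node $z$ picks an element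
$K_z\ni z$, and $v(z)$ is the value at $z$ of the function attached to `face` of $K_z$. For
$z\notin\Omega$ the element is picked with a face on $\partial\Omega$ (`exists_boundaryFace`), so
the attached function lies in $S_0$, the nodal value is zero, and $v\in S_0$. On $K$, the difference
between $v$ and the function of `face K` is controlled by its nodal values. These are estimated by
walking along a face-connected path of elements around the node (`pointWeight_mul_nodal_sub_sq_le`).
Shape regularity bounds the path length, the overlap of neighbourhoods and the change of sizes along
the path.

Two facts link this to Sobolev spaces. Membership of a finite element function in $H^1_0$ is the
same as pointwise vanishing on the mesh outside $\Omega$ (`mem_feSpaceZero_of_eq_zero`,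
`eq_zero_of_mem_feSpaceZero`). And since $u$ is a limit of test functions, the Poincaré, Friedrichs
and transfer inequalities need proof only for $C^1$ functions and then pass to the limit, with no
trace theorem. -/

/-- `K` is the vertex set of a nondegenerate `d`-simplex of `ℝ^d`. -/
structure IsSimplex {d : ℕ} (K : Finset (Euc d)) : Prop where
  card_eq : K.card = d + 1
  indep : AffineIndependent ℝ ((↑) : K → Euc d)

/-- The closed simplex with vertex set `K`. -/
abbrev hull {d : ℕ} (K : Finset (Euc d)) : Set (Euc d) := convexHull ℝ (K : Set (Euc d))

theorem SimplicialMesh.isSimplex {d : ℕ} (T : SimplicialMesh d) {K : Finset (Euc d)}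
    (hK : K ∈ T.elems) : IsSimplex K :=
  ⟨T.card_eq K hK, T.indep K hK⟩

theorem isClosed_hull {d : ℕ} (K : Finset (Euc d)) : IsClosed (hull K) :=
  (K.finite_toSet.isCompact_convexHull ℝ).isClosed

theorem isCompact_hull {d : ℕ} (K : Finset (Euc d)) : IsCompact (hull K) :=
  K.finite_toSet.isCompact_convexHull ℝ

theorem convex_hull {d : ℕ} (K : Finset (Euc d)) : Convex ℝ (hull K) := convex_convexHull ℝ _

theorem measurableSet_hull {d : ℕ} (K : Finset (Euc d)) : MeasurableSet (hull K) :=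
  (isClosed_hull K).measurableSet

theorem hull_mono {d : ℕ} {K L : Finset (Euc d)} (h : K ⊆ L) : hull K ⊆ hull L :=
  convexHull_mono (by exact_mod_cast h)

theorem isBounded_hull {d : ℕ} (K : Finset (Euc d)) : Bornology.IsBounded (hull K) :=
  (isCompact_hull K).isBounded

theorem volume_hull_lt_top {d : ℕ} (K : Finset (Euc d)) : volume (hull K) < ⊤ :=
  (isCompact_hull K).measure_lt_top

theorem mem_hull_of_mem {d : ℕ} {K : Finset (Euc d)} {y : Euc d} (hy : y ∈ K) : y ∈ hull K :=
  subset_convexHull ℝ _ (by exact_mod_cast hy)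

namespace IsSimplex

variable {d : ℕ} {K : Finset (Euc d)}

theorem affineSpan_eq_top (hK : IsSimplex K) :
    affineSpan ℝ (Set.range ((↑) : K → Euc d)) = ⊤ := by
  rw [hK.indep.affineSpan_eq_top_iff_card_eq_finrank_add_one]
  simp [hK.card_eq]

/-- The vertices of a simplex as an affine basis. -/
noncomputable def basis (hK : IsSimplex K) : AffineBasis K ℝ (Euc d) :=
  ⟨(↑), hK.indep, hK.affineSpan_eq_top⟩

theorem range_basis (hK : IsSimplex K) : Set.range hK.basis = (K : Set (Euc d)) :=
  Subtype.range_coe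

end IsSimplex

open Classical in
/-- The barycentric coordinate of the simplex `K` that belongs to the vertex `y` (zero if `y` is not
a vertex). -/
noncomputable def baryCoord {d : ℕ} (K : Finset (Euc d)) (y : Euc d) : Euc d →ᵃ[ℝ] ℝ :=
  if h : IsSimplex K ∧ y ∈ K then h.1.basis.coord ⟨y, h.2⟩ else 0

theorem baryCoord_of_notMem {d : ℕ} {K : Finset (Euc d)} {y : Euc d} (hy : y ∉ K) (x : Euc d) :
    baryCoord K y x = 0 := by
  simp [baryCoord, hy]

theorem continuous_baryCoord {d : ℕ} (K : Finset (Euc d)) (y : Euc d) :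
    Continuous (baryCoord K y) := AffineMap.continuous_of_finiteDimensional _

theorem baryCoord_add_smul {d : ℕ} (K : Finset (Euc d)) (y x v : Euc d) (t : ℝ) :
    baryCoord K y (x + t • v) = baryCoord K y x + t * (baryCoord K y).linear v := by
  have := (baryCoord K y).map_vadd x (t • v)
  simp only [vadd_eq_add, map_smul, smul_eq_mul] at this
  rw [add_comm x, this, add_comm]

theorem baryCoord_sub {d : ℕ} (K : Finset (Euc d)) (y x z : Euc d) :
    baryCoord K y x - baryCoord K y z = (baryCoord K y).linear (x - z) := by
  have := (baryCoord K y).linearMap_vsub x z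
  simpa using this.symm

namespace IsSimplex

variable {d : ℕ} {K : Finset (Euc d)}

theorem baryCoord_apply (hK : IsSimplex K) (y : K) (x : Euc d) :
    baryCoord K y x = hK.basis.coord y x := by
  simp [baryCoord, hK]

theorem sum_baryCoord (hK : IsSimplex K) (x : Euc d) : ∑ y ∈ K, baryCoord K y x = 1 := by
  rw [← hK.basis.sum_coord_apply_eq_one x, ← Finset.sum_coe_sort]
  exact Finset.sum_congr rfl fun y _ => hK.baryCoord_apply y x

theorem sum_baryCoord_smul (hK : IsSimplex K) (x : Euc d) :
    ∑ y ∈ K, baryCoord K y x • y = x := by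
  conv_rhs => rw [← hK.basis.linear_combination_coord_eq_self x]
  rw [← Finset.sum_coe_sort]
  exact Finset.sum_congr rfl fun y _ => by rw [hK.baryCoord_apply y x]; rfl

theorem baryCoord_eq (hK : IsSimplex K) {w : Euc d → ℝ} {x : Euc d} (h1 : ∑ y ∈ K, w y = 1)
    (hx : ∑ y ∈ K, w y • y = x) {y : Euc d} (hy : y ∈ K) : baryCoord K y x = w y := by
  have h1' : ∑ z : K, w z = 1 := by rw [Finset.sum_coe_sort K w]; exact h1
  have := hK.basis.coord_apply_combination_of_mem (s := Finset.univ) (i := ⟨y, hy⟩)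
    (Finset.mem_univ _) (w := fun z : K => w z) h1'
  rw [Finset.univ.affineCombination_eq_linear_combination _ _ h1'] at this
  have hx' : ∑ z : K, w z • hK.basis z = x := by
    rw [← hx, ← Finset.sum_coe_sort K fun z => w z • z]; rfl
  rw [hx'] at this
  rw [hK.baryCoord_apply ⟨y, hy⟩, this]

theorem baryCoord_vertex (hK : IsSimplex K) [DecidableEq (Euc d)] {y z : Euc d} (hy : y ∈ K)
    (hz : z ∈ K) : baryCoord K y z = if y = z then 1 else 0 := by
  apply hK.baryCoord_eq (w := fun y => if y = z then 1 else 0) _ _ hy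
  · simp [hz]
  · simp [hz]

theorem mem_hull_iff (hK : IsSimplex K) {x : Euc d} :
    x ∈ hull K ↔ ∀ y ∈ K, 0 ≤ baryCoord K y x := by
  have := hK.basis.convexHull_eq_nonneg_coord
  rw [hK.range_basis] at this
  rw [hull, this]
  simp only [Set.mem_ofPred_eq, Subtype.forall]
  exact forall₂_congr fun y hy => by rw [hK.baryCoord_apply ⟨y, hy⟩]

theorem mem_interior_iff (hK : IsSimplex K) {x : Euc d} :
    x ∈ interior (hull K) ↔ ∀ y ∈ K, 0 < baryCoord K y x := by
  have := hK.basis.interior_convexHull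
  rw [hK.range_basis] at this
  rw [hull, this]
  simp only [Set.mem_ofPred_eq, Subtype.forall]
  exact forall₂_congr fun y hy => by rw [hK.baryCoord_apply ⟨y, hy⟩]

theorem interior_nonempty (hK : IsSimplex K) : (interior (hull K)).Nonempty := by
  rw [hull, interior_convexHull_nonempty_iff_affineSpan_eq_top]
  have := hK.affineSpan_eq_top
  rwa [Subtype.range_coe] at this

theorem subset_closure_interior (hK : IsSimplex K) : hull K ⊆ closure (interior (hull K)) := by
  rw [(convex_hull K).closure_interior_eq_closure_of_nonempty_interior hK.interior_nonempty]
  exact subset_closure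

theorem nonempty_vertices (hK : IsSimplex K) : K.Nonempty := by
  rw [← Finset.card_pos, hK.card_eq]; omega

theorem volume_pos (hK : IsSimplex K) : 0 < volume (hull K) :=
  (isOpen_interior.measure_pos volume hK.interior_nonempty).trans_le
    (measure_mono interior_subset)

theorem measureReal_pos (hK : IsSimplex K) : 0 < volume.real (hull K) :=
  ENNReal.toReal_pos hK.volume_pos.ne' (volume_hull_lt_top K).ne

theorem baryCoord_le_one (hK : IsSimplex K) {x y : Euc d} (hx : x ∈ hull K) :
    baryCoord K y x ≤ 1 := by
  by_cases hy : y ∈ K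
  · rw [← hK.sum_baryCoord x]
    exact Finset.single_le_sum (f := fun y => baryCoord K y x)
      (fun z hz => hK.mem_hull_iff.1 hx z hz) hy
  · rw [baryCoord_of_notMem hy]; exact zero_le_one

theorem baryCoord_nonneg (hK : IsSimplex K) {x y : Euc d} (hx : x ∈ hull K) :
    0 ≤ baryCoord K y x := by
  by_cases hy : y ∈ K
  · exact hK.mem_hull_iff.1 hx y hy
  · rw [baryCoord_of_notMem hy]

/-- A point of a simplex lies in the subsimplex spanned by `S` iff the coordinates belonging to the
other vertices vanish. -/
theorem mem_hull_subset_iff (hK : IsSimplex K) {S : Finset (Euc d)} (hS : S ⊆ K) {x : Euc d} :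
    x ∈ hull S ↔ x ∈ hull K ∧ ∀ y ∈ K, y ∉ S → baryCoord K y x = 0 := by
  classical
  constructor
  · intro hx
    refine ⟨hull_mono hS hx, fun y hy hyS => ?_⟩
    obtain ⟨w, -, hw1, hwx⟩ := Finset.mem_convexHull'.1 hx
    have := hK.baryCoord_eq (w := fun y => if y ∈ S then w y else 0) (x := x) ?_ ?_ hy
    · simpa [hyS] using this
    · rw [← Finset.sum_filter, Finset.filter_mem_eq_inter, Finset.inter_eq_right.2 hS, hw1]
    · simp only [ite_smul, zero_smul]
      rw [← Finset.sum_filter, Finset.filter_mem_eq_inter, Finset.inter_eq_right.2 hS, hwx]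
  · rintro ⟨hx, h0⟩
    refine Finset.mem_convexHull'.2 ⟨fun y => baryCoord K y x,
      fun y hy => hK.baryCoord_nonneg hx, ?_, ?_⟩
    · rw [← hK.sum_baryCoord x]
      exact Finset.sum_subset hS h0
    · conv_rhs => rw [← hK.sum_baryCoord_smul x]
      exact Finset.sum_subset hS fun y hy hyS => by simp [h0 y hy hyS]

theorem linear_sum (hK : IsSimplex K) (v : Euc d) :
    ∑ y ∈ K, (baryCoord K y).linear v = 0 := by
  have h := hK.sum_baryCoord v
  have h0 := hK.sum_baryCoord 0
  have : ∀ y, (baryCoord K y).linear v = baryCoord K y v - baryCoord K y 0 := fun y => by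
    rw [baryCoord_sub, sub_zero]
  simp only [this, Finset.sum_sub_distrib, h, h0, sub_self]

/-- Barycentric coordinates on a simplex that contains a ball of radius `r` are Lipschitz with
constant `1 / (2 r)`. -/
theorem abs_linear_le (hK : IsSimplex K) {c : Euc d} {r : ℝ} (hr : 0 < r)
    (hc : Metric.closedBall c r ⊆ hull K) (y v : Euc d) :
    |(baryCoord K y).linear v| ≤ ‖v‖ / (2 * r) := by
  wlog hv : v ≠ 0
  · push Not at hv; simp [hv]
  have hv0 : 0 < ‖v‖ := norm_pos_iff.2 hv
  have hn : ‖(r / ‖v‖) • v‖ = r := by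
    rw [norm_smul, Real.norm_of_nonneg (by positivity)]; field_simp
  -- Antipodal points of the ball are $2r$ apart, and the coordinate takes values in $[0,1]$ at
  -- both.
  have h1 : c + (r / ‖v‖) • v ∈ hull K := hc (by simp [hn])
  have h2 : c + (-(r / ‖v‖)) • v ∈ hull K := hc (by simp [hn])
  have e1 := baryCoord_add_smul K y c v (r / ‖v‖)
  have e2 := baryCoord_add_smul K y c v (-(r / ‖v‖))
  have b1 := hK.baryCoord_nonneg (y := y) h1
  have b2 := hK.baryCoord_nonneg (y := y) h2
  have b3 := hK.baryCoord_le_one (y := y) h1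
  have b4 := hK.baryCoord_le_one (y := y) h2
  have : |(r / ‖v‖) * (baryCoord K y).linear v| ≤ 1 / 2 := by
    rw [abs_le]; constructor <;> linarith
  rw [abs_mul, abs_of_pos (by positivity)] at this
  rw [le_div_iff₀ (by positivity)]
  rw [div_mul_eq_mul_div, div_le_iff₀ hv0] at this
  linarith

end IsSimplex

/-! ### Polynomial functions -/

/-- `f` is a polynomial function of total degree at most `n` on `ℝ^d`. -/
def PolyFun {d : ℕ} (n : ℕ) (f : Euc d → ℝ) : Prop :=
  ∃ p : MvPolynomial (Fin d) ℝ, p.totalDegree ≤ n ∧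
    ∀ x, f x = MvPolynomial.eval (fun i => x i) p

namespace PolyFun

variable {d n m : ℕ} {f g : Euc d → ℝ}

theorem mono (hf : PolyFun n f) (h : n ≤ m) : PolyFun m f := by
  obtain ⟨p, hp, hpf⟩ := hf
  exact ⟨p, hp.trans h, hpf⟩

theorem const (n : ℕ) (c : ℝ) : PolyFun n fun _ : Euc d => c :=
  ⟨MvPolynomial.C c, by simp, by simp⟩

theorem coord (i : Fin d) : PolyFun 1 fun x : Euc d => x i :=
  ⟨MvPolynomial.X i, by simp, by simp⟩

theorem add (hf : PolyFun n f) (hg : PolyFun n g) : PolyFun n fun x => f x + g x := by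
  obtain ⟨p, hp, hpf⟩ := hf
  obtain ⟨q, hq, hqg⟩ := hg
  exact ⟨p + q, (MvPolynomial.totalDegree_add p q).trans (max_le hp hq), fun x => by
    simp [hpf, hqg]⟩

theorem sub (hf : PolyFun n f) (hg : PolyFun n g) : PolyFun n fun x => f x - g x := by
  obtain ⟨p, hp, hpf⟩ := hf
  obtain ⟨q, hq, hqg⟩ := hg
  exact ⟨p - q, (MvPolynomial.totalDegree_sub p q).trans (max_le hp hq), fun x => by
    simp [hpf, hqg]⟩

theorem mul (hf : PolyFun n f) (hg : PolyFun m g) : PolyFun (n + m) fun x => f x * g x := by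
  obtain ⟨p, hp, hpf⟩ := hf
  obtain ⟨q, hq, hqg⟩ := hg
  exact ⟨p * q, (MvPolynomial.totalDegree_mul p q).trans (add_le_add hp hq), fun x => by
    simp [hpf, hqg]⟩

theorem const_mul (c : ℝ) (hf : PolyFun n f) : PolyFun n fun x => c * f x := by
  simpa using (const 0 c).mul hf

theorem sum {ι : Type*} (s : Finset ι) {f : ι → Euc d → ℝ} (hf : ∀ i ∈ s, PolyFun n (f i)) :
    PolyFun n fun x => ∑ i ∈ s, f i x := by
  classical
  induction s using Finset.induction_on with
  | empty => simpa using const n 0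
  | insert i s his ih =>
    simp only [Finset.sum_insert his]
    exact (hf i (Finset.mem_insert_self _ _)).add
      (ih fun j hj => hf j (Finset.mem_insert_of_mem hj))

theorem prod {ι : Type*} (s : Finset ι) {f : ι → Euc d → ℝ} {n : ι → ℕ}
    (hf : ∀ i ∈ s, PolyFun (n i) (f i)) : PolyFun (∑ i ∈ s, n i) fun x => ∏ i ∈ s, f i x := by
  classical
  induction s using Finset.induction_on with
  | empty => simpa using const 0 1
  | insert i s his ih =>
    simp only [Finset.prod_insert his, Finset.sum_insert his]
    exact (hf i (Finset.mem_insert_self _ _)).mul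
      (ih fun j hj => hf j (Finset.mem_insert_of_mem hj))

theorem pow (hf : PolyFun 1 f) (k : ℕ) : PolyFun k fun x => f x ^ k := by
  simpa using prod (Finset.range k) (f := fun _ => f) (n := fun _ => 1) fun _ _ => hf

theorem affine (f : Euc d →ᵃ[ℝ] ℝ) : PolyFun 1 f := by
  have h : ∀ x : Euc d, f x = f 0 + ∑ i, f.linear (EuclideanSpace.single i 1) * x i := by
    intro x
    have h1 : f x = f 0 + f.linear x := by
      have := f.linearMap_vsub x 0
      simp only [vsub_eq_sub, sub_zero] at this
      rw [this]; ring
    have h2 : x = ∑ i, x i • EuclideanSpace.single i (1 : ℝ) := by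
      ext j
      simp [Finset.sum_apply, Pi.single_apply]
    rw [h1]
    conv_lhs => rw [h2]
    simp [map_sum, mul_comm]
  have : (f : Euc d → ℝ) = fun x => f 0 + ∑ i, f.linear (EuclideanSpace.single i 1) * x i :=
    funext h
  rw [this]
  exact (const 1 _).add (sum _ fun i _ => (coord i).const_mul _)

theorem eq_sum (hf : PolyFun n f) : ∃ (s : Finset (Fin d →₀ ℕ)) (c : (Fin d →₀ ℕ) → ℝ),
    (∀ m ∈ s, ∑ i, m i ≤ n) ∧ ∀ x, f x = ∑ m ∈ s, c m * ∏ i, x i ^ m i := by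
  obtain ⟨p, hp, hpf⟩ := hf
  refine ⟨p.support, fun m => p.coeff m, fun m hm => ?_, fun x => ?_⟩
  · refine le_trans ?_ hp
    have := MvPolynomial.le_totalDegree hm
    rwa [Finsupp.sum_fintype _ _ (by simp)] at this
  · rw [hpf, MvPolynomial.eval_eq']

theorem comp_affine (hf : PolyFun n f) (A : Euc d → Euc d)
    (hA : ∀ i, PolyFun 1 fun x => A x i) : PolyFun n fun x => f (A x) := by
  obtain ⟨s, c, hs, hfs⟩ := hf.eq_sum
  simp only [hfs]
  refine sum _ fun m hm => const_mul _ ?_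
  exact (prod _ (f := fun i x => A x i ^ m i) (n := fun i => m i)
    fun i _ => (hA i).pow (m i)).mono (hs m hm)

theorem contDiff (hf : PolyFun n f) : ContDiff ℝ ∞ f := by
  obtain ⟨s, c, -, hfs⟩ := hf.eq_sum
  rw [show f = _ from funext hfs]
  refine ContDiff.sum fun m _ => contDiff_const.mul (contDiff_prod fun i _ => ?_)
  exact (contDiff_euclidean.1 contDiff_id i).pow _

end PolyFun

/-! ### Lagrange interpolation on a simplex -/

/-- The generalized binomial coefficient `t (t - 1) ⋯ (t - n + 1) / n!`. -/
noncomputable def realChoose (t : ℝ) : ℕ → ℝ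
  | 0 => 1
  | n + 1 => realChoose t n * ((t - n) / (n + 1))

theorem realChoose_succ (t : ℝ) (n : ℕ) :
    (n + 1) * realChoose t (n + 1) = (t - n) * realChoose t n := by
  have : (n : ℝ) + 1 ≠ 0 := by positivity
  rw [realChoose]; field_simp

theorem realChoose_natCast (m n : ℕ) : realChoose m n = m.choose n := by
  induction n with
  | zero => simp [realChoose]
  | succ n ih =>
    have h := realChoose_succ m n
    have hn : (n : ℝ) + 1 ≠ 0 := by positivity
    have h2 : (m.choose (n + 1) : ℝ) * (n + 1) = m.choose n * ((m : ℝ) - n) := by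
      rcases le_or_gt n m with hnm | hnm
      · have := Nat.choose_succ_right_eq m n
        rw [← Nat.cast_sub hnm]
        exact_mod_cast this
      · simp [Nat.choose_eq_zero_of_lt hnm, Nat.choose_eq_zero_of_lt (Nat.lt_succ_of_lt hnm)]
    apply mul_left_cancel₀ hn
    rw [h, ih, mul_comm _ (m.choose (n + 1) : ℝ), h2, mul_comm]

/-- Makes a Lagrange function vanish wherever a coordinate with positive index vanishes. Hence
restrictions to subsimplices do not see the remaining nodes. -/
theorem realChoose_zero_succ (n : ℕ) : realChoose 0 (n + 1) = 0 := by
  have := realChoose_natCast 0 (n + 1)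
  simpa using this

/-- The Lagrange node with barycentric coordinates `a y / ℓ`. -/
noncomputable def lagrangeNode {d : ℕ} (ℓ : ℕ) (a : Euc d →₀ ℕ) : Euc d :=
  ∑ y ∈ a.support, ((a y : ℝ) / (ℓ : ℝ)) • y

/-- The Lagrange basis function of degree `ℓ` of the simplex `K` that belongs to the node `a`. -/
noncomputable def lagrangeBasis {d : ℕ} (ℓ : ℕ) (K : Finset (Euc d)) (a : Euc d →₀ ℕ)
    (x : Euc d) : ℝ :=
  ∏ y ∈ K, realChoose (ℓ * baryCoord K y x) (a y)

open Classical in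
/-- The multi-indices of the Lagrange nodes in the simplex `K`. -/
noncomputable def nodeIndex {d : ℕ} (ℓ : ℕ) (K : Finset (Euc d)) : Finset (Euc d →₀ ℕ) :=
  K.finsuppAntidiag ℓ

theorem mem_nodeIndex {d ℓ : ℕ} {K : Finset (Euc d)} {a : Euc d →₀ ℕ} :
    a ∈ nodeIndex ℓ K ↔ ∑ y ∈ K, a y = ℓ ∧ a.support ⊆ K := by
  simp [nodeIndex, Finset.mem_finsuppAntidiag]

theorem nodeIndex_mono {d ℓ : ℕ} {K L : Finset (Euc d)} (h : K ⊆ L) :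
    nodeIndex ℓ K ⊆ nodeIndex ℓ L := by
  intro a ha
  rw [mem_nodeIndex] at ha ⊢
  refine ⟨?_, ha.2.trans h⟩
  rw [← ha.1]
  symm
  exact Finset.sum_subset h fun y _ hy => Finsupp.notMem_support_iff.1 fun h' => hy (ha.2 h')

/-- The Lagrange interpolant of `c` on the simplex `K`. -/
noncomputable def interp {d : ℕ} (ℓ : ℕ) (K : Finset (Euc d)) (c : Euc d → ℝ) (x : Euc d) : ℝ :=
  ∑ a ∈ nodeIndex ℓ K, c (lagrangeNode ℓ a) * lagrangeBasis ℓ K a x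

theorem lagrangeNode_eq_sum {d ℓ : ℕ} {K : Finset (Euc d)} {a : Euc d →₀ ℕ}
    (ha : a ∈ nodeIndex ℓ K) : lagrangeNode ℓ a = ∑ y ∈ K, ((a y : ℝ) / (ℓ : ℝ)) • y :=
  Finset.sum_subset (mem_nodeIndex.1 ha).2 fun y _ hy => by
    simp [Finsupp.notMem_support_iff.1 hy]

theorem sum_nodeIndex_div {d ℓ : ℕ} (hℓ : 1 ≤ ℓ) {K : Finset (Euc d)} {a : Euc d →₀ ℕ}
    (ha : a ∈ nodeIndex ℓ K) : ∑ y ∈ K, (a y : ℝ) / (ℓ : ℝ) = 1 := by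
  have : (ℓ : ℝ) ≠ 0 := by positivity
  rw [← Finset.sum_div, div_eq_one_iff_eq this]
  exact_mod_cast (mem_nodeIndex.1 ha).1

theorem lagrangeNode_mem_hull {d ℓ : ℕ} (hℓ : 1 ≤ ℓ) {K : Finset (Euc d)} {a : Euc d →₀ ℕ}
    (ha : a ∈ nodeIndex ℓ K) : lagrangeNode ℓ a ∈ hull K :=
  Finset.mem_convexHull'.2 ⟨fun y => (a y : ℝ) / ℓ, fun y _ => by positivity,
    sum_nodeIndex_div hℓ ha, (lagrangeNode_eq_sum ha).symm⟩

theorem SimplicialMesh.lagrangeNode_mem_nodes {d ℓ : ℕ} (T : SimplicialMesh d)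
    {K : Finset (Euc d)} (hK : K ∈ T.elems) {a : Euc d →₀ ℕ} (ha : a ∈ nodeIndex ℓ K) :
    lagrangeNode ℓ a ∈ T.nodes ℓ :=
  ⟨K, hK, a, (mem_nodeIndex.1 ha).1, lagrangeNode_eq_sum ha⟩

theorem polyFun_realChoose {d : ℕ} {f : Euc d → ℝ} (hf : PolyFun 1 f) (n : ℕ) :
    PolyFun n fun x => realChoose (f x) n := by
  induction n with
  | zero => simpa [realChoose] using PolyFun.const 0 1
  | succ n ih =>
    simp only [realChoose]
    refine ih.mul ?_
    simp only [div_eq_inv_mul]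
    exact (hf.sub (PolyFun.const 1 _)).const_mul _

theorem polyFun_lagrangeBasis {d ℓ : ℕ} {K : Finset (Euc d)} {a : Euc d →₀ ℕ}
    (ha : a ∈ nodeIndex ℓ K) : PolyFun ℓ (lagrangeBasis ℓ K a) := by
  rw [← (mem_nodeIndex.1 ha).1]
  exact PolyFun.prod _ fun y _ =>
    polyFun_realChoose ((PolyFun.affine (baryCoord K y)).const_mul _) (a y)

theorem polyFun_interp {d : ℕ} (ℓ : ℕ) (K : Finset (Euc d)) (c : Euc d → ℝ) :
    PolyFun ℓ (interp ℓ K c) :=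
  PolyFun.sum _ fun _ ha => (polyFun_lagrangeBasis ha).const_mul _

/-- On a subsimplex, the interpolant depends only on the subsimplex. -/
theorem interp_eq_of_subset {d : ℕ} (ℓ : ℕ) {K S : Finset (Euc d)} (hK : IsSimplex K)
    (hS : S ⊆ K) (c : Euc d → ℝ) {x : Euc d} {w : Euc d → ℝ} (h1 : ∑ y ∈ S, w y = 1)
    (hx : ∑ y ∈ S, w y • y = x) :
    interp ℓ K c x = ∑ a ∈ nodeIndex ℓ S,
      c (lagrangeNode ℓ a) * ∏ y ∈ S, realChoose (ℓ * w y) (a y) := by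
  classical
  have hb : ∀ y ∈ K, baryCoord K y x = if y ∈ S then w y else 0 := by
    intro y hy
    refine hK.baryCoord_eq (w := fun y => if y ∈ S then w y else 0) ?_ ?_ hy
    · rw [← Finset.sum_filter, Finset.filter_mem_eq_inter, Finset.inter_eq_right.2 hS, h1]
    · simp only [ite_smul, zero_smul]
      rw [← Finset.sum_filter, Finset.filter_mem_eq_inter, Finset.inter_eq_right.2 hS, hx]
  symm
  rw [interp]
  refine Finset.sum_subset_zero_on_sdiff (nodeIndex_mono hS) ?_ ?_
  · intro a ha
    rw [Finset.mem_sdiff, mem_nodeIndex, mem_nodeIndex] at ha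
    -- A node that does not belong to `S` has a positive index at some vertex outside `S`. The
    -- coordinate of `x` there is zero, which kills one factor of the product.
    obtain ⟨y, hy, hyS⟩ : ∃ y ∈ a.support, y ∉ S := by
      by_contra! hcon
      refine ha.2 ⟨?_, hcon⟩
      rw [← ha.1.1]
      exact Finset.sum_subset hS fun y _ hy =>
        Finsupp.notMem_support_iff.1 fun h' => hy (hcon y h')
    have hyK := ha.1.2 hy
    rw [lagrangeBasis, Finset.prod_eq_zero hyK, mul_zero]
    obtain ⟨k, hk⟩ := Nat.exists_eq_succ_of_ne_zero (Finsupp.mem_support_iff.1 hy)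
    rw [hb y hyK, if_neg hyS, mul_zero, hk, realChoose_zero_succ]
  · intro a ha
    rw [lagrangeBasis]
    congr 1
    rw [← Finset.prod_subset hS]
    · exact Finset.prod_congr rfl fun y hy => by rw [hb y (hS hy), if_pos hy]
    · intro y _ hy
      rw [Finsupp.notMem_support_iff.1 fun h' => hy ((mem_nodeIndex.1 ha).2 h'), realChoose]

/-- At the node `b` the product equals $\prod_y\binom{b_y}{a_y}$. It vanishes unless $a\le b$, and
then equal total degrees force $a=b$. -/
theorem lagrangeBasis_node {d ℓ : ℕ} (hℓ : 1 ≤ ℓ) {K : Finset (Euc d)} (hK : IsSimplex K)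
    [DecidableEq (Euc d →₀ ℕ)] {a b : Euc d →₀ ℕ} (ha : a ∈ nodeIndex ℓ K)
    (hb : b ∈ nodeIndex ℓ K) :
    lagrangeBasis ℓ K a (lagrangeNode ℓ b) = if a = b then 1 else 0 := by
  have hℓ0 : (ℓ : ℝ) ≠ 0 := by positivity
  have h : lagrangeBasis ℓ K a (lagrangeNode ℓ b) = ∏ y ∈ K, ((b y).choose (a y) : ℝ) := by
    refine Finset.prod_congr rfl fun y hy => ?_
    rw [hK.baryCoord_eq (sum_nodeIndex_div hℓ hb) (lagrangeNode_eq_sum hb).symm hy,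
      mul_div_cancel₀ _ hℓ0, realChoose_natCast]
  rw [h]
  rw [mem_nodeIndex] at ha hb
  split_ifs with hab
  · subst hab; simp
  · by_cases hle : ∀ y ∈ K, a y ≤ b y
    · exfalso
      apply hab
      have := (Finset.sum_eq_sum_iff_of_le hle).1 (ha.1.trans hb.1.symm)
      ext y
      by_cases hy : y ∈ K
      · exact this y hy
      · rw [Finsupp.notMem_support_iff.1 fun h' => hy (ha.2 h'),
          Finsupp.notMem_support_iff.1 fun h' => hy (hb.2 h')]
    · push Not at hle
      obtain ⟨y, hy, hlt⟩ := hle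
      exact Finset.prod_eq_zero hy (by rw [Nat.choose_eq_zero_of_lt hlt, Nat.cast_zero])

/-! ### Lagrange functions span the polynomials of degree at most $\ell$. -/

/-- The span of the products of `k` shifted barycentric factors. -/
noncomputable def lagrangeSpan {d : ℕ} (ℓ : ℕ) (K : Finset (Euc d)) (k : ℕ) :
    Submodule ℝ (Euc d → ℝ) :=
  Submodule.span ℝ (lagrangeBasis ℓ K '' (nodeIndex k K))

theorem add_single_mem_nodeIndex {d k : ℕ} {K : Finset (Euc d)} {a : Euc d →₀ ℕ}
    (ha : a ∈ nodeIndex k K) {y : Euc d} (hy : y ∈ K) :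
    a + Finsupp.single y 1 ∈ nodeIndex (k + 1) K := by
  classical
  rw [mem_nodeIndex] at ha ⊢
  constructor
  · simp [Finset.sum_add_distrib, ha.1, Finsupp.single_apply, hy]
  · refine Finsupp.support_add.trans (Finset.union_subset ha.2 ?_)
    exact Finsupp.support_single_subset.trans (by simpa using hy)

/-- The identity $t\binom tn=(n+1)\binom t{n+1}+n\binom tn$ in the factor of the vertex `y`. It
drives the whole spanning argument. -/
theorem baryCoord_mul_lagrangeBasis {d : ℕ} (ℓ : ℕ) {K : Finset (Euc d)} (a : Euc d →₀ ℕ)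
    {y : Euc d} (hy : y ∈ K) (x : Euc d) :
    (ℓ * baryCoord K y x) * lagrangeBasis ℓ K a x =
      (a y + 1) * lagrangeBasis ℓ K (a + Finsupp.single y 1) x + a y * lagrangeBasis ℓ K a x := by
  classical
  simp only [lagrangeBasis]
  rw [← Finset.mul_prod_erase K (fun z => realChoose (ℓ * baryCoord K z x) (a z)) hy,
    ← Finset.mul_prod_erase K (fun z => realChoose (ℓ * baryCoord K z x)
      ((a + Finsupp.single y 1 : Euc d →₀ ℕ) z)) hy]
  have h1 : ∏ z ∈ K.erase y, realChoose (ℓ * baryCoord K z x)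
      ((a + Finsupp.single y 1 : Euc d →₀ ℕ) z) =
      ∏ z ∈ K.erase y, realChoose (ℓ * baryCoord K z x) (a z) := by
    refine Finset.prod_congr rfl fun z hz => ?_
    rw [Finsupp.add_apply, Finsupp.single_eq_of_ne (Finset.ne_of_mem_erase hz), add_zero]
  rw [h1, Finsupp.add_apply, Finsupp.single_eq_same]
  have h2 := realChoose_succ (ℓ * baryCoord K y x) (a y)
  rw [← mul_assoc ((a y : ℝ) + 1), h2]
  ring

/-- Summing the product recurrence over all vertices, where the coordinates add up to one, gives
$(\ell-k)B_a=\sum_y(a_y+1)B_{a+e_y}$. For $k<\ell$ one may divide. -/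
theorem lagrangeSpan_mono {d ℓ k : ℕ} {K : Finset (Euc d)} (hK : IsSimplex K) (hk : k < ℓ) :
    lagrangeSpan ℓ K k ≤ lagrangeSpan ℓ K (k + 1) := by
  refine Submodule.span_le.2 ?_
  rintro _ ⟨a, ha, rfl⟩
  have hne : (ℓ : ℝ) - k ≠ 0 := sub_ne_zero.2 (by exact_mod_cast hk.ne')
  have : lagrangeBasis ℓ K a = ((ℓ : ℝ) - k)⁻¹ • ∑ y ∈ K,
      ((a y : ℝ) + 1) • lagrangeBasis ℓ K (a + Finsupp.single y 1) := by
    ext x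
    have h := Finset.sum_congr rfl fun y hy => baryCoord_mul_lagrangeBasis ℓ (K := K) a hy x
    rw [← Finset.sum_mul, ← Finset.mul_sum, hK.sum_baryCoord, mul_one,
      Finset.sum_add_distrib, ← Finset.sum_mul _ _ (lagrangeBasis ℓ K a x),
      ← Nat.cast_sum, (mem_nodeIndex.1 ha).1] at h
    simp only [Pi.smul_apply, Finset.sum_apply, smul_eq_mul]
    rw [eq_inv_mul_iff_mul_eq₀ hne]
    linarith
  rw [this]
  refine Submodule.smul_mem _ _ (Submodule.sum_mem _ fun y hy => Submodule.smul_mem _ _ ?_)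
  exact Submodule.subset_span ⟨_, add_single_mem_nodeIndex ha hy, rfl⟩

theorem baryCoord_mul_mem_lagrangeSpan {d ℓ k : ℕ} {K : Finset (Euc d)} (hK : IsSimplex K)
    (hk : k < ℓ) {f : Euc d → ℝ} (hf : f ∈ lagrangeSpan ℓ K k) {y : Euc d} (hy : y ∈ K) :
    (fun x => baryCoord K y x * f x) ∈ lagrangeSpan ℓ K (k + 1) := by
  have hℓ : (ℓ : ℝ) ≠ 0 := by exact_mod_cast (by omega : ℓ ≠ 0)
  induction hf using Submodule.span_induction with
  | mem f hf =>
    obtain ⟨a, ha, rfl⟩ := hf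
    have : (fun x => baryCoord K y x * lagrangeBasis ℓ K a x) = (ℓ : ℝ)⁻¹ •
        (((a y : ℝ) + 1) • lagrangeBasis ℓ K (a + Finsupp.single y 1) +
          (a y : ℝ) • lagrangeBasis ℓ K a) := by
      ext x
      have := baryCoord_mul_lagrangeBasis ℓ a hy x
      simp only [Pi.smul_apply, Pi.add_apply, smul_eq_mul]
      rw [← this]; field_simp
    rw [this]
    refine Submodule.smul_mem _ _ (Submodule.add_mem _ (Submodule.smul_mem _ _ ?_)
      (Submodule.smul_mem _ _ ?_))
    · exact Submodule.subset_span ⟨_, add_single_mem_nodeIndex ha hy, rfl⟩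
    · exact lagrangeSpan_mono hK hk (Submodule.subset_span ⟨a, ha, rfl⟩)
  | zero =>
    convert (lagrangeSpan ℓ K (k + 1)).zero_mem using 1
    ext x; simp
  | add f g _ _ hf hg =>
    convert Submodule.add_mem _ hf hg using 1
    ext x; simp [mul_add]
  | smul c f _ hf =>
    convert Submodule.smul_mem _ c hf using 1
    ext x; simp [mul_left_comm]

/-- A Cartesian coordinate is the combination of barycentric ones with the vertex coordinates as
coefficients, so monomials can be built one factor at a time. -/
theorem coord_mul_mem_lagrangeSpan {d ℓ k : ℕ} {K : Finset (Euc d)} (hK : IsSimplex K)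
    (hk : k < ℓ) {f : Euc d → ℝ} (hf : f ∈ lagrangeSpan ℓ K k) (i : Fin d) :
    (fun x => x i * f x) ∈ lagrangeSpan ℓ K (k + 1) := by
  have : (fun x => x i * f x) = ∑ y ∈ K, y i • fun x => baryCoord K y x * f x := by
    ext x
    have h := congrArg (fun z : Euc d => z i) (hK.sum_baryCoord_smul x)
    simp only [WithLp.ofLp_sum, Finset.sum_apply, PiLp.smul_apply, smul_eq_mul] at h
    simp only [Finset.sum_apply, Pi.smul_apply, smul_eq_mul]
    rw [← h, Finset.sum_mul]
    exact Finset.sum_congr rfl fun y _ => by ring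
  rw [this]
  exact Submodule.sum_mem _ fun y hy => Submodule.smul_mem _ _
    (baryCoord_mul_mem_lagrangeSpan hK hk hf hy)

theorem multiset_prod_mem_lagrangeSpan {d ℓ : ℕ} {K : Finset (Euc d)} (hK : IsSimplex K)
    (s : Multiset (Fin d)) (hs : s.card ≤ ℓ) :
    (fun x : Euc d => (s.map fun i => x i).prod) ∈ lagrangeSpan ℓ K s.card := by
  induction s using Multiset.induction_on with
  | empty =>
    refine Submodule.subset_span ⟨0, by simp [mem_nodeIndex], ?_⟩
    ext x; simp [lagrangeBasis, realChoose]
  | cons i s ih =>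
    rw [Multiset.card_cons] at hs ⊢
    simp only [Multiset.map_cons, Multiset.prod_cons]
    exact coord_mul_mem_lagrangeSpan hK (by omega) (ih (by omega)) i

theorem lagrangeSpan_le {d ℓ k : ℕ} {K : Finset (Euc d)} (hK : IsSimplex K) (hk : k ≤ ℓ) :
    lagrangeSpan ℓ K k ≤ lagrangeSpan ℓ K ℓ := by
  induction hk using Nat.decreasingInduction with
  | self => exact le_rfl
  | of_succ k hk ih => exact (lagrangeSpan_mono hK hk).trans ih

theorem PolyFun.mem_lagrangeSpan {d ℓ : ℕ} {K : Finset (Euc d)} (hK : IsSimplex K)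
    {f : Euc d → ℝ} (hf : PolyFun ℓ f) : f ∈ lagrangeSpan ℓ K ℓ := by
  obtain ⟨s, c, hs, hfs⟩ := hf.eq_sum
  have : f = ∑ m ∈ s, c m • fun x : Euc d => ((Finsupp.toMultiset m).map fun i => x i).prod := by
    ext x
    simp only [hfs, Finset.sum_apply, Pi.smul_apply, smul_eq_mul]
    refine Finset.sum_congr rfl fun m _ => ?_
    rw [Finsupp.toMultiset_map, Finsupp.prod_toMultiset,
      Finsupp.prod_mapDomain_index (by simp) (by simp [pow_add]), Finsupp.prod_fintype _ _ (by simp)]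
  rw [this]
  refine Submodule.sum_mem _ fun m hm => Submodule.smul_mem _ _ ?_
  have hc : (Finsupp.toMultiset m).card ≤ ℓ := by
    rw [Finsupp.card_toMultiset, Finsupp.sum_fintype _ _ (by simp)]; exact hs m hm
  exact lagrangeSpan_le hK hc (multiset_prod_mem_lagrangeSpan hK _ hc)

/-- Lagrange interpolation reproduces polynomials. -/
theorem interp_self {d ℓ : ℕ} (hℓ : 1 ≤ ℓ) {K : Finset (Euc d)} (hK : IsSimplex K)
    {f : Euc d → ℝ} (hf : PolyFun ℓ f) : interp ℓ K f = f := by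
  classical
  have := hf.mem_lagrangeSpan hK
  clear hf
  induction this using Submodule.span_induction with
  | mem f hf =>
    obtain ⟨a, ha, rfl⟩ := hf
    ext x
    rw [interp, Finset.sum_eq_single a]
    · rw [lagrangeBasis_node hℓ hK ha ha, if_pos rfl, one_mul]
    · intro b hb hba
      rw [lagrangeBasis_node hℓ hK ha hb, if_neg hba.symm, zero_mul]
    · exact fun h => absurd ha h
  | zero => ext x; simp [interp]
  | add f g _ _ hf hg =>
    conv_rhs => rw [← hf, ← hg]
    ext x
    simp [interp, add_mul, Finset.sum_add_distrib]
  | smul c f _ hf =>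
    conv_rhs => rw [← hf]
    ext x
    simp [interp, Finset.mul_sum, mul_assoc]

theorem interp_node {d ℓ : ℕ} (hℓ : 1 ≤ ℓ) {K : Finset (Euc d)} (hK : IsSimplex K)
    (c : Euc d → ℝ) {a : Euc d →₀ ℕ} (ha : a ∈ nodeIndex ℓ K) :
    interp ℓ K c (lagrangeNode ℓ a) = c (lagrangeNode ℓ a) := by
  classical
  rw [interp, Finset.sum_eq_single a]
  · rw [lagrangeBasis_node hℓ hK ha ha, if_pos rfl, mul_one]
  · intro b hb hba
    rw [lagrangeBasis_node hℓ hK hb ha, if_neg hba, mul_zero]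
  · exact fun h => absurd ha h

/-! ### Poincaré and Friedrichs inequalities for smooth functions -/

/-- Cauchy–Schwarz against the constant one, read off from $\int(cf-m)^2\ge0$ with $c$ the total
mass and $m$ the integral. Multiplying by $c$ avoids a division until the mass is known to be
positive. -/
theorem sq_integral_le {α : Type*} [MeasurableSpace α] {μ : Measure α} [IsFiniteMeasure μ]
    {f : α → ℝ} (hf : Integrable f μ) (hf2 : Integrable (fun x => f x ^ 2) μ) :
    (∫ x, f x ∂μ) ^ 2 ≤ μ.real Set.univ * ∫ x, f x ^ 2 ∂μ := by
  set m := ∫ x, f x ∂μ with hm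
  set c := μ.real Set.univ with hc
  have h0 : 0 ≤ ∫ x, (c * f x - m) ^ 2 ∂μ := integral_nonneg fun x => sq_nonneg _
  have h1 : ∫ x, (c * f x - m) ^ 2 ∂μ = c ^ 2 * ∫ x, f x ^ 2 ∂μ - c * m ^ 2 := by
    have : ∀ x, (c * f x - m) ^ 2 = c ^ 2 * f x ^ 2 - 2 * c * m * f x + m ^ 2 := fun x => by ring
    simp only [this]
    rw [integral_add, integral_sub, integral_const_mul, integral_const_mul, integral_const,
      smul_eq_mul, ← hm, ← hc]
    · ring
    · exact hf2.const_mul _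
    · exact hf.const_mul _
    · exact (hf2.const_mul _).sub (hf.const_mul _)
    · exact integrable_const _
  rcases (measureReal_nonneg : 0 ≤ μ.real Set.univ).eq_or_lt with h | h
  · have hμ : μ = 0 := by
      rw [← Measure.measure_univ_eq_zero]
      exact ((measureReal_eq_zero_iff (measure_ne_top _ _)).1 h.symm)
    simp [hm, hμ]
  · rw [← hc] at h
    have : 0 ≤ c * (c * ∫ x, f x ^ 2 ∂μ - m ^ 2) := by nlinarith
    nlinarith [nonneg_of_mul_nonneg_right this h]

theorem norm_gradient {d : ℕ} (f : Euc d → ℝ) (x : Euc d) : ‖gradient f x‖ = ‖fderiv ℝ f x‖ :=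
  (InnerProductSpace.toDual ℝ (Euc d)).symm.norm_map _

section Smooth

variable {d : ℕ} {G : Euc d → ℝ}

theorem continuous_norm_fderiv_sq (hG : ContDiff ℝ 1 G) :
    Continuous fun x => ‖fderiv ℝ G x‖ ^ 2 :=
  ((hG.continuous_fderiv one_ne_zero).norm).pow 2

/-- The fundamental theorem of calculus along the segment, followed by Cauchy–Schwarz in the
parameter. -/
theorem sq_increment_le (hG : ContDiff ℝ 1 G) (x v : Euc d) {s : ℝ} (hs : 0 ≤ s) :
    (G (x + s • v) - G x) ^ 2 ≤
      s * ‖v‖ ^ 2 * ∫ τ in (0 : ℝ)..s, ‖fderiv ℝ G (x + τ • v)‖ ^ 2 := by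
  have hc : Continuous fun τ : ℝ => x + τ • v := by fun_prop
  have hd : ∀ τ : ℝ, HasDerivAt (fun τ : ℝ => G (x + τ • v)) (fderiv ℝ G (x + τ • v) v) τ := by
    intro τ
    have h1 : HasDerivAt (fun τ : ℝ => x + τ • v) v τ := by
      simpa using ((hasDerivAt_id τ).smul_const v).const_add x
    exact ((hG.differentiable one_ne_zero) _).hasFDerivAt.comp_hasDerivAt τ h1
  have hfd : Continuous fun τ : ℝ => fderiv ℝ G (x + τ • v) :=
    (hG.continuous_fderiv one_ne_zero).comp hc
  have hfdv : Continuous fun τ : ℝ => fderiv ℝ G (x + τ • v) v := hfd.clm_apply continuous_const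
  have h := intervalIntegral.integral_eq_sub_of_hasDerivAt (a := 0) (b := s)
    (fun τ _ => hd τ) (hfdv.intervalIntegrable _ _)
  simp only [zero_smul, add_zero] at h
  rw [← h, intervalIntegral.integral_of_le hs, intervalIntegral.integral_of_le hs]
  have hi : ∀ {f : ℝ → ℝ}, Continuous f → Integrable f (volume.restrict (Set.Ioc 0 s)) :=
    fun hf => hf.integrableOn_Ioc
  have h2 := sq_integral_le (hi hfdv) (hi (hfdv.pow 2))
  rw [measureReal_restrict_apply_univ, Real.volume_real_Ioc_of_le hs, sub_zero] at h2
  refine h2.trans ?_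
  rw [mul_assoc]
  refine mul_le_mul_of_nonneg_left ?_ hs
  rw [← integral_const_mul]
  refine integral_mono (hi (hfdv.pow 2)) (hi ((hfd.norm.pow 2).const_mul _)) fun τ => ?_
  have := (fderiv ℝ G (x + τ • v)).le_opNorm v
  calc (fderiv ℝ G (x + τ • v) v) ^ 2 = ‖fderiv ℝ G (x + τ • v) v‖ ^ 2 := by simp
    _ ≤ (‖fderiv ℝ G (x + τ • v)‖ * ‖v‖) ^ 2 := by gcongr
    _ = _ := by ring

/-- The squared norm of the derivative of `G`, extended by zero outside of `K`. -/
noncomputable def gradEnergy (G : Euc d → ℝ) (K : Set (Euc d)) : Euc d → ENNReal :=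
  K.indicator fun x => ENNReal.ofReal (‖fderiv ℝ G x‖ ^ 2)

theorem measurable_gradEnergy (hG : ContDiff ℝ 1 G) {K : Set (Euc d)} (hK : MeasurableSet K) :
    Measurable (gradEnergy G K) :=
  (ENNReal.continuous_ofReal.comp (continuous_norm_fderiv_sq hG)).measurable.indicator hK

theorem IsCompact.integrableOn_of_continuous {f : Euc d → ℝ} {K : Set (Euc d)}
    (hK : IsCompact K) (hf : Continuous f) : IntegrableOn f K :=
  hf.continuousOn.integrableOn_compact hK

theorem lintegral_gradEnergy (hG : ContDiff ℝ 1 G) {K : Set (Euc d)} (hK : IsCompact K) :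
    ∫⁻ x, gradEnergy G K x = ENNReal.ofReal (∫ x in K, ‖fderiv ℝ G x‖ ^ 2) := by
  rw [gradEnergy, lintegral_indicator hK.measurableSet, ofReal_integral_eq_lintegral_ofReal]
  · exact hK.integrableOn_of_continuous (continuous_norm_fderiv_sq hG)
  · exact Eventually.of_forall fun x => by positivity

/-- The parameter range is enlarged to $[0,1]$, independently of `x`. The energy is extended by zero
and written as a lower Lebesgue integral, so that Tonelli applies without integrability checks. -/
theorem ofReal_sq_increment_le (hG : ContDiff ℝ 1 G) {K : Set (Euc d)} {x v : Euc d} {s h : ℝ}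
    (hs : 0 ≤ s) (hs1 : s ≤ 1) (hv : ‖v‖ ≤ h) (hseg : ∀ τ ∈ Set.Icc 0 s, x + τ • v ∈ K) :
    ENNReal.ofReal ((G (x + s • v) - G x) ^ 2) ≤
      ENNReal.ofReal (h ^ 2) * ∫⁻ τ in Set.Icc (0 : ℝ) 1, gradEnergy G K (x + τ • v) := by
  have hc : Continuous fun τ : ℝ => ‖fderiv ℝ G (x + τ • v)‖ ^ 2 :=
    (continuous_norm_fderiv_sq hG).comp (by fun_prop)
  have h1 : (G (x + s • v) - G x) ^ 2 ≤ h ^ 2 * ∫ τ in (0 : ℝ)..s, ‖fderiv ℝ G (x + τ • v)‖ ^ 2 := by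
    refine (sq_increment_le hG x v hs).trans ?_
    have h0 : 0 ≤ ∫ τ in (0 : ℝ)..s, ‖fderiv ℝ G (x + τ • v)‖ ^ 2 :=
      intervalIntegral.integral_nonneg hs fun τ _ => by positivity
    refine mul_le_mul_of_nonneg_right ?_ h0
    have : ‖v‖ ^ 2 ≤ h ^ 2 := by gcongr
    nlinarith [sq_nonneg ‖v‖]
  refine (ENNReal.ofReal_le_ofReal h1).trans ?_
  rw [ENNReal.ofReal_mul (by positivity)]
  refine mul_le_mul_right ?_ _
  rw [intervalIntegral.integral_of_le hs, ofReal_integral_eq_lintegral_ofReal hc.integrableOn_Ioc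
    (Eventually.of_forall fun x => by positivity)]
  calc ∫⁻ τ in Set.Ioc 0 s, ENNReal.ofReal (‖fderiv ℝ G (x + τ • v)‖ ^ 2)
      ≤ ∫⁻ τ in Set.Ioc 0 s, gradEnergy G K (x + τ • v) := by
        refine setLIntegral_mono' measurableSet_Ioc fun τ hτ => ?_
        rw [gradEnergy, Set.indicator_of_mem (hseg τ ⟨hτ.1.le, hτ.2⟩)]
    _ ≤ _ := lintegral_mono_set (Set.Ioc_subset_Icc_self.trans (Set.Icc_subset_Icc_right hs1))

/-- Friedrichs' inequality on a simplex for functions vanishing on a face. -/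
theorem friedrichs_simplex (hG : ContDiff ℝ 1 G) {F K : Finset (Euc d)} (hK : IsSimplex K)
    {a : Euc d} {ha : a ∉ F} (haK : K = F.cons a ha) (hF : F.Nonempty)
    (h0 : ∀ x ∈ hull F, G x = 0) :
    ∫ x in hull K, G x ^ 2 ≤
      Metric.diam (hull K) ^ 2 * ∫ x in hull K, ‖fderiv ℝ G x‖ ^ 2 := by
  classical
  obtain ⟨b, hbF⟩ := hF
  set h := Metric.diam (hull K)
  have hFK : F ⊆ K := by rw [haK]; exact Finset.subset_cons ha
  have haK' : a ∈ K := by rw [haK]; exact Finset.mem_cons_self a F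
  have hbK : b ∈ K := hFK hbF
  have hab : a ≠ b := fun e => ha (e ▸ hbF)
  have hv : ‖b - a‖ ≤ h := by
    rw [← dist_eq_norm]
    exact Metric.dist_le_diam_of_mem (isBounded_hull K) (mem_hull_of_mem hbK) (mem_hull_of_mem haK')
  have hlin : ∀ y ∈ K, (baryCoord K y).linear (b - a) =
      (if y = b then 1 else 0) - (if y = a then 1 else 0) := fun y hy => by
    rw [← baryCoord_sub, hK.baryCoord_vertex hy hbK, hK.baryCoord_vertex hy haK']
  have hmeas := measurable_gradEnergy hG (measurableSet_hull K)
  have hpt : ∀ x ∈ hull K, ENNReal.ofReal (G x ^ 2) ≤ ENNReal.ofReal (h ^ 2) *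
      ∫⁻ τ in Set.Icc (0 : ℝ) 1, gradEnergy G (hull K) (x + τ • (b - a)) := by
    intro x hx
    have hs := hK.baryCoord_nonneg (y := a) hx
    have hs1 := hK.baryCoord_le_one (y := a) hx
    have hseg : ∀ τ ∈ Set.Icc 0 (baryCoord K a x), x + τ • (b - a) ∈ hull K := by
      intro τ hτ
      rw [hK.mem_hull_iff]
      intro y hy
      have h1 := hK.baryCoord_nonneg (y := y) hx
      rw [baryCoord_add_smul, hlin y hy]
      by_cases hya : y = a
      · subst hya
        rw [if_neg hab, if_pos rfl]
        linarith [hτ.2]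
      · rw [if_neg hya, sub_zero]
        have := hτ.1
        split_ifs <;> linarith
    -- Moving along the edge direction $b-a$ for the time $\lambda_a(x)$ exhausts the coordinate of
    -- `a` and ends on the face `F`, where `G` vanishes.
    have hend : G (x + baryCoord K a x • (b - a)) = 0 := by
      apply h0
      rw [hK.mem_hull_subset_iff hFK]
      refine ⟨hseg _ ⟨hs, le_rfl⟩, fun y hy hyF => ?_⟩
      have : y = a := by
        rw [haK, Finset.mem_cons] at hy
        exact hy.resolve_right hyF
      subst this
      rw [baryCoord_add_smul, hlin y hy, if_neg hab, if_pos rfl]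
      ring
    have := ofReal_sq_increment_le hG hs hs1 hv hseg
    rwa [hend, zero_sub, neg_sq] at this
  have hint : IntegrableOn (fun x => G x ^ 2) (hull K) :=
    (isCompact_hull K).integrableOn_of_continuous (hG.continuous.pow 2)
  have key : ENNReal.ofReal (∫ x in hull K, G x ^ 2) ≤
      ENNReal.ofReal (h ^ 2 * ∫ x in hull K, ‖fderiv ℝ G x‖ ^ 2) := by
    rw [ofReal_integral_eq_lintegral_ofReal hint (Eventually.of_forall fun x => by positivity),
      ENNReal.ofReal_mul (by positivity), ← lintegral_gradEnergy hG (isCompact_hull K)]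
    calc ∫⁻ x in hull K, ENNReal.ofReal (G x ^ 2)
        ≤ ∫⁻ x in hull K, ENNReal.ofReal (h ^ 2) *
            ∫⁻ τ in Set.Icc (0 : ℝ) 1, gradEnergy G (hull K) (x + τ • (b - a)) :=
          setLIntegral_mono' (measurableSet_hull K) hpt
      _ ≤ ∫⁻ x, ENNReal.ofReal (h ^ 2) *
            ∫⁻ τ in Set.Icc (0 : ℝ) 1, gradEnergy G (hull K) (x + τ • (b - a)) :=
          setLIntegral_le_lintegral _ _
      _ = ENNReal.ofReal (h ^ 2) *
            ∫⁻ τ in Set.Icc (0 : ℝ) 1, ∫⁻ x, gradEnergy G (hull K) (x + τ • (b - a)) := by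
          rw [lintegral_const_mul' _ _ ENNReal.ofReal_ne_top, lintegral_lintegral_swap]
          exact (hmeas.comp (by fun_prop)).aemeasurable
      _ = _ := by
          -- By translation invariance the inner integral does not depend on the parameter.
          simp only [lintegral_add_right_eq_self (gradEnergy G (hull K))]
          simp
  exact (ENNReal.ofReal_le_ofReal_iff (mul_nonneg (sq_nonneg _)
    (integral_nonneg fun x => by positivity))).1 key

/-- The Jacobian factor is $t^{-d}\le2^d$. This is where the constant in Poincaré's inequality comes
from. -/
theorem lintegral_comp_smul_add {f : Euc d → ENNReal} (hf : Measurable f) {t : ℝ}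
    (ht : 1 / 2 ≤ t) (c : Euc d) : ∫⁻ x, f (t • x + c) ≤ 2 ^ d * ∫⁻ x, f x := by
  have ht0 : t ≠ 0 := by linarith
  have h1 : ∫⁻ x, f (t • x + c) = ∫⁻ x, f (x + c) ∂(Measure.map (t • ·) volume) := by
    rw [lintegral_map (by fun_prop) (by fun_prop)]
  rw [h1, Measure.map_addHaar_smul volume ht0, lintegral_smul_measure,
    lintegral_add_right_eq_self]
  refine mul_le_mul_left ?_ _
  have : |(t ^ Module.finrank ℝ (Euc d))⁻¹| ≤ 2 ^ d := by
    rw [finrank_euclideanSpace_fin, abs_of_nonneg (by positivity), ← inv_pow]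
    gcongr
    rw [inv_le_comm₀ (by linarith) (by norm_num)]
    linarith
  refine (ENNReal.ofReal_le_ofReal this).trans ?_
  rw [ENNReal.ofReal_pow (by norm_num)]
  simp

/-- Poincaré's inequality on a convex compact set. -/
theorem poincare_convex (hG : ContDiff ℝ 1 G) {K : Set (Euc d)} (hK : IsCompact K)
    (hconv : Convex ℝ K) (hpos : 0 < volume.real K) :
    ∫ x in K, (G x - (volume.real K)⁻¹ * ∫ y in K, G y) ^ 2 ≤
      2 ^ d * Metric.diam K ^ 2 * ∫ x in K, ‖fderiv ℝ G x‖ ^ 2 := by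
  set h := Metric.diam K
  set V := volume.real K
  set m := V⁻¹ * ∫ y in K, G y
  have hfin : volume K < ⊤ := hK.measure_lt_top
  have : IsFiniteMeasure (volume.restrict K) := ⟨by simpa using hfin⟩
  have hmeas := measurable_gradEnergy hG hK.measurableSet
  have hVeq : ENNReal.ofReal V = volume K := ENNReal.ofReal_toReal hfin.ne
  set E := ∫⁻ x, gradEnergy G K x with hE
  -- Cauchy–Schwarz in `y`, since $V(G(x)-m)=\int_K(G(x)-G(y))\,dy$.
  have hpt : ∀ x ∈ K, ENNReal.ofReal (V * (G x - m) ^ 2) ≤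
      ∫⁻ y in K, ENNReal.ofReal ((G x - G y) ^ 2) := by
    intro x hx
    have hc : Continuous fun y => G x - G y := continuous_const.sub hG.continuous
    have hi := hK.integrableOn_of_continuous hc
    have hi2 : IntegrableOn (fun y => (G x - G y) ^ 2) K :=
      hK.integrableOn_of_continuous (hc.pow 2)
    have hJ := sq_integral_le hi hi2
    rw [measureReal_restrict_apply_univ] at hJ
    rw [← ofReal_integral_eq_lintegral_ofReal hi2 (Eventually.of_forall fun x => by positivity)]
    refine ENNReal.ofReal_le_ofReal ?_
    have hV : ∫ y in K, (G x - G y) = V * (G x - m) := by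
      rw [integral_sub (integrable_const _) (hK.integrableOn_of_continuous hG.continuous),
        integral_const, measureReal_restrict_apply_univ, smul_eq_mul, mul_sub, ← mul_assoc,
        mul_inv_cancel₀ hpos.ne', one_mul]
    rw [hV] at hJ
    refine le_of_mul_le_mul_left ?_ hpos
    calc V * (V * (G x - m) ^ 2) = (V * (G x - m)) ^ 2 := by ring
      _ ≤ _ := hJ
  have hpt2 : ∀ x ∈ K, ∀ y ∈ K, ENNReal.ofReal ((G x - G y) ^ 2) ≤ ENNReal.ofReal (h ^ 2) *
      ∫⁻ τ in Set.Icc (0 : ℝ) 1, gradEnergy G K (y + τ • (x - y)) := by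
    intro x hx y hy
    have hv : ‖x - y‖ ≤ h := by
      rw [← dist_eq_norm]
      exact Metric.dist_le_diam_of_mem hK.isBounded hx hy
    have := ofReal_sq_increment_le (x := y) (v := x - y) hG zero_le_one le_rfl hv
      fun τ hτ => hconv.add_smul_sub_mem hy hx hτ
    simpa using this
  have hm2 : Measurable fun p : (Euc d × Euc d) × ℝ =>
      gradEnergy G K (p.1.2 + p.2 • (p.1.1 - p.1.2)) := hmeas.comp (by fun_prop)
  have hτ : ∀ τ ∈ Set.Icc (0 : ℝ) 1, ∫⁻ x in K, ∫⁻ y in K, gradEnergy G K (y + τ • (x - y)) ≤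
      2 ^ d * E * volume K := by
    intro τ hτ
    have hm3 : Measurable (Function.uncurry fun x y => gradEnergy G K (y + τ • (x - y))) :=
      hmeas.comp (by fun_prop)
    -- In $\tau x+(1-\tau)y$ one of the two coefficients is at least $1/2$. Integrating first in
    -- that variable keeps the Jacobian bounded.
    rcases le_total (1 / 2) τ with h2 | h2
    · rw [lintegral_lintegral_swap hm3.aemeasurable]
      rw [← setLIntegral_const]
      refine setLIntegral_mono' hK.measurableSet fun y _ => ?_
      refine (setLIntegral_le_lintegral _ _).trans ?_
      have : ∀ x, y + τ • (x - y) = τ • x + (y - τ • y) := fun x => by rw [smul_sub]; abel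
      simp only [this]
      exact lintegral_comp_smul_add hmeas h2 _
    · rw [← setLIntegral_const]
      refine setLIntegral_mono' hK.measurableSet fun x _ => ?_
      refine (setLIntegral_le_lintegral _ _).trans ?_
      have : ∀ y, y + τ • (x - y) = (1 - τ) • y + τ • x := fun x => by
        rw [smul_sub, sub_smul, one_smul]; abel
      simp only [this]
      exact lintegral_comp_smul_add hmeas (by linarith) _
  have hint : IntegrableOn (fun x => (G x - m) ^ 2) K :=
    hK.integrableOn_of_continuous ((hG.continuous.sub continuous_const).pow 2)
  have key : ENNReal.ofReal (V * ∫ x in K, (G x - m) ^ 2) ≤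
      ENNReal.ofReal (V * (2 ^ d * h ^ 2 * ∫ x in K, ‖fderiv ℝ G x‖ ^ 2)) := by
    rw [← integral_const_mul, ofReal_integral_eq_lintegral_ofReal (hint.const_mul _)
      (Eventually.of_forall fun x => by positivity)]
    have hswap : ∀ x, ∫⁻ y in K, ENNReal.ofReal (h ^ 2) *
        ∫⁻ τ in Set.Icc (0 : ℝ) 1, gradEnergy G K (y + τ • (x - y)) = ENNReal.ofReal (h ^ 2) *
        ∫⁻ τ in Set.Icc (0 : ℝ) 1, ∫⁻ y in K, gradEnergy G K (y + τ • (x - y)) := by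
      intro x
      rw [lintegral_const_mul' _ _ ENNReal.ofReal_ne_top, lintegral_lintegral_swap]
      exact (hm2.comp (f := fun p : Euc d × ℝ => ((x, p.1), p.2)) (by fun_prop)).aemeasurable
    calc ∫⁻ x in K, ENNReal.ofReal (V * (G x - m) ^ 2)
        ≤ ∫⁻ x in K, ∫⁻ y in K, ENNReal.ofReal (h ^ 2) *
            ∫⁻ τ in Set.Icc (0 : ℝ) 1, gradEnergy G K (y + τ • (x - y)) :=
          setLIntegral_mono' hK.measurableSet fun x hx => (hpt x hx).trans
            (setLIntegral_mono' hK.measurableSet fun y hy => hpt2 x hx y hy)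
      _ = ENNReal.ofReal (h ^ 2) * ∫⁻ τ in Set.Icc (0 : ℝ) 1,
            ∫⁻ x in K, ∫⁻ y in K, gradEnergy G K (y + τ • (x - y)) := by
          simp only [hswap]
          rw [lintegral_const_mul' _ _ ENNReal.ofReal_ne_top, lintegral_lintegral_swap]
          have : Measurable fun p : (Euc d × ℝ) × Euc d =>
            gradEnergy G K (p.2 + p.1.2 • (p.1.1 - p.2)) := hmeas.comp (by fun_prop)
          exact (this.lintegral_prod_right' (ν := volume.restrict K)).aemeasurable
      _ ≤ ENNReal.ofReal (h ^ 2) * ∫⁻ τ in Set.Icc (0 : ℝ) 1, 2 ^ d * E * volume K :=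
          mul_le_mul_right (setLIntegral_mono' measurableSet_Icc hτ) _
      _ = _ := by
          rw [setLIntegral_const, Real.volume_Icc, sub_zero, ENNReal.ofReal_one, mul_one,
            ENNReal.ofReal_mul hpos.le, ENNReal.ofReal_mul (by positivity),
            ENNReal.ofReal_mul (by positivity), hVeq, hE, lintegral_gradEnergy hG hK,
            ENNReal.ofReal_pow (by norm_num) d]
          simp only [ENNReal.ofReal_ofNat]
          ring
  have hE0 : 0 ≤ ∫ x in K, ‖fderiv ℝ G x‖ ^ 2 := integral_nonneg fun x => by positivity
  exact le_of_mul_le_mul_left ((ENNReal.ofReal_le_ofReal_iff (by positivity)).1 key) hpos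

end Smooth

/-! ### Affine maps between simplices -/

theorem AffineMap.hasFDerivAt_euc {d : ℕ} (A : Euc d →ᵃ[ℝ] Euc d) (x : Euc d) :
    HasFDerivAt A (LinearMap.toContinuousLinearMap A.linear) x := by
  have h : (A : Euc d → Euc d) = fun x => LinearMap.toContinuousLinearMap A.linear x + A 0 := by
    ext1 x
    have := A.linearMap_vsub x 0
    simp only [vsub_eq_sub, sub_zero] at this
    simp [this]
  rw [h]
  exact (ContinuousLinearMap.hasFDerivAt _).add_const _

/-- The Jacobian of an affine map is constant, and the change of variables formula for the function
one identifies it as a quotient of volumes. No determinant has to be computed. -/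
theorem integral_affine_image {d : ℕ} (A : Euc d →ᵃ[ℝ] Euc d) (hA : Function.Injective A)
    {s s' : Set (Euc d)} (hs : MeasurableSet s) (hss' : A '' s = s') (f : Euc d → ℝ) :
    volume.real s * ∫ x in s', f x = volume.real s' * ∫ x in s, f (A x) := by
  have h := fun g : Euc d → ℝ => integral_image_eq_integral_abs_det_fderiv_smul volume hs
    (fun x _ => (A.hasFDerivAt_euc x).hasFDerivWithinAt) hA.injOn g
  simp only [hss', smul_eq_mul, integral_const_mul] at h
  have h1 := h fun _ => 1
  simp only [integral_const, measureReal_restrict_apply_univ, smul_eq_mul, mul_one] at h1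
  rw [h, h1]
  ring

/-- The affine map that sends each vertex `y` of the simplex `K` to `e y`. -/
noncomputable def simplexMap {d : ℕ} (K : Finset (Euc d)) (e : Euc d → Euc d) :
    Euc d →ᵃ[ℝ] Euc d :=
  ∑ y ∈ K, (LinearMap.toSpanSingleton ℝ (Euc d) (e y)).toAffineMap.comp (baryCoord K y)

theorem simplexMap_apply {d : ℕ} (K : Finset (Euc d)) (e : Euc d → Euc d) (x : Euc d) :
    simplexMap K e x = ∑ y ∈ K, baryCoord K y x • e y := by
  classical
  have : ∀ s : Finset (Euc d), (∑ y ∈ s, (LinearMap.toSpanSingleton ℝ (Euc d)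
      (e y)).toAffineMap.comp (baryCoord K y)) x = ∑ y ∈ s, baryCoord K y x • e y := by
    intro s
    induction s using Finset.induction_on with
    | empty => simp
    | insert y s hy ih => rw [Finset.sum_insert hy, Finset.sum_insert hy, ← ih]; simp
  exact this K

theorem simplexMap_linear {d : ℕ} (K : Finset (Euc d)) (e : Euc d → Euc d) (v : Euc d) :
    (simplexMap K e).linear v = ∑ y ∈ K, (baryCoord K y).linear v • e y := by
  have h := (simplexMap K e).linearMap_vsub v 0
  simp only [vsub_eq_sub, sub_zero] at h
  rw [h, simplexMap_apply, simplexMap_apply, ← Finset.sum_sub_distrib]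
  refine Finset.sum_congr rfl fun y _ => ?_
  rw [← sub_smul, baryCoord_sub, sub_zero]

section SimplexMap

variable {d : ℕ} {K K' : Finset (Euc d)} {e : Euc d → Euc d}

/-- The derivatives of the barycentric coordinates add up to zero, so a fixed vertex `z` of the
target may be subtracted from every image. Each of the $d+1$ terms then has size at most
$\|v\|/(2r)$ times the target diameter. -/
theorem norm_simplexMap_linear_le (hK : IsSimplex K) (hK' : IsSimplex K')
    (he : Set.MapsTo e K K') {c : Euc d} {r : ℝ} (hr : 0 < r)
    (hc : Metric.closedBall c r ⊆ hull K) :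
    ‖LinearMap.toContinuousLinearMap (simplexMap K e).linear‖ ≤
      (d + 1) * Metric.diam (hull K') / (2 * r) := by
  refine ContinuousLinearMap.opNorm_le_bound _
    (div_nonneg (mul_nonneg (by positivity) Metric.diam_nonneg) (by positivity)) fun v => ?_
  obtain ⟨z, hz⟩ := hK'.nonempty_vertices
  have h1 : (simplexMap K e).linear v = ∑ y ∈ K, (baryCoord K y).linear v • (e y - z) := by
    simp only [smul_sub, Finset.sum_sub_distrib]
    rw [← Finset.sum_smul, hK.linear_sum, zero_smul, sub_zero, simplexMap_linear]
  rw [LinearMap.coe_toContinuousLinearMap', h1]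
  refine (norm_sum_le _ _).trans ?_
  have h2 : ∀ y ∈ K, ‖(baryCoord K y).linear v • (e y - z)‖ ≤
      ‖v‖ / (2 * r) * Metric.diam (hull K') := by
    intro y hy
    rw [norm_smul, Real.norm_eq_abs, ← dist_eq_norm]
    refine mul_le_mul (hK.abs_linear_le hr hc y v) ?_ dist_nonneg (by positivity)
    exact Metric.dist_le_diam_of_mem (isBounded_hull K') (mem_hull_of_mem (he hy))
      (mem_hull_of_mem hz)
  refine (Finset.sum_le_card_nsmul _ _ _ h2).trans (le_of_eq ?_)
  rw [hK.card_eq, nsmul_eq_mul]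
  push_cast
  ring

theorem baryCoord_simplexMap (hK : IsSimplex K) (hK' : IsSimplex K') (he : Set.BijOn e K K')
    {y : Euc d} (hy : y ∈ K) (x : Euc d) :
    baryCoord K' (e y) (simplexMap K e x) = baryCoord K y x := by
  have hinv := he.invOn_invFunOn
  set e' := Function.invFunOn e K
  have hs : ∀ {M : Type} [AddCommMonoid M] (f : Euc d → M),
      ∑ z ∈ K', f z = ∑ y ∈ K, f (e y) := by
    intro M _ f
    symm
    exact Finset.sum_nbij e (fun y hy => he.mapsTo hy) he.injOn he.surjOn fun _ _ => rfl
  have := hK'.baryCoord_eq (w := fun z => baryCoord K (e' z) x) (x := simplexMap K e x) ?_ ?_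
    (he.mapsTo hy)
  · rw [this, hinv.1 hy]
  · rw [hs, ← hK.sum_baryCoord x]
    exact Finset.sum_congr rfl fun y hy => by rw [hinv.1 hy]
  · rw [hs, simplexMap_apply]
    exact Finset.sum_congr rfl fun y hy => by rw [hinv.1 hy]

theorem simplexMap_simplexMap (hK : IsSimplex K) (hK' : IsSimplex K') (he : Set.BijOn e K K')
    {e' : Euc d → Euc d} (hinv : Set.InvOn e' e K K') (x : Euc d) :
    simplexMap K' e' (simplexMap K e x) = x := by
  rw [simplexMap_apply]
  conv_rhs => rw [← hK.sum_baryCoord_smul x]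
  symm
  refine Finset.sum_nbij e (fun y hy => he.mapsTo hy) he.injOn he.surjOn fun y hy => ?_
  rw [baryCoord_simplexMap hK hK' he hy, hinv.1 hy]

theorem simplexMap_mem_hull (hK : IsSimplex K) (hK' : IsSimplex K') (he : Set.BijOn e K K')
    {x : Euc d} (hx : x ∈ hull K) : simplexMap K e x ∈ hull K' := by
  rw [hK'.mem_hull_iff]
  intro z hz
  obtain ⟨y, hy, rfl⟩ := he.surjOn hz
  rw [baryCoord_simplexMap hK hK' he hy]
  exact hK.mem_hull_iff.1 hx y hy

theorem simplexMap_injective (hK : IsSimplex K) (hK' : IsSimplex K') (he : Set.BijOn e K K') :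
    Function.Injective (simplexMap K e) :=
  Function.LeftInverse.injective (simplexMap_simplexMap hK hK' he he.invOn_invFunOn)

theorem simplexMap_image (hK : IsSimplex K) (hK' : IsSimplex K') (he : Set.BijOn e K K') :
    simplexMap K e '' hull K = hull K' := by
  have hinv := he.invOn_invFunOn
  have he' := he.symm hinv.symm
  refine Set.Subset.antisymm ?_ fun x hx => ?_
  · rintro _ ⟨x, hx, rfl⟩
    exact simplexMap_mem_hull hK hK' he hx
  · exact ⟨_, simplexMap_mem_hull hK' hK he' hx, simplexMap_simplexMap hK' hK he' hinv.symm x⟩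

theorem integral_simplexMap (hK : IsSimplex K) (hK' : IsSimplex K') (he : Set.BijOn e K K')
    (f : Euc d → ℝ) :
    volume.real (hull K) * ∫ x in hull K', f x =
      volume.real (hull K') * ∫ x in hull K, f (simplexMap K e x) :=
  integral_affine_image _ (simplexMap_injective hK hK' he) (measurableSet_hull K)
    (simplexMap_image hK hK' he) f

theorem contDiff_affine {n : WithTop ℕ∞} (A : Euc d →ᵃ[ℝ] Euc d) : ContDiff ℝ n A := by
  have h : (A : Euc d → Euc d) = fun x => LinearMap.toContinuousLinearMap A.linear x + A 0 := by
    ext1 x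
    have := A.linearMap_vsub x 0
    simp only [vsub_eq_sub, sub_zero] at this
    simp [this]
  rw [h]
  exact (ContinuousLinearMap.contDiff _).add contDiff_const

theorem fderiv_comp_affine {G : Euc d → ℝ} (hG : ContDiff ℝ 1 G) (A : Euc d →ᵃ[ℝ] Euc d)
    (x : Euc d) : fderiv ℝ (fun x => G (A x)) x =
      (fderiv ℝ G (A x)).comp (LinearMap.toContinuousLinearMap A.linear) :=
  (((hG.differentiable one_ne_zero) _).hasFDerivAt.comp x (A.hasFDerivAt_euc x)).fderiv

theorem norm_fderiv_comp_affine_le {G : Euc d → ℝ} (hG : ContDiff ℝ 1 G)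
    (A : Euc d →ᵃ[ℝ] Euc d) {N : ℝ} (hN : ‖LinearMap.toContinuousLinearMap A.linear‖ ≤ N)
    (x : Euc d) : ‖fderiv ℝ (fun x => G (A x)) x‖ ^ 2 ≤ N ^ 2 * ‖fderiv ℝ G (A x)‖ ^ 2 := by
  rw [fderiv_comp_affine hG, ← mul_pow]
  refine pow_le_pow_left₀ (norm_nonneg _) ?_ 2
  refine (ContinuousLinearMap.opNorm_comp_le _ _).trans ?_
  rw [mul_comm]
  gcongr

end SimplexMap

/-- Transfer of an `L²` bound from the simplex `K` to a simplex `K'` with a common face `F`. -/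
theorem transfer_across_face {d : ℕ} {G G' : Euc d → ℝ} (hG : ContDiff ℝ 1 G)
    (hG' : ContDiff ℝ 1 G') {F K K' : Finset (Euc d)} (hK : IsSimplex K) (hK' : IsSimplex K')
    {a a' : Euc d} {ha : a ∉ F} {ha' : a' ∉ F} (haK : K = F.cons a ha) (haK' : K' = F.cons a' ha')
    (hF : F.Nonempty) (heq : ∀ x ∈ hull F, G x = G' x) (b : ℝ) {c : Euc d} {r κ : ℝ} (hr : 0 < r)
    (hc : Metric.closedBall c r ⊆ hull K) (hκ : Metric.diam (hull K') ≤ κ * r) :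
    ∫ x in hull K', (G' x - b) ^ 2 ≤
      volume.real (hull K') / volume.real (hull K) * (2 * (∫ x in hull K, (G x - b) ^ 2) +
        4 * Metric.diam (hull K) ^ 2 * ∫ x in hull K, ‖fderiv ℝ G x‖ ^ 2) +
      4 * Metric.diam (hull K) ^ 2 * ((d + 1) * κ / 2) ^ 2 *
        ∫ x in hull K', ‖fderiv ℝ G' x‖ ^ 2 := by
  classical
  set h := Metric.diam (hull K)
  set N : ℝ := (d + 1) * κ / 2
  -- This vertex map gives the affine bijection from `K` onto `K'` that is the identity on the
  -- common face.
  set e : Euc d → Euc d := fun y => if y = a then a' else y with he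
  have heF : ∀ y ∈ F, e y = y := fun y hy => if_neg fun h => ha (by rwa [← h])
  have hea : e a = a' := if_pos rfl
  have hbij : Set.BijOn e K K' := by
    refine ⟨fun y hy => ?_, fun y hy z hz hyz => ?_, fun z hz => ?_⟩
    · simp only [haK, haK', Finset.coe_cons] at hy ⊢
      rcases hy with rfl | hy
      · rw [hea]; exact Or.inl rfl
      · rw [heF y hy]; exact Or.inr hy
    · simp only [haK, Finset.coe_cons] at hy hz
      rcases hy with rfl | hy <;> rcases hz with rfl | hz
      · rfl
      · rw [hea, heF z hz] at hyz
        exact absurd (hyz ▸ hz) ha'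
      · rw [hea, heF y hy] at hyz
        exact absurd (hyz ▸ hy) ha'
      · rwa [heF y hy, heF z hz] at hyz
    · simp only [haK', haK, Finset.coe_cons] at hz ⊢
      rcases hz with rfl | hz
      · exact ⟨a, Or.inl rfl, hea⟩
      · exact ⟨z, Or.inr hz, heF z hz⟩
  set A := simplexMap K e with hA
  have hN : ‖LinearMap.toContinuousLinearMap A.linear‖ ≤ N := by
    refine (norm_simplexMap_linear_le hK hK' hbij.mapsTo hr hc).trans ?_
    rw [div_le_iff₀ (by positivity)]
    calc (d + 1) * Metric.diam (hull K') ≤ (d + 1) * (κ * r) := by gcongr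
      _ = N * (2 * r) := by simp only [N]; ring
  have hAF : ∀ x ∈ hull F, A x = x := by
    intro x hx
    have h1 := (hK.mem_hull_subset_iff (haK ▸ Finset.subset_cons ha)).1 hx
    rw [hA, simplexMap_apply]
    conv_rhs => rw [← hK.sum_baryCoord_smul x]
    refine Finset.sum_congr rfl fun y hy => ?_
    by_cases hyF : y ∈ F
    · rw [heF y hyF]
    · rw [h1.2 y hy hyF, zero_smul, zero_smul]
  have hGA : ContDiff ℝ 1 fun x => G' (A x) := hG'.comp (contDiff_affine A)
  -- The pull-back of `G'` and `G` agree on `F`, so Friedrichs on `K` bounds their $L^2$ distance by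
  -- gradients.
  have hfr := friedrichs_simplex (hGA.sub hG) hK haK hF fun x hx => by
    rw [hAF x hx, heq x hx, sub_self]
  have hi : ∀ {f : Euc d → ℝ}, Continuous f → IntegrableOn f (hull K) :=
    fun hf => (isCompact_hull K).integrableOn_of_continuous hf
  have hcA : Continuous A := (contDiff_affine (n := 0) A).continuous
  have hD : ∫ x in hull K, ‖fderiv ℝ (fun x => G' (A x) - G x) x‖ ^ 2 ≤
      2 * N ^ 2 * (∫ x in hull K, ‖fderiv ℝ G' (A x)‖ ^ 2) +
        2 * ∫ x in hull K, ‖fderiv ℝ G x‖ ^ 2 := by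
    have c1 : Continuous fun x => ‖fderiv ℝ G' (A x)‖ ^ 2 :=
      (continuous_norm_fderiv_sq hG').comp hcA
    have c2 := continuous_norm_fderiv_sq hG
    rw [← integral_const_mul, ← integral_const_mul,
      ← integral_add ((hi c1).const_mul _) ((hi c2).const_mul _)]
    refine integral_mono (hi (continuous_norm_fderiv_sq (hGA.sub hG)))
      (((hi c1).const_mul _).add ((hi c2).const_mul _)) fun x => ?_
    have e1 : fderiv ℝ (fun x => G' (A x) - G x) x =
        fderiv ℝ (fun x => G' (A x)) x - fderiv ℝ G x :=
      fderiv_fun_sub (hGA.differentiable one_ne_zero x) (hG.differentiable one_ne_zero x)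
    have e2 := norm_fderiv_comp_affine_le hG' A hN x
    have e3 := norm_sub_le (fderiv ℝ (fun x => G' (A x)) x) (fderiv ℝ G x)
    simp only [e1]
    calc _ ≤ (‖fderiv ℝ (fun x => G' (A x)) x‖ + ‖fderiv ℝ G x‖) ^ 2 := by gcongr
      _ ≤ _ := by nlinarith [sq_nonneg (‖fderiv ℝ (fun x => G' (A x)) x‖ - ‖fderiv ℝ G x‖)]
  have hsum : ∫ x in hull K, (G' (A x) - b) ^ 2 ≤
      2 * (∫ x in hull K, (G' (A x) - G x) ^ 2) + 2 * ∫ x in hull K, (G x - b) ^ 2 := by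
    have c1 : Continuous fun x => (G' (A x) - G x) ^ 2 := (hGA.continuous.sub hG.continuous).pow 2
    have c2 : Continuous fun x => (G x - b) ^ 2 := (hG.continuous.sub continuous_const).pow 2
    rw [← integral_const_mul, ← integral_const_mul,
      ← integral_add ((hi c1).const_mul _) ((hi c2).const_mul _)]
    refine integral_mono (hi ((hGA.continuous.sub continuous_const).pow 2))
      (((hi c1).const_mul _).add ((hi c2).const_mul _)) fun x => ?_
    nlinarith [sq_nonneg ((G' (A x) - G x) - (G x - b))]
  have i1 := integral_simplexMap hK hK' hbij fun x => (G' x - b) ^ 2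
  have i2 := integral_simplexMap hK hK' hbij fun x => ‖fderiv ℝ G' x‖ ^ 2
  rw [← hA] at i1 i2
  have hV := hK.measureReal_pos
  have hV' := hK'.measureReal_pos
  set V := volume.real (hull K)
  set V' := volume.real (hull K')
  have e1 : ∫ x in hull K', (G' x - b) ^ 2 = V' / V * ∫ x in hull K, (G' (A x) - b) ^ 2 := by
    field_simp; linarith
  have e2 : ∫ x in hull K', ‖fderiv ℝ G' x‖ ^ 2 =
      V' / V * ∫ x in hull K, ‖fderiv ℝ G' (A x)‖ ^ 2 := by
    field_simp; linarith
  rw [e1, e2]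
  have hVV : 0 ≤ V' / V := by positivity
  have hh := mul_le_mul_of_nonneg_left hD (sq_nonneg h)
  calc _ ≤ V' / V * (2 * (h ^ 2 * (2 * N ^ 2 * (∫ x in hull K, ‖fderiv ℝ G' (A x)‖ ^ 2) +
        2 * ∫ x in hull K, ‖fderiv ℝ G x‖ ^ 2)) + 2 * ∫ x in hull K, (G x - b) ^ 2) := by
        refine mul_le_mul_of_nonneg_left ?_ hVV
        linarith
    _ = _ := by ring

/-! ### Inverse estimates for polynomials on simplices -/

theorem exists_nodeIndex_of_sum {d ℓ : ℕ} {K : Finset (Euc d)} {n : Euc d → ℕ}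
    (hn : ∑ y ∈ K, n y = ℓ) :
    ∃ a ∈ nodeIndex ℓ K, lagrangeNode ℓ a = ∑ y ∈ K, ((n y : ℝ) / (ℓ : ℝ)) • y := by
  classical
  have ha : Finsupp.onFinset K (fun y => if y ∈ K then n y else 0) (by simp; tauto) ∈
      nodeIndex ℓ K := by
    rw [mem_nodeIndex]
    refine ⟨?_, Finsupp.support_onFinset_subset⟩
    rw [← hn]
    exact Finset.sum_congr rfl fun y hy => by simp [hy]
  refine ⟨_, ha, ?_⟩
  rw [lagrangeNode_eq_sum ha]
  exact Finset.sum_congr rfl fun y hy => by simp [hy]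

/-- Compactness in the finite dimensional space of nodal vectors: the squared $L^2$ norm is a
continuous quadratic form, positive away from zero, hence bounded below on the unit sphere. The
constant still depends on the simplex; scaling removes this afterwards. -/
theorem nodal_norm_le {d ℓ : ℕ} (hℓ : 1 ≤ ℓ) {K : Finset (Euc d)} (hK : IsSimplex K) :
    ∃ C : ℝ, 0 < C ∧ ∀ q : Euc d → ℝ, PolyFun ℓ q → ∀ a ∈ nodeIndex ℓ K,
      q (lagrangeNode ℓ a) ^ 2 ≤ C * ∫ x in hull K, q x ^ 2 := by
  classical
  set ι := {a // a ∈ nodeIndex ℓ K}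
  have hφ : ∀ a : ι, Continuous (lagrangeBasis ℓ K a.1) :=
    fun a => (polyFun_lagrangeBasis a.2).contDiff.continuous
  let f : (ι → ℝ) → Euc d → ℝ := fun c x => ∑ a : ι, c a * lagrangeBasis ℓ K a.1 x
  have hfc : ∀ c, Continuous (f c) := fun c => by
    exact continuous_finsetSum _ fun a _ => continuous_const.mul (hφ a)
  let N : (ι → ℝ) → ℝ := fun c => ∫ x in hull K, f c x ^ 2
  have hi : ∀ {f : Euc d → ℝ}, Continuous f → IntegrableOn f (hull K) :=
    fun hf => (isCompact_hull K).integrableOn_of_continuous hf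
  have hNc : Continuous N := by
    have : N = fun c => ∑ a : ι, ∑ b : ι, c a * c b *
        ∫ x in hull K, lagrangeBasis ℓ K a.1 x * lagrangeBasis ℓ K b.1 x := by
      ext c
      simp only [N, f, pow_two, Finset.sum_mul_sum]
      rw [integral_finsetSum _ fun a _ => ?_]
      · refine Finset.sum_congr rfl fun a _ => ?_
        rw [integral_finsetSum _ fun b _ => ?_]
        · refine Finset.sum_congr rfl fun b _ => ?_
          rw [← integral_const_mul]
          congr 1; ext x; ring
        · exact hi (by have := hφ a; have := hφ b; fun_prop)
      · refine hi (continuous_finsetSum _ fun b _ => ?_)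
        have := hφ a; have := hφ b; fun_prop
    rw [this]
    fun_prop
  have hfnode : ∀ (c : ι → ℝ) (a : ι), f c (lagrangeNode ℓ a.1) = c a := by
    intro c a
    simp only [f]
    rw [Finset.sum_eq_single a]
    · rw [lagrangeBasis_node hℓ hK a.2 a.2, if_pos rfl, mul_one]
    · intro b _ hba
      rw [lagrangeBasis_node hℓ hK b.2 a.2, if_neg fun h => hba (Subtype.ext h), mul_zero]
    · simp
  -- If the norm is zero, the function vanishes almost everywhere, hence on the open interior, hence
  -- on its closure. The closure contains all nodes.
  have hNpos : ∀ c, c ≠ 0 → 0 < N c := by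
    intro c hc
    refine lt_of_le_of_ne (integral_nonneg fun x => sq_nonneg _) fun h0 => hc ?_
    have h1 := (setIntegral_eq_zero_iff_of_nonneg_ae
      (Eventually.of_forall fun x => sq_nonneg (f c x)) (hi ((hfc c).pow 2))).1 h0.symm
    have h2 : Set.EqOn (f c) 0 (interior (hull K)) := by
      have h3 : f c =ᵐ[volume.restrict (interior (hull K))] 0 := by
        filter_upwards [ae_mono (Measure.restrict_mono interior_subset le_rfl) h1] with x hx
        simpa using hx
      exact Measure.eqOn_open_of_ae_eq h3 isOpen_interior (hfc c).continuousOn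
        continuousOn_const
    have h3 := (h2.closure (hfc c) continuous_const).mono hK.subset_closure_interior
    ext a
    rw [← hfnode c a]
    exact h3 (lagrangeNode_mem_hull hℓ a.2)
  have hqf : ∀ q : Euc d → ℝ, PolyFun ℓ q → q = f fun a => q (lagrangeNode ℓ a.1) := by
    intro q hq
    conv_lhs => rw [← interp_self hℓ hK hq]
    ext x
    simp only [interp, f]
    rw [← Finset.sum_coe_sort]
  rcases isEmpty_or_nonempty ι with hι | hι
  · exact ⟨1, one_pos, fun q _ a ha => (hι.false ⟨a, ha⟩).elim⟩
  obtain ⟨c₀, hc₀, hmin⟩ := (isCompact_sphere (0 : ι → ℝ) 1).exists_isMinOn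
    (NormedSpace.sphere_nonempty.2 zero_le_one) hNc.continuousOn
  have hc₀' : c₀ ≠ 0 := by
    rintro rfl
    simp at hc₀
  have hm := hNpos c₀ hc₀'
  refine ⟨(N c₀)⁻¹, inv_pos.2 hm, fun q hq a ha => ?_⟩
  set c : ι → ℝ := fun a => q (lagrangeNode ℓ a.1) with hcdef
  have hNq : ∫ x in hull K, q x ^ 2 = N c := by
    conv_lhs => rw [hqf q hq]
  rw [hNq, inv_mul_eq_div, le_div_iff₀ hm]
  have hca : q (lagrangeNode ℓ a) ^ 2 ≤ ‖c‖ ^ 2 := by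
    rw [← sq_abs, ← Real.norm_eq_abs]
    exact pow_le_pow_left₀ (norm_nonneg _) (norm_le_pi_norm c ⟨a, ha⟩) 2
  rcases eq_or_ne c 0 with h0 | h0
  · rw [h0, norm_zero] at hca
    have : q (lagrangeNode ℓ a) ^ 2 = 0 := by nlinarith [sq_nonneg (q (lagrangeNode ℓ a))]
    rw [this, zero_mul]
    exact integral_nonneg fun x => sq_nonneg _
  · have hn : 0 < ‖c‖ := norm_pos_iff.2 h0
    have h1 : N c₀ ≤ N (‖c‖⁻¹ • c) := hmin (by simp [norm_smul, hn.ne'])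
    have h2 : N (‖c‖⁻¹ • c) = (‖c‖⁻¹) ^ 2 * N c := by
      simp only [N, f, Pi.smul_apply, smul_eq_mul, mul_assoc, ← Finset.mul_sum]
      rw [← integral_const_mul]
      congr 1; ext x; ring
    rw [h2, inv_pow, inv_mul_eq_div, le_div_iff₀ (by positivity)] at h1
    nlinarith

/-- Expand in the Lagrange basis. Its finitely many functions and their derivatives are bounded on
the compact simplex, and `S` adds up these bounds. -/
theorem polynomial_bound_of_nodal {d ℓ : ℕ} (hℓ : 1 ≤ ℓ) {K : Finset (Euc d)}
    (hK : IsSimplex K) :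
    ∃ C : ℝ, 0 < C ∧ ∀ q : Euc d → ℝ, PolyFun ℓ q → ∀ M : ℝ,
      (∀ a ∈ nodeIndex ℓ K, q (lagrangeNode ℓ a) ^ 2 ≤ M) →
        ∀ x ∈ hull K, q x ^ 2 ≤ C * M ∧ ‖fderiv ℝ q x‖ ^ 2 ≤ C * M := by
  classical
  have h1 : ∀ a ∈ nodeIndex ℓ K, ∃ B : ℝ, 0 ≤ B ∧ ∀ x ∈ hull K,
      |lagrangeBasis ℓ K a x| ≤ B ∧ ‖fderiv ℝ (lagrangeBasis ℓ K a) x‖ ≤ B := by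
    intro a ha
    have hs := (polyFun_lagrangeBasis ha).contDiff
    obtain ⟨B1, hB1⟩ := (isCompact_hull K).exists_bound_of_continuousOn hs.continuous.continuousOn
    obtain ⟨B2, hB2⟩ := (isCompact_hull K).exists_bound_of_continuousOn
      (hs.continuous_fderiv (by simp)).continuousOn
    refine ⟨max 0 (max B1 B2), le_max_left _ _, fun x hx => ⟨?_, ?_⟩⟩
    · exact (hB1 x hx).trans ((le_max_left _ _).trans (le_max_right _ _))
    · exact (hB2 x hx).trans ((le_max_right _ _).trans (le_max_right _ _))
  choose! B hB0 hB using h1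
  set S := ∑ a ∈ nodeIndex ℓ K, B a
  have hS : 0 ≤ S := Finset.sum_nonneg hB0
  refine ⟨S ^ 2 + 1, by positivity, fun q hq M hM x hx => ?_⟩
  rcases (nodeIndex ℓ K).eq_empty_or_nonempty with he | ⟨a₀, ha₀⟩
  · exfalso
    have h0 := interp_self hℓ hK (PolyFun.const (d := d) ℓ 1)
    have := congrFun h0 0
    simp [interp, he] at this
  have hM0 : 0 ≤ M := (sq_nonneg _).trans (hM a₀ ha₀)
  have hqa : ∀ a ∈ nodeIndex ℓ K, |q (lagrangeNode ℓ a)| ≤ √M :=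
    fun a ha => Real.abs_le_sqrt (hM a ha)
  have hqe : q = fun x => ∑ a ∈ nodeIndex ℓ K, q (lagrangeNode ℓ a) * lagrangeBasis ℓ K a x :=
    (interp_self hℓ hK hq).symm
  have hb : (√M * S) ^ 2 ≤ (S ^ 2 + 1) * M := by
    rw [mul_pow, Real.sq_sqrt hM0]; nlinarith
  constructor
  · refine le_trans ?_ hb
    rw [← sq_abs]
    refine pow_le_pow_left₀ (abs_nonneg _) ?_ 2
    rw [hqe]
    refine (Finset.abs_sum_le_sum_abs _ _).trans ?_
    rw [Finset.mul_sum]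
    refine Finset.sum_le_sum fun a ha => ?_
    rw [abs_mul]
    exact mul_le_mul (hqa a ha) (hB a ha x hx).1 (abs_nonneg _) (Real.sqrt_nonneg _)
  · refine le_trans ?_ hb
    refine pow_le_pow_left₀ (norm_nonneg _) ?_ 2
    rw [hqe, fderiv_fun_sum fun a ha =>
      (((polyFun_lagrangeBasis ha).contDiff.differentiable (by simp)) x).const_mul _]
    refine (norm_sum_le _ _).trans ?_
    rw [Finset.mul_sum]
    refine Finset.sum_le_sum fun a ha => ?_
    rw [fderiv_const_mul (((polyFun_lagrangeBasis ha).contDiff.differentiable (by simp)) x),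
      norm_smul]
    exact mul_le_mul (hqa a ha) (hB a ha x hx).2 (norm_nonneg _) (Real.sqrt_nonneg _)

theorem polyFun_comp_affine {d n : ℕ} {f : Euc d → ℝ} (hf : PolyFun n f)
    (A : Euc d →ᵃ[ℝ] Euc d) : PolyFun n fun x => f (A x) :=
  hf.comp_affine A fun i =>
    PolyFun.affine ((EuclideanSpace.proj (𝕜 := ℝ) i).toLinearMap.toAffineMap.comp A)

/-- Scaled norm equivalences for polynomials on a simplex; the constant depends only on the
dimension and the degree. -/
theorem inverse_estimates (d ℓ : ℕ) (hℓ : 1 ≤ ℓ) :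
    ∃ C : ℝ, 0 < C ∧ ∀ K : Finset (Euc d), IsSimplex K → ∀ q : Euc d → ℝ, PolyFun ℓ q →
      (∀ x ∈ hull K, volume.real (hull K) * q x ^ 2 ≤ C * ∫ x in hull K, q x ^ 2) ∧
      ∀ M : ℝ, (∀ a ∈ nodeIndex ℓ K, q (lagrangeNode ℓ a) ^ 2 ≤ M) →
        ∀ x ∈ hull K, q x ^ 2 ≤ C * M ∧ ∀ (c : Euc d) (r : ℝ), 0 < r →
          Metric.closedBall c r ⊆ hull K → r ^ 2 * ‖fderiv ℝ q x‖ ^ 2 ≤ C * M := by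
  classical
  -- The constant has to be fixed before `K`, so it is computed on one reference simplex. Without
  -- any simplex the claim would be vacuous.
  by_cases hex : ∃ K₀ : Finset (Euc d), IsSimplex K₀
  swap
  · exact ⟨1, one_pos, fun K hK => absurd ⟨K, hK⟩ hex⟩
  obtain ⟨K₀, hK₀⟩ := hex
  obtain ⟨C₁, hC₁, h₁⟩ := nodal_norm_le hℓ hK₀
  obtain ⟨C₂, hC₂, h₂⟩ := polynomial_bound_of_nodal hℓ hK₀
  set D : ℝ := (d + 1) * Metric.diam (hull K₀) / 2
  have hV₀ := hK₀.measureReal_pos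
  set V₀ := volume.real (hull K₀)
  -- The three summands serve the $L^2$ bound of point values, the nodal bound of gradients and the
  -- nodal bound of values.
  refine ⟨C₂ * C₁ * V₀ + C₂ * D ^ 2 + C₂, by positivity, fun K hK q hq => ?_⟩
  set e : K₀ ≃ K := Finset.equivOfCardEq (hK₀.card_eq.trans hK.card_eq.symm)
  set e₁ : Euc d → Euc d := fun y => if h : y ∈ K₀ then e ⟨y, h⟩ else 0 with he₁
  have he1 : ∀ (y : Euc d) (h : y ∈ K₀), e₁ y = e ⟨y, h⟩ := fun y h => dif_pos h
  have hbij : Set.BijOn e₁ K₀ K := by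
    refine ⟨fun y hy => ?_, fun y hy z hz hyz => ?_, fun z hz => ?_⟩
    · rw [he1 y hy]; exact (e ⟨y, hy⟩).2
    · rw [he1 y hy, he1 z hz] at hyz
      simpa using e.injective (Subtype.ext hyz)
    · refine ⟨e.symm ⟨z, hz⟩, (e.symm ⟨z, hz⟩).2, ?_⟩
      rw [he1 _ (e.symm ⟨z, hz⟩).2]
      simp
  have hinv := hbij.invOn_invFunOn
  set e₂ := Function.invFunOn e₁ K₀
  have hbij' : Set.BijOn e₂ K K₀ := hbij.symm hinv.symm
  set A := simplexMap K₀ e₁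
  set A' := simplexMap K e₂
  have hAA' : ∀ x, A (A' x) = x := simplexMap_simplexMap hK hK₀ hbij' hinv.symm
  have hqA := polyFun_comp_affine hq A
  have hnode : ∀ a ∈ nodeIndex ℓ K₀, ∃ b ∈ nodeIndex ℓ K,
      lagrangeNode ℓ b = A (lagrangeNode ℓ a) := by
    intro a ha
    obtain ⟨b, hb, hbe⟩ := exists_nodeIndex_of_sum (ℓ := ℓ) (K := K) (n := fun z => a (e₂ z)) (by
      rw [← (mem_nodeIndex.1 ha).1]
      exact Finset.sum_nbij e₂ (fun y hy => hbij'.mapsTo hy) hbij'.injOn hbij'.surjOn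
        fun _ _ => rfl)
    refine ⟨b, hb, ?_⟩
    rw [hbe, simplexMap_apply]
    refine Finset.sum_nbij e₂ (fun y hy => hbij'.mapsTo hy) hbij'.injOn hbij'.surjOn
      fun z hz => ?_
    rw [hK₀.baryCoord_eq (sum_nodeIndex_div hℓ ha) (lagrangeNode_eq_sum ha).symm
      (hbij'.mapsTo hz), hinv.2 hz]
  refine ⟨fun x hx => ?_, fun M hM x hx => ?_⟩
  · have h3 := (h₂ _ hqA _ (h₁ _ hqA) (A' x) (simplexMap_mem_hull hK hK₀ hbij' hx)).1
    rw [hAA'] at h3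
    have h4 := integral_simplexMap hK₀ hK hbij fun x => q x ^ 2
    have hV := hK.measureReal_pos
    have hI : 0 ≤ ∫ x in hull K, q x ^ 2 := integral_nonneg fun x => sq_nonneg _
    calc volume.real (hull K) * q x ^ 2
        ≤ volume.real (hull K) * (C₂ * (C₁ * ∫ x in hull K₀, q (A x) ^ 2)) := by gcongr
      _ = C₂ * C₁ * V₀ * ∫ x in hull K, q x ^ 2 := by
          rw [show C₂ * C₁ * V₀ * ∫ x in hull K, q x ^ 2 =
            C₂ * C₁ * (V₀ * ∫ x in hull K, q x ^ 2) by ring, h4]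
          ring
      _ ≤ _ := by
          refine mul_le_mul_of_nonneg_right ?_ hI
          nlinarith [mul_nonneg hC₂.le (sq_nonneg D)]
  · have hM' : ∀ a ∈ nodeIndex ℓ K₀, q (A (lagrangeNode ℓ a)) ^ 2 ≤ M := by
      intro a ha
      obtain ⟨b, hb, hbe⟩ := hnode a ha
      rw [← hbe]
      exact hM b hb
    have h3 := h₂ _ hqA M hM' (A' x) (simplexMap_mem_hull hK hK₀ hbij' hx)
    rw [hAA'] at h3
    have hM0 : 0 ≤ M := by
      have := (sq_nonneg _).trans h3.1
      exact nonneg_of_mul_nonneg_right this hC₂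
    have hC0 : 0 ≤ C₂ * C₁ * V₀ := by positivity
    refine ⟨h3.1.trans ?_, fun c r hr hc => ?_⟩
    · refine mul_le_mul_of_nonneg_right ?_ hM0
      nlinarith [mul_nonneg hC₂.le (sq_nonneg D)]
    · have hN := norm_simplexMap_linear_le hK hK₀ hbij'.mapsTo hr hc
      have h5 := norm_fderiv_comp_affine_le (hqA.contDiff.of_le (by simp)) A' hN x
      simp only [hAA'] at h5
      -- The map onto the reference simplex has norm at most $D/r$, so the factor $r^2$ makes the
      -- bound scale invariant.
      have h6 : r ^ 2 * ((d + 1) * Metric.diam (hull K₀) / (2 * r)) ^ 2 = D ^ 2 := by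
        simp only [D]; field_simp
      calc r ^ 2 * ‖fderiv ℝ q x‖ ^ 2 ≤ r ^ 2 * (((d + 1) * Metric.diam (hull K₀) / (2 * r)) ^ 2 *
            ‖fderiv ℝ (fun x => q (A x)) (A' x)‖ ^ 2) := by gcongr
        _ = D ^ 2 * ‖fderiv ℝ (fun x => q (A x)) (A' x)‖ ^ 2 := by rw [← h6]; ring
        _ ≤ D ^ 2 * (C₂ * M) := by gcongr; exact h3.2
        _ = (C₂ * D ^ 2) * M := by ring
        _ ≤ _ := by
          refine mul_le_mul_of_nonneg_right ?_ hM0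
          linarith

/-! ### Weak gradients -/

section WeakGradient

variable {d : ℕ} {U V : Set (Euc d)} {u v : Euc d → ℝ} {g h : Euc d → Euc d}

theorem measurable_gradient (f : Euc d → ℝ) : Measurable (gradient f) :=
  (InnerProductSpace.toDual ℝ (Euc d)).symm.continuous.measurable.comp (measurable_fderiv ℝ f)

theorem gradient_eq_zero_of_notMem_tsupport {φ : Euc d → ℝ} {x : Euc d} (hx : x ∉ tsupport φ) :
    gradient φ x = 0 := by
  rw [← norm_eq_zero, norm_gradient, norm_eq_zero]
  exact image_eq_zero_of_notMem_tsupport fun h => hx (tsupport_fderiv_subset ℝ h)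

theorem IsTestFunction.mono {φ : Euc d → ℝ} (hφ : IsTestFunction V φ) (hVU : V ⊆ U) :
    IsTestFunction U φ := ⟨hφ.1, hφ.2.1, hφ.2.2.trans hVU⟩

theorem IsTestFunction.continuous_gradient {φ : Euc d → ℝ} (hφ : IsTestFunction U φ) :
    Continuous (gradient φ) :=
  (InnerProductSpace.toDual ℝ (Euc d)).symm.continuous.comp
    (hφ.1.continuous_fderiv (by simp))

theorem IsTestFunction.hasCompactSupport_gradient {φ : Euc d → ℝ} (hφ : IsTestFunction U φ) :
    HasCompactSupport (gradient φ) :=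
  hφ.2.1.mono' fun x hx => by
    by_contra h
    exact hx (gradient_eq_zero_of_notMem_tsupport h)

theorem IsTestFunction.memLp {φ : Euc d → ℝ} (hφ : IsTestFunction U φ) :
    MemLp φ 2 (volume.restrict U) :=
  (hφ.1.continuous.memLp_of_hasCompactSupport hφ.2.1).restrict U

theorem IsTestFunction.memLp_gradient {φ : Euc d → ℝ} (hφ : IsTestFunction U φ) :
    MemLp (gradient φ) 2 (volume.restrict U) :=
  (hφ.continuous_gradient.memLp_of_hasCompactSupport hφ.hasCompactSupport_gradient).restrict U

theorem integrable_smul_of_memLp {α E : Type*} [MeasurableSpace α] {μ : Measure α}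
    [NormedAddCommGroup E] [NormedSpace ℝ E] {f : α → ℝ} {g : α → E} (hf : MemLp f 2 μ)
    (hg : MemLp g 2 μ) : Integrable (fun x => f x • g x) μ := by
  have := hg.smul (r := 1) hf
  rwa [memLp_one_iff_integrable] at this

theorem IsWeakGradient.mono (hu : IsWeakGradient U u g) (hVU : V ⊆ U) (hU : MeasurableSet U) :
    IsWeakGradient V u g := by
  refine ⟨hu.1.mono_measure (Measure.restrict_mono hVU le_rfl), fun φ hφ => ?_⟩
  have h := hu.2 φ (hφ.mono hVU)
  rw [setIntegral_eq_of_subset_of_forall_sdiff_eq_zero hU hVU fun x hx => ?_,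
    setIntegral_eq_of_subset_of_forall_sdiff_eq_zero hU hVU fun x hx => ?_] at h
  · exact h
  · rw [image_eq_zero_of_notMem_tsupport fun h' => hx.2 (hφ.2.2 h'), zero_smul]
  · rw [gradient_eq_zero_of_notMem_tsupport fun h' => hx.2 (hφ.2.2 h'), smul_zero]

theorem IsWeakGradient.congr (hu : IsWeakGradient U u g) (hU : MeasurableSet U)
    (huv : Set.EqOn u v U) : IsWeakGradient U v g := by
  refine ⟨hu.1, fun φ hφ => ?_⟩
  rw [← hu.2 φ hφ]
  exact setIntegral_congr_fun hU fun x hx => by simp only [huv hx]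

theorem IsWeakGradient.sub (hu : IsWeakGradient U u g) (hv : IsWeakGradient U v h)
    (hu2 : MemLp u 2 (volume.restrict U)) (hv2 : MemLp v 2 (volume.restrict U)) :
    IsWeakGradient U (u - v) (g - h) := by
  refine ⟨hu.1.sub hv.1, fun φ hφ => ?_⟩
  simp only [Pi.sub_apply, sub_smul, smul_sub]
  rw [integral_sub (integrable_smul_of_memLp hu2 hφ.memLp_gradient)
      (integrable_smul_of_memLp hv2 hφ.memLp_gradient),
    integral_sub (integrable_smul_of_memLp hφ.memLp hu.1)
      (integrable_smul_of_memLp hφ.memLp hv.1), hu.2 φ hφ, hv.2 φ hφ]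
  abel

/-- The fundamental lemma of the calculus of variations, applied to the difference of the two
gradients, which is integrable because the volume is finite. -/
theorem IsWeakGradient.ae_eq (hU : IsOpen U) (hfin : volume U < ⊤)
    (hg : IsWeakGradient U u g) (hh : IsWeakGradient U u h) : g =ᵐ[volume.restrict U] h := by
  have : IsFiniteMeasure (volume.restrict U) := ⟨by simpa using hfin⟩
  have hint : IntegrableOn (g - h) U := (hg.1.sub hh.1).integrable (by norm_num)
  have key := hU.ae_eq_zero_of_integral_contDiff_smul_eq_zero hint.locallyIntegrableOn
    fun φ h1 h2 h3 => by
      have hφ : IsTestFunction U φ := ⟨h1, h2, h3⟩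
      rw [← setIntegral_eq_integral_of_forall_compl_eq_zero (s := U) fun x hx => by
        rw [image_eq_zero_of_notMem_tsupport fun h' => hx (h3 h'), zero_smul]]
      simp only [Pi.sub_apply, smul_sub]
      rw [integral_sub (integrable_smul_of_memLp hφ.memLp hg.1)
        (integrable_smul_of_memLp hφ.memLp hh.1), sub_eq_zero, ← neg_inj, ← hg.2 φ hφ,
        ← hh.2 φ hφ]
  refine (ae_restrict_iff' hU.measurableSet).2 ?_
  filter_upwards [key] with x hx hxU
  exact sub_eq_zero.1 (hx hxU)

theorem IsWeakGradient.weakGradient_spec (hg : IsWeakGradient U u g) :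
    IsWeakGradient U u (weakGradient U u) := by
  have h : ∃ g, IsWeakGradient U u g := ⟨g, hg⟩
  rw [weakGradient, dif_pos h]
  exact h.choose_spec

/-- Removes the arbitrary choice hidden in `weakGradient`: from here on, norms are computed with an
explicit gradient. -/
theorem IsWeakGradient.rdNorm_sq (hU : IsOpen U) (hfin : volume U < ⊤)
    (hg : IsWeakGradient U u g) {ε : ℝ} (hε : 0 ≤ ε) :
    rdNorm ε U u ^ 2 = (∫ x in U, u x ^ 2) + ε * ∫ x in U, ‖g x‖ ^ 2 := by
  have h1 : 0 ≤ ∫ x in U, u x ^ 2 := integral_nonneg fun x => sq_nonneg _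
  have h2 : 0 ≤ ∫ x in U, ‖weakGradient U u x‖ ^ 2 := integral_nonneg fun x => sq_nonneg _
  have h3 : ∫ x in U, ‖weakGradient U u x‖ ^ 2 = ∫ x in U, ‖g x‖ ^ 2 := by
    refine integral_congr_ae ?_
    filter_upwards [hg.weakGradient_spec.ae_eq hU hfin hg] with x hx
    rw [hx]
  rw [rdNorm, Real.sq_sqrt (by positivity), h3]

theorem rdNorm_nonneg {ε : ℝ} : 0 ≤ rdNorm ε U u := Real.sqrt_nonneg _

end WeakGradient

/-! ### Lipschitz continuity from a finite closed cover -/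

/-- A Dini derivative argument. At each point only one set of the cover has to supply a slope bound,
and only along points approaching from the right, so the pieces may interlace arbitrarily. -/
theorem sub_le_of_closed_cover {ι : Type*} (s : Finset ι) {A : ι → Set ℝ}
    (hA : ∀ i ∈ s, IsClosed (A i)) {f : ℝ → ℝ} (hf : ContinuousOn f (Set.Icc 0 1))
    (hcov : Set.Icc (0 : ℝ) 1 ⊆ ⋃ i ∈ s, A i) {M : ℝ}
    (hL : ∀ i ∈ s, ∀ x ∈ A i ∩ Set.Icc 0 1, ∀ y ∈ A i ∩ Set.Icc 0 1, |f x - f y| ≤ M * |x - y|) :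
    f 1 - f 0 ≤ M := by
  have key := image_le_of_liminf_slope_right_le_deriv_boundary (B := fun t => f 0 + M * t)
    (B' := fun _ => M) hf (by simp) (by fun_prop)
    (fun x _ => by
      simpa using (((hasDerivAt_id x).const_mul M).const_add (f 0)).hasDerivWithinAt)
    (fun x hx r hr => ?_) (Set.right_mem_Icc.2 zero_le_one)
  · simp only [mul_one] at key; linarith
  have hev : ∀ᶠ z in 𝓝[>] x, z ∈ Set.Ioo x 1 := Ioo_mem_nhdsGT hx.2
  -- By finiteness, one set of the cover contains points arbitrarily close to `x` on its right.
  -- Being closed, it contains `x` as well.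
  obtain ⟨i, hi, hfreq⟩ : ∃ i ∈ s, ∃ᶠ z in 𝓝[>] x, z ∈ A i := by
    by_contra! hcon
    have h1 : ∀ᶠ z in 𝓝[>] x, ∀ i ∈ s, z ∉ A i :=
      (Finset.eventually_all s).2 fun i hi => hcon i hi
    obtain ⟨z, hz1, hz2⟩ := (h1.and hev).exists
    have := hcov ⟨hx.1.trans hz2.1.le, hz2.2.le⟩
    simp only [Set.mem_iUnion] at this
    obtain ⟨i, hi, hzi⟩ := this
    exact hz1 i hi hzi
  have hxA : x ∈ A i := by
    rw [← (hA i hi).closure_eq, mem_closure_iff_frequently]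
    exact hfreq.filter_mono nhdsWithin_le_nhds
  refine (hfreq.and_eventually hev).mono fun z hz => lt_of_le_of_lt ?_ hr
  rw [slope_def_field, div_le_iff₀ (by linarith [hz.2.1])]
  have := hL i hi z ⟨hz.1, hx.1.trans hz.2.1.le, hz.2.2.le⟩ x ⟨hxA, hx.1, hx.2.le⟩
  rw [abs_of_pos (a := z - x) (by linarith [hz.2.1])] at this
  exact (le_abs_self _).trans this

theorem abs_sub_le_of_closed_cover {E ι : Type*} [NormedAddCommGroup E] [NormedSpace ℝ E]
    (s : Finset ι) {A : ι → Set E} (hA : ∀ i ∈ s, IsClosed (A i)) {f : E → ℝ} {x y : E}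
    (hf : ContinuousOn f (segment ℝ x y)) (hcov : segment ℝ x y ⊆ ⋃ i ∈ s, A i) {M : ℝ}
    (hL : ∀ i ∈ s, ∀ a ∈ A i ∩ segment ℝ x y, ∀ b ∈ A i ∩ segment ℝ x y,
      |f a - f b| ≤ M * ‖a - b‖) :
    |f x - f y| ≤ M * ‖x - y‖ := by
  set γ : ℝ → E := fun t => x + t • (y - x) with hγ
  have hγc : Continuous γ := by fun_prop
  have hmaps : ∀ t ∈ Set.Icc (0 : ℝ) 1, γ t ∈ segment ℝ x y := by
    intro t ht
    rw [segment_eq_image']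
    exact ⟨t, ht, rfl⟩
  have hcov' : Set.Icc (0 : ℝ) 1 ⊆ ⋃ i ∈ s, γ ⁻¹' A i := by
    intro t ht
    have := hcov (hmaps t ht)
    simpa using this
  have hdist : ∀ a b : ℝ, ‖γ a - γ b‖ = ‖x - y‖ * |a - b| := by
    intro a b
    have : γ a - γ b = (a - b) • (y - x) := by simp only [hγ, sub_smul]; abel
    rw [this, norm_smul, Real.norm_eq_abs, norm_sub_rev x y, mul_comm]
  have hfc : ContinuousOn (f ∘ γ) (Set.Icc 0 1) := hf.comp hγc.continuousOn hmaps
  have hLip : ∀ i ∈ s, ∀ a ∈ γ ⁻¹' A i ∩ Set.Icc 0 1, ∀ b ∈ γ ⁻¹' A i ∩ Set.Icc 0 1,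
      |f (γ a) - f (γ b)| ≤ M * ‖x - y‖ * |a - b| := by
    intro i hi a ha b hb
    rw [mul_assoc, ← hdist]
    exact hL i hi _ ⟨ha.1, hmaps a ha.2⟩ _ ⟨hb.1, hmaps b hb.2⟩
  have hcl : ∀ i ∈ s, IsClosed (γ ⁻¹' A i) := fun i hi => (hA i hi).preimage hγc
  have h1 := sub_le_of_closed_cover s hcl hfc hcov' hLip
  have h2 := sub_le_of_closed_cover s (f := fun t => -(f ∘ γ) t) (M := M * ‖x - y‖) hcl
    hfc.neg hcov' fun i hi a ha b hb => by
      have := hLip i hi b hb a ha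
      simp only [Function.comp_apply]
      rw [abs_sub_comm a b]
      calc |-f (γ a) - -f (γ b)| = |f (γ b) - f (γ a)| := by congr 1; ring
        _ ≤ _ := this
  have e0 : γ 0 = x := by simp [hγ]
  have e1 : γ 1 = y := by simp [hγ]
  simp only [Function.comp_apply, e0, e1] at h1 h2
  rw [abs_le]
  constructor <;> linarith

/-! ### Finite element functions -/

/-- The union of the closed simplices in `S`. -/
def unionHull {d : ℕ} (S : Finset (Finset (Euc d))) : Set (Euc d) := ⋃ K ∈ S, hull K

theorem mem_unionHull {d : ℕ} {S : Finset (Finset (Euc d))} {x : Euc d} :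
    x ∈ unionHull S ↔ ∃ K ∈ S, x ∈ hull K := by
  simp [unionHull]

theorem isCompact_unionHull {d : ℕ} (S : Finset (Finset (Euc d))) : IsCompact (unionHull S) :=
  S.isCompact_biUnion fun K _ => isCompact_hull K

theorem hull_subset_unionHull {d : ℕ} {S : Finset (Finset (Euc d))} {K : Finset (Euc d)}
    (hK : K ∈ S) : hull K ⊆ unionHull S := fun _ hx => mem_unionHull.2 ⟨K, hK, hx⟩

theorem unionHull_mono {d : ℕ} {S S' : Finset (Finset (Euc d))} (h : S ⊆ S') :
    unionHull S ⊆ unionHull S' := fun _ hx =>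
  let ⟨K, hK, hxK⟩ := mem_unionHull.1 hx
  mem_unionHull.2 ⟨K, h hK, hxK⟩

/-- Almost every point is interior to the simplices of `S` that contain it. -/
theorem ae_mem_interior_of_mem_hull {d : ℕ} (S : Finset (Finset (Euc d))) :
    ∀ᵐ x : Euc d, ∀ K ∈ S, x ∈ hull K → x ∈ interior (hull K) := by
  refine (Finset.eventually_all S).2 fun K _ => ?_
  have h : ∀ᵐ x : Euc d, x ∉ frontier (hull K) :=
    measure_eq_zero_iff_ae_notMem.1 ((convex_hull K).addHaar_frontier volume)
  filter_upwards [h] with x hx hxK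
  by_contra hcon
  exact hx ⟨subset_closure hxK, hcon⟩

namespace SimplicialMesh

variable {d ℓ : ℕ} (T : SimplicialMesh d)

theorem domain_eq : T.domain = interior (unionHull T.elems) := rfl

theorem domain_subset : T.domain ⊆ unionHull T.elems := interior_subset

theorem isOpen_domain : IsOpen T.domain := isOpen_interior

theorem volume_domain_lt_top : volume T.domain < ⊤ :=
  (measure_mono T.domain_subset).trans_lt (isCompact_unionHull _).measure_lt_top

theorem interior_hull_subset_domain {K : Finset (Euc d)} (hK : K ∈ T.elems) :
    interior (hull K) ⊆ T.domain :=
  interior_mono (hull_subset_unionHull hK)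

theorem hull_inter {K K' : Finset (Euc d)} [DecidableEq (Euc d)] (hK : K ∈ T.elems)
    (hK' : K' ∈ T.elems) : hull K ∩ hull K' = hull (K ∩ K') := by
  have := T.conforming K hK K' hK'
  rwa [← Finset.coe_inter] at this

/-- An interior point of `K` has positive coordinates at all vertices, while lying in the common
subsimplex forces them to vanish outside `K'`. Hence $K\subseteq K'$, and both have $d+1$ vertices.
-/
theorem eq_of_mem_interior {K K' : Finset (Euc d)} (hK : K ∈ T.elems) (hK' : K' ∈ T.elems)
    {x : Euc d} (hx : x ∈ interior (hull K)) (hx' : x ∈ hull K') : K = K' := by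
  classical
  have h1 : x ∈ hull (K ∩ K') := by
    rw [← T.hull_inter hK hK']; exact ⟨interior_subset hx, hx'⟩
  have h2 := ((T.isSimplex hK).mem_hull_subset_iff Finset.inter_subset_left).1 h1
  have h3 := (T.isSimplex hK).mem_interior_iff.1 hx
  have h4 : K ⊆ K' := by
    intro y hy
    by_contra hy'
    exact (h3 y hy).ne' (h2.2 y hy fun h => hy' (Finset.mem_inter.1 h).2)
  exact Finset.eq_of_subset_of_card_le h4 (by rw [T.card_eq K hK, T.card_eq K' hK'])

theorem interior_unionHull_ae_eq {S : Finset (Finset (Euc d))} :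
    (interior (unionHull S) : Set (Euc d)) =ᵐ[volume] ⋃ K ∈ S, interior (hull K) := by
  refine (eventuallyEq_set.2 ?_)
  filter_upwards [ae_mem_interior_of_mem_hull S] with x hx
  constructor
  · intro hxU
    obtain ⟨K, hK, hxK⟩ := mem_unionHull.1 (interior_subset hxU)
    exact Set.mem_biUnion hK (hx K hK hxK)
  · intro h
    simp only [Set.mem_iUnion] at h
    obtain ⟨K, hK, hxK⟩ := h
    exact interior_mono (hull_subset_unionHull hK) hxK

theorem hull_ae_eq_interior (K : Finset (Euc d)) :
    (interior (hull K) : Set (Euc d)) =ᵐ[volume] hull K :=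
  eventuallyEq_set.2 <| by
    filter_upwards [ae_mem_interior_of_mem_hull {K}] with x hx
    exact ⟨fun h => interior_subset h, fun h => hx K (Finset.mem_singleton_self K) h⟩

theorem integral_interior_unionHull {f : Euc d → ℝ} (hf : IntegrableOn f T.domain)
    {S : Finset (Finset (Euc d))} (hS : S ⊆ T.elems) :
    ∫ x in interior (unionHull S), f x = ∑ K ∈ S, ∫ x in hull K, f x := by
  rw [setIntegral_congr_set interior_unionHull_ae_eq, integral_biUnion_finset]
  · exact Finset.sum_congr rfl fun K _ => setIntegral_congr_set (hull_ae_eq_interior K)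
  · exact fun K _ => isOpen_interior.measurableSet
  · intro K hK K' hK' hne
    refine Set.disjoint_left.2 fun x hx hx' => hne ?_
    exact T.eq_of_mem_interior (hS hK) (hS hK') hx (interior_subset hx')
  · exact fun K hK => hf.mono_set (T.interior_hull_subset_domain (hS hK))

variable {T}

/-- The polynomial that represents the finite element function `v` on the element `K`. -/
theorem exists_polyFun {v : Euc d → ℝ} (hv : v ∈ T.feSpace ℓ) {K : Finset (Euc d)}
    (hK : K ∈ T.elems) : ∃ q : Euc d → ℝ, PolyFun ℓ q ∧ Set.EqOn v q (hull K) := by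
  obtain ⟨p, hp, hpe⟩ := hv.2 K hK
  exact ⟨fun x => MvPolynomial.eval (fun i => x i) p, ⟨p, hp, fun _ => rfl⟩, hpe⟩

theorem mem_feSpace_iff {v : Euc d → ℝ} : v ∈ T.feSpace ℓ ↔ ContinuousOn v T.domain ∧
    ∀ K ∈ T.elems, ∃ q : Euc d → ℝ, PolyFun ℓ q ∧ Set.EqOn v q (hull K) := by
  refine ⟨fun h => ⟨h.1, fun K hK => exists_polyFun h hK⟩, fun h => ⟨h.1, fun K hK => ?_⟩⟩
  obtain ⟨q, ⟨p, hp, hpq⟩, hq⟩ := h.2 K hK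
  exact ⟨p, hp, fun x hx => (hq hx).trans (hpq x)⟩

theorem fderiv_eq_of_eqOn {v q : Euc d → ℝ} {K : Finset (Euc d)} (h : Set.EqOn v q (hull K))
    {x : Euc d} (hx : x ∈ interior (hull K)) : v =ᶠ[𝓝 x] q := by
  filter_upwards [isOpen_interior.mem_nhds hx] with y hy using h (interior_subset hy)

theorem gradient_eq_of_eqOn {v q : Euc d → ℝ} {K : Finset (Euc d)}
    (h : Set.EqOn v q (hull K)) {x : Euc d} (hx : x ∈ interior (hull K)) :
    gradient v x = gradient q x := by
  simp only [gradient, (fderiv_eq_of_eqOn h hx).fderiv_eq]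

/-- A finite element function is Lipschitz on each element, with a uniform constant. -/
theorem exists_lipschitz {v : Euc d → ℝ} (hv : v ∈ T.feSpace ℓ) :
    ∃ M : ℝ, 0 ≤ M ∧ ∀ K ∈ T.elems,
      (∀ x ∈ hull K, ∀ y ∈ hull K, |v x - v y| ≤ M * ‖x - y‖) ∧ (∀ x ∈ hull K, |v x| ≤ M) ∧
      ∀ x ∈ interior (hull K), ‖gradient v x‖ ≤ M := by
  have h : ∀ K ∈ T.elems, ∃ M : ℝ, 0 ≤ M ∧
      (∀ x ∈ hull K, ∀ y ∈ hull K, |v x - v y| ≤ M * ‖x - y‖) ∧ (∀ x ∈ hull K, |v x| ≤ M) ∧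
      ∀ x ∈ interior (hull K), ‖gradient v x‖ ≤ M := by
    intro K hK
    obtain ⟨q, hq, hvq⟩ := exists_polyFun hv hK
    have hs := hq.contDiff
    obtain ⟨B1, hB1⟩ := (isCompact_hull K).exists_bound_of_continuousOn hs.continuous.continuousOn
    obtain ⟨B2, hB2⟩ := (isCompact_hull K).exists_bound_of_continuousOn
      (hs.continuous_fderiv (by simp)).continuousOn
    set M := max 0 (max B1 B2)
    have hM1 : B1 ≤ M := (le_max_left _ _).trans (le_max_right _ _)
    have hM2 : B2 ≤ M := (le_max_right _ _).trans (le_max_right _ _)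
    refine ⟨M, le_max_left _ _, fun x hx y hy => ?_, fun x hx => ?_, fun x hx => ?_⟩
    · rw [hvq hx, hvq hy]
      exact (convex_hull K).norm_image_sub_le_of_norm_fderiv_le
        (fun z _ => hs.differentiable (by simp) z) (fun z hz => (hB2 z hz).trans hM2) hy hx
    · rw [hvq hx]; exact (hB1 x hx).trans hM1
    · rw [gradient_eq_of_eqOn hvq hx, norm_gradient]
      exact (hB2 x (interior_subset hx)).trans hM2
  choose! M hM0 hM using h
  have hle : ∀ K ∈ T.elems, M K ≤ ∑ K ∈ T.elems, M K :=
    fun K hK => Finset.single_le_sum hM0 hK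
  refine ⟨∑ K ∈ T.elems, M K, Finset.sum_nonneg hM0, fun K hK =>
    ⟨fun x hx y hy => ((hM K hK).1 x hx y hy).trans ?_, fun x hx => ((hM K hK).2.1 x hx).trans
      (hle K hK), fun x hx => ((hM K hK).2.2 x hx).trans (hle K hK)⟩⟩
  exact mul_le_mul_of_nonneg_right (hle K hK) (norm_nonneg _)

/-- Only local, since a segment between two points of $\Omega$ may leave $\Omega$. Inside a ball
contained in $\Omega$ the elements form a finite closed cover of the segment. -/
theorem locallyLipschitzOn {v : Euc d → ℝ} (hv : v ∈ T.feSpace ℓ) :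
    LocallyLipschitzOn T.domain v := by
  obtain ⟨M, hM0, hM⟩ := exists_lipschitz hv
  intro x hx
  obtain ⟨r, hr, hball⟩ := Metric.isOpen_iff.1 T.isOpen_domain x hx
  refine ⟨M.toNNReal, Metric.ball x r, mem_nhdsWithin_of_mem_nhds (Metric.ball_mem_nhds x hr), ?_⟩
  refine LipschitzOnWith.of_dist_le_mul fun a ha b hb => ?_
  rw [Real.dist_eq, dist_eq_norm, Real.coe_toNNReal _ hM0]
  have hseg : segment ℝ a b ⊆ T.domain := ((convex_ball x r).segment_subset ha hb).trans hball
  refine abs_sub_le_of_closed_cover T.elems (A := hull) (fun K _ => isClosed_hull K)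
    (hv.1.mono hseg) (hseg.trans T.domain_subset) fun K hK y hy z hz => ?_
  exact (hM K hK).1 y hy.1 z hz.1

theorem memLp_feSpace {v : Euc d → ℝ} (hv : v ∈ T.feSpace ℓ) :
    MemLp v 2 (volume.restrict T.domain) := by
  have : IsFiniteMeasure (volume.restrict T.domain) := ⟨by simpa using T.volume_domain_lt_top⟩
  obtain ⟨M, hM0, hM⟩ := exists_lipschitz hv
  refine MemLp.of_bound (hv.1.aestronglyMeasurable T.isOpen_domain.measurableSet) M ?_
  refine (ae_restrict_iff' T.isOpen_domain.measurableSet).2 (Eventually.of_forall fun x hx => ?_)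
  obtain ⟨K, hK, hxK⟩ := mem_unionHull.1 (T.domain_subset hx)
  exact (hM K hK).2.1 x hxK

theorem memLp_gradient_feSpace {v : Euc d → ℝ} (hv : v ∈ T.feSpace ℓ) :
    MemLp (gradient v) 2 (volume.restrict T.domain) := by
  have : IsFiniteMeasure (volume.restrict T.domain) := ⟨by simpa using T.volume_domain_lt_top⟩
  obtain ⟨M, hM0, hM⟩ := exists_lipschitz hv
  refine MemLp.of_bound (measurable_gradient v).aestronglyMeasurable M ?_
  refine (ae_restrict_iff' T.isOpen_domain.measurableSet).2 ?_
  filter_upwards [ae_mem_interior_of_mem_hull T.elems] with x hx hxU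
  obtain ⟨K, hK, hxK⟩ := mem_unionHull.1 (T.domain_subset hxU)
  exact (hM K hK).2.2 x (hx K hK hxK)

/-- The piecewise gradient of a finite element function is its weak gradient. -/
theorem isWeakGradient_feSpace {v : Euc d → ℝ} (hv : v ∈ T.feSpace ℓ) :
    IsWeakGradient T.domain v (gradient v) := by
  refine ⟨memLp_gradient_feSpace hv, fun φ hφ => ?_⟩
  have hφL : ∃ D, LipschitzWith D φ :=
    (hφ.1.of_le (by simp)).lipschitzWith_of_hasCompactSupport hφ.2.1 (n := 1) one_ne_zero
  obtain ⟨D, hD⟩ := hφL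
  -- On the compact support of the test function, local Lipschitz continuity becomes a single
  -- Lipschitz bound. The restriction then extends to a globally Lipschitz `f`, to which integration
  -- by parts on the whole space applies.
  obtain ⟨C, hC⟩ := ((locallyLipschitzOn hv).mono hφ.2.2).exists_lipschitzOnWith_of_compact
    hφ.2.1.isCompact
  obtain ⟨f, hf, hfv⟩ := hC.extend_real
  have i1 : Integrable (fun x => v x • gradient φ x) (volume.restrict T.domain) :=
    integrable_smul_of_memLp (memLp_feSpace hv) hφ.memLp_gradient
  have i2 : Integrable (fun x => φ x • gradient v x) (volume.restrict T.domain) :=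
    integrable_smul_of_memLp hφ.memLp (memLp_gradient_feSpace hv)
  refine ext_inner_left ℝ fun e => ?_
  rw [inner_neg_right, ← integral_inner i1, ← integral_inner i2]
  have key := LipschitzWith.integral_lineDeriv_mul_eq (μ := (volume : Measure (Euc d))) hf hD hφ.2.1 e
  have hinner : ∀ (w : Euc d → ℝ) (x : Euc d), inner ℝ e (gradient w x) = fderiv ℝ w x e := by
    intro w x
    rw [real_inner_comm, gradient, InnerProductSpace.toDual_symm_apply]
  rw [setIntegral_eq_integral_of_forall_compl_eq_zero fun x hx => by
      rw [gradient_eq_zero_of_notMem_tsupport fun h' => hx (hφ.2.2 h'), smul_zero,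
        inner_zero_right],
    setIntegral_eq_integral_of_forall_compl_eq_zero fun x hx => by
      rw [image_eq_zero_of_notMem_tsupport fun h' => hx (hφ.2.2 h'), zero_smul,
        inner_zero_right]]
  have e1 : ∫ x, inner ℝ e (φ x • gradient v x) = ∫ x, lineDeriv ℝ f x e * φ x := by
    refine integral_congr_ae ?_
    filter_upwards [ae_mem_interior_of_mem_hull T.elems] with x hx
    rw [real_inner_smul_right, hinner, mul_comm]
    by_cases h0 : φ x = 0
    · rw [h0, mul_zero, mul_zero]
    have hxS : x ∈ tsupport φ := subset_tsupport φ h0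
    obtain ⟨K, hK, hxK⟩ := mem_unionHull.1 (T.domain_subset (hφ.2.2 hxS))
    obtain ⟨q, hq, hvq⟩ := exists_polyFun hv hK
    have hvd : DifferentiableAt ℝ v x :=
      (hq.contDiff.differentiable (by simp) x).congr_of_eventuallyEq
        (fderiv_eq_of_eqOn hvq (hx K hK hxK))
    have hfe : f =ᶠ[𝓝 x] v := by
      filter_upwards [(hφ.1.continuous.isOpen_support).mem_nhds (show x ∈ Function.support φ from h0)]
        with y hy
      exact (hfv (subset_tsupport φ hy)).symm
    rw [(hvd.congr_of_eventuallyEq hfe).lineDeriv_eq_fderiv, hfe.fderiv_eq]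
  have e2 : ∫ x, inner ℝ e (v x • gradient φ x) = -∫ x, lineDeriv ℝ φ x (-e) * f x := by
    rw [← integral_neg]
    congr 1
    ext x
    rw [real_inner_smul_right, hinner, lineDeriv_neg,
      ((hφ.1.differentiable (by simp)) x).lineDeriv_eq_fderiv]
    by_cases hxS : x ∈ tsupport φ
    · rw [hfv hxS]; ring
    · rw [show fderiv ℝ φ x = 0 from
        image_eq_zero_of_notMem_tsupport fun h => hxS (tsupport_fderiv_subset ℝ h)]
      simp
  rw [e1, e2, key]

end SimplicialMesh

/-! ### Lipschitz functions and `H¹₀` -/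

section Lipschitz

variable {d : ℕ} {U : Set (Euc d)} {f : Euc d → ℝ} {C : NNReal}

theorem inner_gradient (w : Euc d → ℝ) (e x : Euc d) :
    inner ℝ e (gradient w x) = fderiv ℝ w x e := by
  rw [real_inner_comm, gradient, InnerProductSpace.toDual_symm_apply]

theorem LipschitzWith.norm_gradient_le (hf : LipschitzWith C f) (x : Euc d) :
    ‖gradient f x‖ ≤ C := by
  rw [norm_gradient]; exact norm_fderiv_le_of_lipschitz ℝ hf

theorem memLp_gradient_of_lipschitz (hfin : volume U < ⊤) (hf : LipschitzWith C f) :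
    MemLp (gradient f) 2 (volume.restrict U) := by
  have : IsFiniteMeasure (volume.restrict U) := ⟨by simpa using hfin⟩
  exact MemLp.of_bound (measurable_gradient f).aestronglyMeasurable C
    (Eventually.of_forall hf.norm_gradient_le)

theorem isWeakGradient_of_lipschitz (hfin : volume U < ⊤) (hf : LipschitzWith C f) :
    IsWeakGradient U f (gradient f) := by
  refine ⟨memLp_gradient_of_lipschitz hfin hf, fun φ hφ => ?_⟩
  obtain ⟨D, hD⟩ : ∃ D, LipschitzWith D φ :=
    (hφ.1.of_le (by simp)).lipschitzWith_of_hasCompactSupport hφ.2.1 (n := 1) one_ne_zero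
  have i1 : Integrable (fun x => f x • gradient φ x) (volume.restrict U) :=
    ((hf.continuous.smul hφ.continuous_gradient).integrable_of_hasCompactSupport
      hφ.hasCompactSupport_gradient.smul_left).restrict
  have i2 : Integrable (fun x => φ x • gradient f x) (volume.restrict U) :=
    integrable_smul_of_memLp hφ.memLp (memLp_gradient_of_lipschitz hfin hf)
  refine ext_inner_left ℝ fun e => ?_
  rw [inner_neg_right, ← integral_inner i1, ← integral_inner i2]
  have key := LipschitzWith.integral_lineDeriv_mul_eq (μ := (volume : Measure (Euc d))) hf hD
    hφ.2.1 e
  rw [setIntegral_eq_integral_of_forall_compl_eq_zero fun x hx => by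
      rw [gradient_eq_zero_of_notMem_tsupport fun h' => hx (hφ.2.2 h'), smul_zero,
        inner_zero_right],
    setIntegral_eq_integral_of_forall_compl_eq_zero fun x hx => by
      rw [image_eq_zero_of_notMem_tsupport fun h' => hx (hφ.2.2 h'), zero_smul,
        inner_zero_right]]
  have e1 : ∫ x, inner ℝ e (φ x • gradient f x) = ∫ x, lineDeriv ℝ f x e * φ x := by
    refine integral_congr_ae ?_
    filter_upwards [hf.ae_differentiableAt] with x hx
    rw [real_inner_smul_right, inner_gradient, mul_comm, hx.lineDeriv_eq_fderiv]
  have e2 : ∫ x, inner ℝ e (f x • gradient φ x) = -∫ x, lineDeriv ℝ φ x (-e) * f x := by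
    rw [← integral_neg]
    congr 1
    ext x
    rw [real_inner_smul_right, inner_gradient, lineDeriv_neg,
      ((hφ.1.differentiable (by simp)) x).lineDeriv_eq_fderiv]
    ring
  rw [e1, e2, key]

theorem IsTestFunction.exists_lipschitz {φ : Euc d → ℝ} (hφ : IsTestFunction U φ) :
    ∃ D, LipschitzWith D φ :=
  (hφ.1.of_le (by simp)).lipschitzWith_of_hasCompactSupport hφ.2.1 (n := 1) one_ne_zero

theorem IsTestFunction.isWeakGradient {φ : Euc d → ℝ} (hφ : IsTestFunction U φ)
    (hfin : volume U < ⊤) : IsWeakGradient U φ (gradient φ) :=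
  let ⟨_, hD⟩ := hφ.exists_lipschitz
  isWeakGradient_of_lipschitz hfin hD

/-! ### Mollification of Lipschitz functions. -/

/-- Standard mollification of `f` at scale `1 / (n + 1)`. -/
noncomputable def mollBump (d n : ℕ) : ContDiffBump (0 : Euc d) :=
  ⟨1 / (n + 1), 2 / (n + 1), by positivity, by gcongr; norm_num⟩

theorem tendsto_mollBump_rOut (d : ℕ) :
    Tendsto (fun n => (mollBump d n).rOut) atTop (𝓝 0) := by
  have : Tendsto (fun n : ℕ => 2 * (1 / ((n : ℝ) + 1))) atTop (𝓝 (2 * 0)) :=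
    tendsto_one_div_add_atTop_nhds_zero_nat.const_mul 2
  simpa [mollBump, div_eq_mul_inv] using this

/-- The mollification of `f`. -/
noncomputable def mollify (n : ℕ) (f : Euc d → ℝ) : Euc d → ℝ :=
  convolution ((mollBump d n).normed volume) f (ContinuousLinearMap.lsmul ℝ ℝ) volume

/-- The derivative falls on `f` rather than on the kernel: by Rademacher `f` is differentiable
almost everywhere, and its Lipschitz bound dominates the difference quotients. Gradients of
mollifications thus inherit the Lipschitz constant. -/
theorem hasFDerivAt_mollify (hf : LipschitzWith C f) (n : ℕ) (x : Euc d) :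
    HasFDerivAt (mollify n f) (convolution ((mollBump d n).normed volume) (fderiv ℝ f)
      (ContinuousLinearMap.lsmul ℝ ℝ) volume x) x := by
  set ρ := (mollBump d n).normed (volume : Measure (Euc d))
  have hρc : Continuous ρ := (mollBump d n).continuous_normed
  have hρs : HasCompactSupport ρ := (mollBump d n).hasCompactSupport_normed
  have hρi : Integrable ρ := (mollBump d n).integrable_normed
  have hρ0 : ∀ t, 0 ≤ ρ t := (mollBump d n).nonneg_normed
  have hFc : ∀ x : Euc d, Continuous fun t => ρ t • f (x - t) := fun x =>
    hρc.smul (hf.continuous.comp (by fun_prop))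
  refine (hasFDerivAt_integral_of_dominated_loc_of_lip (F := fun x t => ρ t • f (x - t))
    (F' := fun t => ρ t • fderiv ℝ f (x - t)) (bound := fun t => C * ρ t) (s := Set.univ)
    univ_mem (Eventually.of_forall fun x => (hFc x).aestronglyMeasurable) ?_ ?_ ?_
    (hρi.const_mul _) ?_).2
  · exact (hFc x).integrable_of_hasCompactSupport hρs.smul_right
  · refine hρc.aestronglyMeasurable.smul ?_
    exact ((measurable_fderiv ℝ f).comp (by fun_prop)).aestronglyMeasurable
  · refine Eventually.of_forall fun t => ?_
    refine (LipschitzWith.of_dist_le_mul fun a b => ?_).lipschitzOnWith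
    rw [Real.coe_nnabs, abs_of_nonneg (mul_nonneg C.coe_nonneg (hρ0 t)), dist_smul₀, Real.norm_eq_abs,
      abs_of_nonneg (hρ0 t), mul_comm (C : ℝ), mul_assoc]
    refine mul_le_mul_of_nonneg_left ?_ (hρ0 t)
    simpa using hf.dist_le_mul (a - t) (b - t)
  · have h := (Measure.measurePreserving_sub_left (volume : Measure (Euc d)) x).quasiMeasurePreserving.ae
      hf.ae_differentiableAt
    filter_upwards [h] with t ht
    have h1 : HasFDerivAt (fun y : Euc d => f (y - t)) (fderiv ℝ f (x - t)) x := by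
      simpa [Function.comp_def] using ht.hasFDerivAt.comp x ((hasFDerivAt_id x).sub_const t)
    exact h1.const_smul (ρ t)

theorem norm_fderiv_mollify_le (hf : LipschitzWith C f) (n : ℕ) (x : Euc d) :
    ‖fderiv ℝ (mollify n f) x‖ ≤ C := by
  set ρ := (mollBump d n).normed (volume : Measure (Euc d))
  have hρi : Integrable ρ := (mollBump d n).integrable_normed
  have hρ0 : ∀ t, 0 ≤ ρ t := (mollBump d n).nonneg_normed
  rw [(hasFDerivAt_mollify hf n x).fderiv]
  calc _ ≤ ∫ t, C * ρ t := by
        refine norm_integral_le_of_norm_le (hρi.const_mul _) (Eventually.of_forall fun t => ?_)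
        rw [ContinuousLinearMap.lsmul_apply, norm_smul, Real.norm_of_nonneg (hρ0 t), mul_comm]
        exact mul_le_mul_of_nonneg_right (norm_fderiv_le_of_lipschitz ℝ hf) (hρ0 t)
    _ = C := by
        rw [integral_const_mul, ContDiffBump.integral_normed, mul_one]

theorem abs_mollify_sub_le (hf : LipschitzWith C f) (n : ℕ) (x : Euc d) :
    |mollify n f x - f x| ≤ C * (mollBump d n).rOut := by
  rw [← Real.dist_eq]
  refine ContDiffBump.dist_normed_convolution_le hf.continuous.aestronglyMeasurable
    fun y hy => (hf.dist_le_mul y x).trans ?_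
  gcongr
  exact (Metric.mem_ball.1 hy).le

theorem isTestFunction_mollify (hU : IsOpen U) (hf : LipschitzWith C f)
    (hc : HasCompactSupport f) (hsub : tsupport f ⊆ U) :
    ∀ᶠ n in atTop, IsTestFunction U (mollify n f) := by
  obtain ⟨δ, hδ, hδU⟩ := hc.isCompact.exists_cthickening_subset_open hU hsub
  filter_upwards [(tendsto_mollBump_rOut d).eventually (gt_mem_nhds hδ)] with n hn
  refine ⟨?_, ?_, ?_⟩
  · exact (mollBump d n).hasCompactSupport_normed.contDiff_convolution_left _
      (mollBump d n).contDiff_normed hf.continuous.locallyIntegrable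
  · exact (mollBump d n).hasCompactSupport_normed.convolution _ hc
  · refine (closure_minimal ?_ Metric.isClosed_cthickening).trans hδU
    refine (support_convolution_subset _).trans ?_
    rw [ContDiffBump.support_normed_eq]
    rintro _ ⟨a, ha, b, hb, rfl⟩
    refine Metric.mem_cthickening_of_dist_le _ b δ _ (subset_tsupport f hb) ?_
    have : ‖a‖ < (mollBump d n).rOut := by simpa using ha
    simpa [dist_eq_norm] using (this.trans hn).le

theorem gradient_sub_norm (f g : Euc d → ℝ) (x : Euc d) :
    ‖gradient f x - gradient g x‖ = ‖fderiv ℝ f x - fderiv ℝ g x‖ := by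
  rw [gradient, gradient, ← map_sub]
  exact (InnerProductSpace.toDual ℝ (Euc d)).symm.norm_map _

/-- A Lipschitz function with compact support in `U` is approximated by test functions. -/
theorem exists_testFunction_near_lipschitz (hU : IsOpen U) (hfin : volume U < ⊤)
    (hf : LipschitzWith C f) (hc : HasCompactSupport f) (hsub : tsupport f ⊆ U) {κ : ℝ}
    (hκ : 0 < κ) : ∃ φ, IsTestFunction U φ ∧
      (∫ x in U, (f x - φ x) ^ 2) + ∫ x in U, ‖gradient f x - gradient φ x‖ ^ 2 < κ := by
  have : IsFiniteMeasure (volume.restrict U) := ⟨by simpa using hfin⟩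
  have hr2 : ∀ n, (mollBump d n).rOut ≤ 2 := fun n => by
    change (2 : ℝ) / (n + 1) ≤ 2
    rw [div_le_iff₀ (by positivity)]
    have : (0 : ℝ) ≤ n := by positivity
    linarith
  have hmc : ∀ n, Continuous (mollify n f) := fun n =>
    continuous_iff_continuousAt.2 fun x => (hasFDerivAt_mollify hf n x).continuousAt
  have t1 : Tendsto (fun n => ∫ x in U, (f x - mollify n f x) ^ 2) atTop
      (𝓝 (∫ x in U, (0 : ℝ))) := by
    refine tendsto_integral_of_dominated_convergence (fun _ => (C * 2) ^ 2) (fun n => ?_)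
      (integrable_const _) (fun n => Eventually.of_forall fun x => ?_)
      (Eventually.of_forall fun x => ?_)
    · exact ((hf.continuous.sub (hmc n)).pow 2).aestronglyMeasurable
    · rw [Real.norm_of_nonneg (sq_nonneg _), ← sq_abs, abs_sub_comm]
      refine pow_le_pow_left₀ (abs_nonneg _) ((abs_mollify_sub_le hf n x).trans ?_) 2
      exact mul_le_mul_of_nonneg_left (hr2 n) C.coe_nonneg
    · have h0 : Tendsto (fun n => ((C : ℝ) * (mollBump d n).rOut) ^ 2) atTop (𝓝 ((C * 0) ^ 2)) :=
        ((tendsto_mollBump_rOut d).const_mul _).pow 2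
      rw [mul_zero, zero_pow two_ne_zero] at h0
      refine squeeze_zero (fun n => sq_nonneg _) (fun n => ?_) h0
      rw [← sq_abs, abs_sub_comm]
      exact pow_le_pow_left₀ (abs_nonneg _) (abs_mollify_sub_le hf n x) 2
  have t2 : Tendsto (fun n => ∫ x in U, ‖gradient f x - gradient (mollify n f) x‖ ^ 2) atTop
      (𝓝 (∫ x in U, (0 : ℝ))) := by
    refine tendsto_integral_of_dominated_convergence (fun _ => ((C : ℝ) + C) ^ 2) (fun n => ?_)
      (integrable_const _) (fun n => Eventually.of_forall fun x => ?_) ?_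
    · exact (((measurable_gradient _).sub (measurable_gradient _)).norm.pow_const
        2).aestronglyMeasurable
    · rw [Real.norm_of_nonneg (sq_nonneg _)]
      refine pow_le_pow_left₀ (norm_nonneg _) ((norm_sub_le _ _).trans ?_) 2
      refine add_le_add (hf.norm_gradient_le x) ?_
      rw [norm_gradient]
      exact norm_fderiv_mollify_le hf n x
    · have hli : LocallyIntegrable (fderiv ℝ f) (volume : Measure (Euc d)) := by
        refine locallyIntegrable_const (C : ℝ) |>.mono
          (measurable_fderiv ℝ f).aestronglyMeasurable (Eventually.of_forall fun x => ?_)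
        rw [Real.norm_of_nonneg C.coe_nonneg]
        exact norm_fderiv_le_of_lipschitz ℝ hf
      -- The gradient is only bounded and measurable, so its averages converge almost everywhere by
      -- Lebesgue differentiation. The uniform bound upgrades this to $L^2$ convergence on $U$,
      -- which has finite volume.
      have hconv := ContDiffBump.ae_convolution_tendsto_right_of_locallyIntegrable
        (φ := fun n => mollBump d n) (K := 2) (tendsto_mollBump_rOut d)
        (Eventually.of_forall fun n => by
          change (2 : ℝ) / (n + 1) ≤ 2 * (1 / (n + 1))
          rw [mul_one_div]) hli
      filter_upwards [ae_restrict_of_ae hconv] with x hx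
      have h1 : Tendsto (fun n => fderiv ℝ f x - fderiv ℝ (mollify n f) x) atTop (𝓝 0) := by
        simp only [fun n => (hasFDerivAt_mollify hf n x).fderiv]
        simpa using hx.const_sub (fderiv ℝ f x)
      have h2 := (h1.norm).pow 2
      simp only [gradient_sub_norm]
      simpa using h2
  simp only [integral_zero] at t1 t2
  have t3 := t1.add t2
  rw [add_zero] at t3
  obtain ⟨n, h1, h2⟩ := ((t3.eventually (gt_mem_nhds hκ)).and
    (isTestFunction_mollify hU hf hc hsub)).exists
  exact ⟨_, h2, h1⟩

/-! ### Cutting off near the boundary. -/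

/-- The distance cutoff `min (1, max (0, dist(x, Uᶜ) / δ - 1))`. -/
noncomputable def distCutoff (U : Set (Euc d)) (δ : ℝ) (x : Euc d) : ℝ :=
  min 1 (max 0 (Metric.infDist x Uᶜ / δ - 1))

theorem distCutoff_nonneg (δ : ℝ) (x : Euc d) : 0 ≤ distCutoff U δ x :=
  le_min zero_le_one (le_max_left _ _)

theorem distCutoff_le_one (δ : ℝ) (x : Euc d) : distCutoff U δ x ≤ 1 := min_le_left _ _

theorem abs_distCutoff_sub_le {δ : ℝ} (hδ : 0 < δ) (x y : Euc d) :
    |distCutoff U δ x - distCutoff U δ y| ≤ ‖x - y‖ / δ := by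
  have h1 : |distCutoff U δ x - distCutoff U δ y| ≤
      |(Metric.infDist x Uᶜ / δ - 1) - (Metric.infDist y Uᶜ / δ - 1)| := by
    refine (abs_min_sub_min_le_max _ _ _ _).trans ?_
    rw [sub_self, abs_zero, max_eq_right (abs_nonneg _)]
    refine (abs_max_sub_max_le_max _ _ _ _).trans ?_
    rw [sub_self, abs_zero, max_eq_right (abs_nonneg _)]
  refine h1.trans ?_
  rw [show (Metric.infDist x Uᶜ / δ - 1) - (Metric.infDist y Uᶜ / δ - 1) =
    (Metric.infDist x Uᶜ - Metric.infDist y Uᶜ) / δ by ring, abs_div, abs_of_pos hδ]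
  gcongr
  have := (Metric.lipschitz_infDist_pt Uᶜ).dist_le_mul x y
  simpa [Real.dist_eq, dist_eq_norm] using this

/-- A Lipschitz function that vanishes outside of `U` is approximated by Lipschitz functions with
compact support in `U`. -/
theorem exists_compactSupport_near_lipschitz (hU : IsOpen U) (hb : Bornology.IsBounded U)
    (hne : Uᶜ.Nonempty) (hf : LipschitzWith C f) (h0 : ∀ x ∉ U, f x = 0) {κ : ℝ} (hκ : 0 < κ) :
    ∃ (g : Euc d → ℝ) (D : NNReal), LipschitzWith D g ∧ HasCompactSupport g ∧ tsupport g ⊆ U ∧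
      (∫ x in U, (f x - g x) ^ 2) + ∫ x in U, ‖gradient f x - gradient g x‖ ^ 2 < κ := by
  have hfin : volume U < ⊤ := hb.measure_lt_top
  have : IsFiniteMeasure (volume.restrict U) := ⟨by simpa using hfin⟩
  have hcl : IsClosed Uᶜ := hU.isClosed_compl
  have hfd : ∀ x, |f x| ≤ C * Metric.infDist x Uᶜ := by
    intro x
    obtain ⟨y, hy, hxy⟩ := hcl.exists_infDist_eq_dist hne x
    have := hf.dist_le_mul x y
    rwa [h0 y hy, Real.dist_eq, sub_zero, ← hxy] at this
  let δ : ℕ → ℝ := fun n => 1 / ((n : ℝ) + 1)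
  have hδ : ∀ n, 0 < δ n := fun n => by positivity
  have hδ1 : ∀ n, δ n ≤ 1 := fun n => by
    simp only [δ]
    rw [div_le_one (by positivity)]
    have : (0 : ℝ) ≤ n := by positivity
    linarith
  let z : ℕ → Euc d → ℝ := fun n x => (1 - distCutoff U (δ n) x) * f x
  have hzfar : ∀ n x, 2 * δ n ≤ Metric.infDist x Uᶜ → z n x = 0 := by
    intro n x hx
    have h1 : 1 ≤ Metric.infDist x Uᶜ / δ n - 1 := by
      rw [le_sub_iff_add_le, le_div_iff₀ (hδ n)]; linarith
    simp only [z, distCutoff]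
    rw [max_eq_right (by linarith), min_eq_left h1, sub_self, zero_mul]
  have hznear : ∀ n x y, Metric.infDist y Uᶜ ≤ 2 * δ n →
      |z n x - z n y| ≤ 3 * C * ‖x - y‖ := by
    intro n x y hy
    -- The slope $1/\delta$ of the cutoff meets $|f|\le 2C\delta$ in the layer where it acts,
    -- because `f` vanishes outside `U`. So the removed part `z n` is Lipschitz with constant $3C$
    -- for every `n`.
    have e : z n x - z n y = (1 - distCutoff U (δ n) x) * (f x - f y) -
        (distCutoff U (δ n) x - distCutoff U (δ n) y) * f y := by simp only [z]; ring
    rw [e]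
    refine (abs_sub _ _).trans ?_
    rw [abs_mul, abs_mul]
    have h1 : |1 - distCutoff U (δ n) x| ≤ 1 := by
      rw [abs_le]
      constructor <;> linarith [distCutoff_nonneg (U := U) (δ n) x,
        distCutoff_le_one (U := U) (δ n) x]
    have h2 : |f x - f y| ≤ C * ‖x - y‖ := by
      simpa [Real.dist_eq, dist_eq_norm] using hf.dist_le_mul x y
    have h3 := abs_distCutoff_sub_le (U := U) (hδ n) x y
    have h4 : |f y| ≤ C * (2 * δ n) :=
      (hfd y).trans (mul_le_mul_of_nonneg_left hy C.coe_nonneg)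
    calc _ ≤ 1 * (C * ‖x - y‖) + ‖x - y‖ / δ n * (C * (2 * δ n)) := by
          gcongr
      _ = 3 * C * ‖x - y‖ := by have := (hδ n).ne'; field_simp; ring
  have hzL : ∀ n, LipschitzWith (3 * C) (z n) := by
    intro n
    refine LipschitzWith.of_dist_le_mul fun x y => ?_
    rw [Real.dist_eq, dist_eq_norm]
    push_cast
    rcases le_total (Metric.infDist y Uᶜ) (2 * δ n) with hy | hy
    · exact hznear n x y hy
    rcases le_total (Metric.infDist x Uᶜ) (2 * δ n) with hx | hx
    · rw [abs_sub_comm, norm_sub_rev]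
      exact hznear n y x hx
    · rw [hzfar n x hx, hzfar n y hy, sub_self, abs_zero]
      positivity
  have hzb : ∀ n x, |z n x| ≤ 2 * C := by
    intro n x
    rcases le_total (Metric.infDist x Uᶜ) (2 * δ n) with hx | hx
    · simp only [z, abs_mul]
      have h1 : |1 - distCutoff U (δ n) x| ≤ 1 := by
        rw [abs_le]
        constructor <;> linarith [distCutoff_nonneg (U := U) (δ n) x,
          distCutoff_le_one (U := U) (δ n) x]
      have h4 : |f x| ≤ 2 * C := (hfd x).trans (by
        have := mul_le_mul_of_nonneg_left (hx.trans (by linarith [hδ1 n] : 2 * δ n ≤ 2)) C.coe_nonneg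
        linarith)
      calc _ ≤ 1 * (2 * (C : ℝ)) := by gcongr
        _ = _ := one_mul _
    · rw [hzfar n x hx, abs_zero]; positivity
  have hδ0 : Tendsto (fun n => 2 * δ n) atTop (𝓝 0) := by
    have := (tendsto_one_div_add_atTop_nhds_zero_nat (𝕜 := ℝ)).const_mul 2
    rwa [mul_zero] at this
  -- The removed part disappears eventually near every point of `U`. With the uniform bounds,
  -- dominated convergence then handles values and gradients alike.
  have hev : ∀ x ∈ U, ∀ᶠ n in atTop, z n =ᶠ[𝓝 x] fun _ => 0 := by
    intro x hx
    have hpos : 0 < Metric.infDist x Uᶜ :=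
      (hcl.notMem_iff_infDist_pos hne).1 fun h => h hx
    filter_upwards [hδ0.eventually (gt_mem_nhds hpos)] with n hn
    have hc : Continuous fun y => Metric.infDist y Uᶜ := Metric.continuous_infDist_pt _
    filter_upwards [hc.continuousAt.eventually (lt_mem_nhds hn)] with y hy
    exact hzfar n y hy.le
  have t1 : Tendsto (fun n => ∫ x in U, z n x ^ 2) atTop (𝓝 (∫ x in U, (0 : ℝ))) := by
    refine tendsto_integral_of_dominated_convergence (fun _ => (2 * C) ^ 2) (fun n => ?_)
      (integrable_const _) (fun n => Eventually.of_forall fun x => ?_)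
      ((ae_restrict_iff' hU.measurableSet).2 (Eventually.of_forall fun x hx => ?_))
    · exact ((hzL n).continuous.pow 2).aestronglyMeasurable
    · rw [Real.norm_of_nonneg (sq_nonneg _), ← sq_abs]
      exact pow_le_pow_left₀ (abs_nonneg _) (hzb n x) 2
    · refine tendsto_const_nhds.congr' ?_
      filter_upwards [hev x hx] with n hn
      rw [hn.self_of_nhds, zero_pow two_ne_zero]
  have t2 : Tendsto (fun n => ∫ x in U, ‖gradient (z n) x‖ ^ 2) atTop
      (𝓝 (∫ x in U, (0 : ℝ))) := by
    refine tendsto_integral_of_dominated_convergence (fun _ => ((3 * C : NNReal) : ℝ) ^ 2)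
      (fun n => ?_) (integrable_const _) (fun n => Eventually.of_forall fun x => ?_)
      ((ae_restrict_iff' hU.measurableSet).2 (Eventually.of_forall fun x hx => ?_))
    · exact ((measurable_gradient _).norm.pow_const 2).aestronglyMeasurable
    · rw [Real.norm_of_nonneg (sq_nonneg _)]
      exact pow_le_pow_left₀ (norm_nonneg _) ((hzL n).norm_gradient_le x) 2
    · refine tendsto_const_nhds.congr' ?_
      filter_upwards [hev x hx] with n hn
      rw [norm_gradient, hn.fderiv_eq]
      simp
  simp only [integral_zero] at t1 t2
  have t3 := t1.add t2
  rw [add_zero] at t3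
  obtain ⟨n, hn⟩ := (t3.eventually (gt_mem_nhds hκ)).exists
  have hgL : LipschitzWith (C + 3 * C) fun x => f x - z n x := hf.sub (hzL n)
  have hsupp : Function.support (fun x => f x - z n x) ⊆ {x | δ n ≤ Metric.infDist x Uᶜ} := by
    intro x hx
    by_contra hcon
    simp only [Set.mem_ofPred_eq, not_le] at hcon
    apply hx
    have h1 : Metric.infDist x Uᶜ / δ n - 1 ≤ 0 := by
      rw [sub_nonpos, div_le_one (hδ n)]; exact hcon.le
    simp only [z, distCutoff]
    rw [max_eq_left h1, min_eq_right zero_le_one]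
    ring
  have hts : tsupport (fun x => f x - z n x) ⊆ {x | δ n ≤ Metric.infDist x Uᶜ} :=
    closure_minimal hsupp (isClosed_le continuous_const (Metric.continuous_infDist_pt _))
  have htU : tsupport (fun x => f x - z n x) ⊆ U := by
    intro x hx
    by_contra hcon
    have h1 := hts hx
    simp only [Set.mem_ofPred_eq, Metric.infDist_zero_of_mem (show x ∈ Uᶜ from hcon)] at h1
    exact absurd h1 (not_le.2 (hδ n))
  refine ⟨_, _, hgL, ?_, htU, ?_⟩
  · exact Metric.isCompact_of_isClosed_isBounded (isClosed_tsupport _) (hb.subset htU)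
  · have e1 : ∫ x in U, (f x - (f x - z n x)) ^ 2 = ∫ x in U, z n x ^ 2 := by
      congr 1; ext x; ring
    have e2 : ∫ x in U, ‖gradient f x - gradient (fun x => f x - z n x) x‖ ^ 2 =
        ∫ x in U, ‖gradient (z n) x‖ ^ 2 := by
      refine integral_congr_ae (ae_restrict_of_ae ?_)
      filter_upwards [hf.ae_differentiableAt, (hzL n).ae_differentiableAt] with x h1 h2
      rw [gradient_sub_norm, fderiv_fun_sub h1 h2, norm_gradient]
      congr 2; abel
    rw [e1, e2]
    exact hn

end Lipschitz

/-! ### Finite element functions in `H¹₀` -/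

theorem noncompactSpace_euc {d : ℕ} (hd : 1 ≤ d) : NoncompactSpace (Euc d) := by
  have : Nonempty (Fin d) := ⟨⟨0, hd⟩⟩
  have : Nontrivial (Euc d) := inferInstance
  exact NormedSpace.noncompactSpace ℝ (Euc d)

namespace SimplicialMesh

variable {d ℓ : ℕ} {T : SimplicialMesh d}

theorem isBounded_domain : Bornology.IsBounded T.domain :=
  (isCompact_unionHull T.elems).isBounded.subset T.domain_subset

/-- A finite element function that vanishes on the boundary extends by zero to a Lipschitz
function. -/
theorem exists_lipschitz_extension {v : Euc d → ℝ} (hv : v ∈ T.feSpace ℓ)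
    (h0 : ∀ x ∈ unionHull T.elems, x ∉ T.domain → v x = 0) :
    ∃ C : NNReal, LipschitzWith C ((unionHull T.elems).indicator v) := by
  classical
  obtain ⟨M, hM0, hM⟩ := exists_lipschitz hv
  set W := (unionHull T.elems).indicator v
  -- The closed elements together with the closure of the exterior, indexed by `none`, cover the
  -- whole space. On that closure the extension is zero by the boundary assumption.
  let A : Option T.elems → Set (Euc d) := fun o =>
    o.elim (closure (unionHull T.elems)ᶜ) fun K => hull K.1
  have hA : ∀ o, IsClosed (A o) := by
    rintro (_ | K)
    · exact isClosed_closure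
    · exact isClosed_hull K.1
  have hcov : ⋃ o, A o = Set.univ := by
    refine Set.eq_univ_of_forall fun x => Set.mem_iUnion.2 ?_
    by_cases hx : x ∈ unionHull T.elems
    · obtain ⟨K, hK, hxK⟩ := mem_unionHull.1 hx
      exact ⟨some ⟨K, hK⟩, hxK⟩
    · exact ⟨none, subset_closure hx⟩
  have hWK : ∀ K ∈ T.elems, Set.EqOn W v (hull K) := fun K hK x hx =>
    Set.indicator_of_mem (hull_subset_unionHull hK hx) v
  have hW0 : ∀ x ∈ closure (unionHull T.elems)ᶜ, W x = 0 := by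
    intro x hx
    by_cases hxU : x ∈ unionHull T.elems
    · rw [show W x = v x from Set.indicator_of_mem hxU v]
      refine h0 x hxU fun hxd => ?_
      rw [closure_compl] at hx
      exact hx hxd
    · exact Set.indicator_of_notMem hxU v
  have hAL : ∀ o, ∀ x ∈ A o, ∀ y ∈ A o, |W x - W y| ≤ M * ‖x - y‖ := by
    rintro (_ | K) x hx y hy
    · rw [hW0 x hx, hW0 y hy, sub_self, abs_zero]; positivity
    · rw [hWK K.1 K.2 hx, hWK K.1 K.2 hy]; exact (hM K.1 K.2).1 x hx y hy
  have hWc : Continuous W := by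
    refine (locallyFinite_of_finite A).continuous hcov hA fun o => ?_
    have : LipschitzOnWith M.toNNReal W (A o) := LipschitzOnWith.of_dist_le_mul fun x hx y hy => by
      rw [Real.dist_eq, dist_eq_norm, Real.coe_toNNReal _ hM0]; exact hAL o x hx y hy
    exact this.continuousOn
  refine ⟨M.toNNReal, LipschitzWith.of_dist_le_mul fun x y => ?_⟩
  rw [Real.dist_eq, dist_eq_norm, Real.coe_toNNReal _ hM0]
  refine abs_sub_le_of_closed_cover Finset.univ (A := A) (fun o _ => hA o) hWc.continuousOn ?_
    fun o _ a ha b hb => hAL o a ha.1 b hb.1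
  simp only [Finset.mem_univ, Set.iUnion_true, hcov]
  exact Set.subset_univ _

/-- A finite element function that vanishes on the boundary belongs to `H¹₀`. -/
theorem mem_feSpaceZero_of_eq_zero (hd : 1 ≤ d) {v : Euc d → ℝ} (hv : v ∈ T.feSpace ℓ)
    (h0 : ∀ x ∈ unionHull T.elems, x ∉ T.domain → v x = 0) : v ∈ T.feSpaceZero ℓ := by
  refine ⟨hv, ⟨memLp_feSpace hv, _, isWeakGradient_feSpace hv⟩, ?_⟩
  obtain ⟨C, hC⟩ := exists_lipschitz_extension hv h0
  set W := (unionHull T.elems).indicator v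
  have hU := T.isOpen_domain
  have hfin := T.volume_domain_lt_top
  have hWv : Set.EqOn W v T.domain := fun x hx => Set.indicator_of_mem (T.domain_subset hx) v
  have hne : T.domainᶜ.Nonempty := by
    have := noncompactSpace_euc hd
    have h1 := (isCompact_unionHull T.elems).ne_univ
    obtain ⟨x, hx⟩ := Set.nonempty_compl.2 h1
    exact ⟨x, fun h => hx (T.domain_subset h)⟩
  have hW0 : ∀ x ∉ T.domain, W x = 0 := by
    intro x hx
    by_cases hxU : x ∈ unionHull T.elems
    · rw [show W x = v x from Set.indicator_of_mem hxU v]; exact h0 x hxU hx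
    · exact Set.indicator_of_notMem hxU v
  have hWw : IsWeakGradient T.domain v (gradient W) :=
    (isWeakGradient_of_lipschitz hfin hC).congr hU.measurableSet hWv
  have : IsFiniteMeasure (volume.restrict T.domain) := ⟨by simpa using hfin⟩
  have key : ∀ κ : ℝ, 0 < κ → ∃ φ, IsTestFunction T.domain φ ∧
      rdNorm 1 T.domain (v - φ) ^ 2 < κ := by
    intro κ hκ
    -- First cut off to compact support, then mollify. The quarters absorb the factor two from
    -- $(a+b)^2\le2a^2+2b^2$.
    obtain ⟨g, D, hg, hgc, hgs, hgκ⟩ :=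
      exists_compactSupport_near_lipschitz hU isBounded_domain hne hC hW0
        (show 0 < κ / 4 by positivity)
    obtain ⟨φ, hφ, hφκ⟩ := exists_testFunction_near_lipschitz hU hfin hg hgc hgs
      (show 0 < κ / 4 by positivity)
    refine ⟨φ, hφ, ?_⟩
    have hsub := hWw.sub (hφ.isWeakGradient hfin) (memLp_feSpace hv) hφ.memLp
    rw [hsub.rdNorm_sq hU hfin zero_le_one, one_mul]
    obtain ⟨E, hE⟩ := hφ.exists_lipschitz
    have iL : ∀ {f : Euc d → ℝ}, Continuous f → IntegrableOn f T.domain := fun hf =>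
      (hf.continuousOn.integrableOn_compact (isCompact_unionHull T.elems)).mono_set T.domain_subset
    have iG : ∀ {f h : Euc d → ℝ} {C D : NNReal}, LipschitzWith C f → LipschitzWith D h →
        IntegrableOn (fun x => ‖gradient f x - gradient h x‖ ^ 2) T.domain := fun hf hh =>
      ((memLp_gradient_of_lipschitz hfin hf).sub
        (memLp_gradient_of_lipschitz hfin hh)).integrable_norm_pow two_ne_zero
    have b1 : ∫ x in T.domain, (v - φ) x ^ 2 ≤
        2 * (∫ x in T.domain, (W x - g x) ^ 2) + 2 * ∫ x in T.domain, (g x - φ x) ^ 2 := by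
      have i1 := iL ((hC.continuous.sub hg.continuous).pow 2)
      have i2 := iL ((hg.continuous.sub hE.continuous).pow 2)
      rw [← integral_const_mul, ← integral_const_mul,
        ← integral_add (by exact i1.const_mul 2) (by exact i2.const_mul 2)]
      have e : ∫ x in T.domain, (v - φ) x ^ 2 = ∫ x in T.domain, (W x - φ x) ^ 2 :=
        setIntegral_congr_fun hU.measurableSet fun x hx => by simp [hWv hx]
      rw [e]
      refine integral_mono (iL ((hC.continuous.sub hE.continuous).pow 2))
        (by exact (i1.const_mul 2).add (i2.const_mul 2)) fun x => ?_
      nlinarith [sq_nonneg ((W x - g x) - (g x - φ x))]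
    have b2 : ∫ x in T.domain, ‖(gradient W - gradient φ) x‖ ^ 2 ≤
        2 * (∫ x in T.domain, ‖gradient W x - gradient g x‖ ^ 2) +
          2 * ∫ x in T.domain, ‖gradient g x - gradient φ x‖ ^ 2 := by
      have i1 := iG hC hg
      have i2 := iG hg hE
      rw [← integral_const_mul, ← integral_const_mul,
        ← integral_add (by exact i1.const_mul 2) (by exact i2.const_mul 2)]
      refine integral_mono (iG hC hE) (by exact (i1.const_mul 2).add (i2.const_mul 2)) fun x => ?_
      have h3 := norm_sub_le_norm_sub_add_norm_sub (gradient W x) (gradient g x) (gradient φ x)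
      have h4 := norm_nonneg (gradient W x - gradient φ x)
      simp only [Pi.sub_apply]
      nlinarith [sq_nonneg (‖gradient W x - gradient g x‖ - ‖gradient g x - gradient φ x‖)]
    linarith
  choose! φ hφ hκ using fun n : ℕ => key (1 / ((n : ℝ) + 1)) (by positivity)
  refine ⟨φ, hφ, ?_⟩
  have h1 : Tendsto (fun n => rdNorm 1 T.domain (v - φ n) ^ 2) atTop (𝓝 0) :=
    squeeze_zero (fun n => sq_nonneg _) (fun n => (hκ n).le)
      tendsto_one_div_add_atTop_nhds_zero_nat
  have h2 := h1.sqrt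
  simpa [Real.sqrt_sq rdNorm_nonneg] using h2

/-! ### Vanishing boundary values of finite element functions in $H^1_0$. -/

/-- Approximating test functions, with the convergence of the function and of its gradient made
explicit. -/
theorem exists_approx_of_memH10 {U : Set (Euc d)} (hU : IsOpen U) (hfin : volume U < ⊤)
    {u : Euc d → ℝ} (hu : MemH10 U u) {g : Euc d → Euc d} (hg : IsWeakGradient U u g) :
    ∃ φ : ℕ → Euc d → ℝ, (∀ n, IsTestFunction U (φ n)) ∧
      Tendsto (fun n => ∫ x in U, (u x - φ n x) ^ 2) atTop (𝓝 0) ∧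
      Tendsto (fun n => ∫ x in U, ‖g x - gradient (φ n) x‖ ^ 2) atTop (𝓝 0) := by
  obtain ⟨hu1, φ, hφ, hlim⟩ := hu
  have h2 := hlim.pow 2
  rw [zero_pow two_ne_zero] at h2
  have he : ∀ n, rdNorm 1 U (u - φ n) ^ 2 =
      (∫ x in U, (u x - φ n x) ^ 2) + ∫ x in U, ‖g x - gradient (φ n) x‖ ^ 2 := by
    intro n
    rw [(hg.sub ((hφ n).isWeakGradient hfin) hu1.1 (hφ n).memLp).rdNorm_sq hU hfin zero_le_one,
      one_mul]
    rfl
  simp only [he] at h2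
  have p1 : ∀ n, 0 ≤ ∫ x in U, (u x - φ n x) ^ 2 := fun n => integral_nonneg fun x => sq_nonneg _
  have p2 : ∀ n, 0 ≤ ∫ x in U, ‖g x - gradient (φ n) x‖ ^ 2 :=
    fun n => integral_nonneg fun x => sq_nonneg _
  exact ⟨φ, hφ, squeeze_zero p1 (fun n => le_add_of_nonneg_right (p2 n)) h2,
    squeeze_zero p2 (fun n => le_add_of_nonneg_left (p1 n)) h2⟩

/-- Translation estimate behind the trace theorem. -/
theorem integral_sq_le_of_test {U : Set (Euc d)} (hU : IsOpen U) {φ : Euc d → ℝ}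
    (hφ : IsTestFunction U φ) {g : Euc d → Euc d} (hg : MemLp g 2 (volume.restrict U)) {M : ℝ}
    (hM : ∀ᵐ x ∂volume.restrict U, ‖g x‖ ≤ M) (x y : Euc d) {r : ℝ}
    (hy : Metric.ball y r ⊆ Uᶜ) :
    ∫ w in Metric.ball x r, φ w ^ 2 ≤ ‖y - x‖ ^ 2 *
      (2 * M ^ 2 * volume.real (Metric.ball x r) +
        2 * ∫ w in U, ‖g w - gradient φ w‖ ^ 2) := by
  set A := Metric.ball x r
  set h := ‖y - x‖ with hh
  have hφ1 : ContDiff ℝ 1 φ := hφ.1.of_le (by simp)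
  have hAfin : volume A < ⊤ := measure_ball_lt_top
  have hAm : MeasurableSet A := measurableSet_ball
  set D : Euc d → ENNReal := U.indicator fun w => ENNReal.ofReal (‖g w - gradient φ w‖ ^ 2) with hD
  have hsub : MemLp (fun w => g w - gradient φ w) 2 (volume.restrict U) := hg.sub hφ.memLp_gradient
  have hDint : ∫⁻ w, D w = ENNReal.ofReal (∫ w in U, ‖g w - gradient φ w‖ ^ 2) := by
    rw [hD, lintegral_indicator hU.measurableSet, ofReal_integral_eq_lintegral_ofReal
      (hsub.integrable_norm_pow two_ne_zero) (Eventually.of_forall fun x => sq_nonneg _)]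
  have hmeas := measurable_gradEnergy hφ1 MeasurableSet.univ
  have htwo : ∀ a : ℝ, 2 * ENNReal.ofReal a = ENNReal.ofReal (2 * a) := fun a => by
    rw [ENNReal.ofReal_mul (by norm_num), ENNReal.ofReal_ofNat]
  -- Inside `U` the gradient of `φ` is at most `M` plus its distance to `g`; outside it is zero. So
  -- paths that leave `U` contribute nothing extra.
  have hH : ∀ᵐ w : Euc d, gradEnergy φ Set.univ w ≤ ENNReal.ofReal (2 * M ^ 2) + 2 * D w := by
    filter_upwards [(ae_restrict_iff' hU.measurableSet).1 hM] with w hw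
    rw [gradEnergy, Set.indicator_of_mem (Set.mem_univ w), ← norm_gradient]
    by_cases hwU : w ∈ U
    · rw [hD, Set.indicator_of_mem hwU, htwo, ← ENNReal.ofReal_add (by positivity) (by positivity)]
      refine ENNReal.ofReal_le_ofReal ?_
      have h1 : ‖gradient φ w‖ ≤ M + ‖g w - gradient φ w‖ := by
        have := norm_le_norm_add_norm_sub (g w) (gradient φ w)
        linarith [hw hwU]
      have h2 := norm_nonneg (gradient φ w)
      nlinarith [sq_nonneg (M - ‖g w - gradient φ w‖)]
    · rw [gradient_eq_zero_of_notMem_tsupport fun h' => hwU (hφ.2.2 h')]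
      simp
  have hshift : ∀ p : Euc d, ∫⁻ w in A, gradEnergy φ Set.univ (w + p) ≤
      ENNReal.ofReal (2 * M ^ 2) * volume A + 2 * ∫⁻ w, D w := by
    intro p
    have hp := (measurePreserving_add_right (volume : Measure (Euc d)) p).quasiMeasurePreserving.ae
      hH
    calc ∫⁻ w in A, gradEnergy φ Set.univ (w + p)
        ≤ ∫⁻ w in A, (ENNReal.ofReal (2 * M ^ 2) + 2 * D (w + p)) :=
          lintegral_mono_ae (ae_restrict_of_ae hp)
      _ = ENNReal.ofReal (2 * M ^ 2) * volume A + 2 * ∫⁻ w in A, D (w + p) := by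
          rw [lintegral_add_left measurable_const, setLIntegral_const,
            lintegral_const_mul' _ _ (by simp)]
      _ ≤ _ := by
          refine add_le_add le_rfl (mul_le_mul' le_rfl ((setLIntegral_le_lintegral _ _).trans ?_))
          rw [lintegral_add_right_eq_self D]
  have hpt : ∀ w ∈ A, ENNReal.ofReal (φ w ^ 2) ≤ ENNReal.ofReal (h ^ 2) *
      ∫⁻ τ in Set.Icc (0 : ℝ) 1, gradEnergy φ Set.univ (w + τ • (y - x)) := by
    intro w hw
    have h1 := ofReal_sq_increment_le (x := w) (v := y - x) (K := Set.univ) hφ1 zero_le_one le_rfl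
      hh.ge fun τ _ => Set.mem_univ _
    -- Translation by $y-x$ carries the ball around `x` to the ball around `y`, which lies outside
    -- the support of `φ`.
    have h2 : φ (w + (1 : ℝ) • (y - x)) = 0 := by
      refine image_eq_zero_of_notMem_tsupport fun h' => hy ?_ (hφ.2.2 h')
      rw [one_smul, Metric.mem_ball, dist_eq_norm]
      have : w + (y - x) - y = w - x := by abel
      rw [this, ← dist_eq_norm]
      exact hw
    rwa [h2, zero_sub, neg_sq] at h1
  have hint : IntegrableOn (fun w => φ w ^ 2) A :=
    ((hφ.1.continuous.pow 2).continuousOn.integrableOn_compact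
      (isCompact_closedBall x r)).mono_set Metric.ball_subset_closedBall
  have hI0 : 0 ≤ ∫ w in U, ‖g w - gradient φ w‖ ^ 2 := integral_nonneg fun x => sq_nonneg _
  have hRHS : ∀ I : ℝ, 0 ≤ I → ENNReal.ofReal (h ^ 2) *
      (ENNReal.ofReal (2 * M ^ 2) * volume A + 2 * ENNReal.ofReal I) =
      ENNReal.ofReal (h ^ 2 * (2 * M ^ 2 * volume.real A + 2 * I)) := by
    intro I hI
    have hVA : volume A = ENNReal.ofReal (volume.real A) := (ENNReal.ofReal_toReal hAfin.ne).symm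
    rw [hVA, htwo, ← ENNReal.ofReal_mul (by positivity),
      ← ENNReal.ofReal_add (by positivity) (by positivity), ← ENNReal.ofReal_mul (by positivity)]
  refine (ENNReal.ofReal_le_ofReal_iff (mul_nonneg (sq_nonneg _) (add_nonneg
    (mul_nonneg (by positivity) measureReal_nonneg) (mul_nonneg zero_le_two hI0)))).1 ?_
  rw [ofReal_integral_eq_lintegral_ofReal hint (Eventually.of_forall fun x => sq_nonneg _)]
  calc ∫⁻ w in A, ENNReal.ofReal (φ w ^ 2)
      ≤ ∫⁻ w in A, ENNReal.ofReal (h ^ 2) *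
          ∫⁻ τ in Set.Icc (0 : ℝ) 1, gradEnergy φ Set.univ (w + τ • (y - x)) :=
        setLIntegral_mono' hAm hpt
    _ = ENNReal.ofReal (h ^ 2) *
          ∫⁻ τ in Set.Icc (0 : ℝ) 1, ∫⁻ w in A, gradEnergy φ Set.univ (w + τ • (y - x)) := by
        rw [lintegral_const_mul' _ _ ENNReal.ofReal_ne_top, lintegral_lintegral_swap]
        exact (hmeas.comp (by fun_prop)).aemeasurable
    _ ≤ ENNReal.ofReal (h ^ 2) * ∫⁻ τ in Set.Icc (0 : ℝ) 1,
          (ENNReal.ofReal (2 * M ^ 2) * volume A + 2 * ∫⁻ w, D w) :=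
        mul_le_mul_right (setLIntegral_mono' measurableSet_Icc fun τ _ => hshift _) _
    _ = _ := by
        rw [setLIntegral_const, Real.volume_Icc, sub_zero, ENNReal.ofReal_one, mul_one, hDint,
          hRHS _ hI0]

/-- Finite element functions in `H¹₀` vanish on the boundary. -/
theorem eq_zero_of_mem_feSpaceZero {v : Euc d → ℝ} (hv : v ∈ T.feSpaceZero ℓ) {z : Euc d}
    (hz : z ∈ unionHull T.elems) (hzd : z ∉ T.domain) : v z = 0 := by
  obtain ⟨M, hM0, hM⟩ := exists_lipschitz hv.1
  have hU := T.isOpen_domain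
  have hfin := T.volume_domain_lt_top
  have hw := isWeakGradient_feSpace hv.1
  obtain ⟨φ, hφ, h1, h2⟩ := exists_approx_of_memH10 hU hfin hv.2 hw
  have hMae : ∀ᵐ x ∂volume.restrict T.domain, ‖gradient v x‖ ≤ M := by
    refine (ae_restrict_iff' hU.measurableSet).2 ?_
    filter_upwards [ae_mem_interior_of_mem_hull T.elems] with x hx hxU
    obtain ⟨K, hK, hxK⟩ := mem_unionHull.1 (T.domain_subset hxU)
    exact (hM K hK).2.2 x (hx K hK hxK)
  obtain ⟨K, hK, hzK⟩ := mem_unionHull.1 hz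
  have hKs := T.isSimplex hK
  -- In the limit, the translation estimate bounds the mean of $v^2$ on a small ball around `x` by
  -- $(2M\|y-x\|)^2$. On that ball `v` deviates from $v(x)$ by at most $M\|y-x\|$, which yields the
  -- factor three.
  have key : ∀ x ∈ interior (hull K), ∀ y ∉ unionHull T.elems, |v x| ≤ 3 * M * ‖y - x‖ := by
    intro x hx y hy
    obtain ⟨r₁, hr₁, hb₁⟩ := Metric.isOpen_iff.1 isOpen_interior x hx
    obtain ⟨r₂, hr₂, hb₂⟩ := Metric.isOpen_iff.1
      (isCompact_unionHull T.elems).isClosed.isOpen_compl y hy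
    have hne : 0 < ‖y - x‖ := norm_pos_iff.2 (sub_ne_zero.2 fun h =>
      hy (h ▸ hull_subset_unionHull hK (interior_subset hx)))
    set r := min (min r₁ r₂) ‖y - x‖
    have hr : 0 < r := lt_min (lt_min hr₁ hr₂) hne
    have hA : Metric.ball x r ⊆ interior (hull K) := (Metric.ball_subset_ball
      ((min_le_left _ _).trans (min_le_left _ _))).trans hb₁
    have hAd : Metric.ball x r ⊆ T.domain := hA.trans (T.interior_hull_subset_domain hK)
    have hB : Metric.ball y r ⊆ T.domainᶜ := fun w hw hwd =>
      hb₂ (Metric.ball_subset_ball ((min_le_left _ _).trans (min_le_right _ _)) hw)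
        (T.domain_subset hwd)
    set V := volume.real (Metric.ball x r)
    have hV : 0 < V := ENNReal.toReal_pos (Metric.measure_ball_pos volume x hr).ne'
      measure_ball_lt_top.ne
    have hvi : IntegrableOn (fun w => v w ^ 2) (Metric.ball x r) := by
      exact ((memLp_feSpace hv.1).integrable_sq).mono_measure (Measure.restrict_mono hAd le_rfl)
    have hstep : ∀ n, ∫ w in Metric.ball x r, v w ^ 2 ≤
        2 * (‖y - x‖ ^ 2 * (2 * M ^ 2 * V +
          2 * ∫ w in T.domain, ‖gradient v w - gradient (φ n) w‖ ^ 2)) +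
        2 * ∫ w in T.domain, (v w - φ n w) ^ 2 := by
      intro n
      have hb := integral_sq_le_of_test hU (hφ n) hw.1 hMae x y hB
      have hdi : IntegrableOn (fun w => (v w - φ n w) ^ 2) T.domain := by
        exact ((memLp_feSpace hv.1).sub (hφ n).memLp).integrable_sq
      have hb' : ∫ w in Metric.ball x r, (v w - φ n w) ^ 2 ≤
          ∫ w in T.domain, (v w - φ n w) ^ 2 :=
        setIntegral_mono_set hdi (Eventually.of_forall fun w => sq_nonneg _) hAd.eventuallyLE
      have hφi : IntegrableOn (fun w => φ n w ^ 2) (Metric.ball x r) := by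
        exact ((hφ n).memLp.integrable_sq).mono_measure (Measure.restrict_mono hAd le_rfl)
      have hb3 : ∫ w in Metric.ball x r, v w ^ 2 ≤ 2 * (∫ w in Metric.ball x r, φ n w ^ 2) +
          2 * ∫ w in Metric.ball x r, (v w - φ n w) ^ 2 := by
        rw [← integral_const_mul, ← integral_const_mul,
          ← integral_add (hφi.const_mul 2) ((hdi.mono_set hAd).const_mul 2)]
        refine integral_mono hvi ((hφi.const_mul 2).add ((hdi.mono_set hAd).const_mul 2))
          fun w => ?_
        simp only
        nlinarith [sq_nonneg (φ n w - (v w - φ n w))]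
      linarith
    have hlim : ∫ w in Metric.ball x r, v w ^ 2 ≤
        2 * (‖y - x‖ ^ 2 * (2 * M ^ 2 * V + 2 * 0)) + 2 * 0 :=
      ge_of_tendsto' (((((h2.const_mul 2).const_add _).const_mul _).const_mul 2).add
        (h1.const_mul 2)) hstep
    have hlow : ∀ w ∈ Metric.ball x r, |v x| - M * ‖y - x‖ ≤ |v w| := by
      intro w hw
      have e1 := (hM K hK).1 x (interior_subset hx) w (interior_subset (hA hw))
      have e2 : ‖x - w‖ ≤ ‖y - x‖ := by
        rw [← dist_eq_norm, dist_comm]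
        exact (Metric.mem_ball.1 hw).le.trans (min_le_right _ _)
      have e3 := abs_sub_abs_le_abs_sub (v x) (v w)
      have e4 := mul_le_mul_of_nonneg_left e2 hM0
      linarith
    by_contra! hcon
    have hpos : 2 * M * ‖y - x‖ < |v x| - M * ‖y - x‖ := by linarith
    have hlow2 : (|v x| - M * ‖y - x‖) ^ 2 * V ≤ ∫ w in Metric.ball x r, v w ^ 2 := by
      have : (|v x| - M * ‖y - x‖) ^ 2 * V =
          ∫ w in Metric.ball x r, (|v x| - M * ‖y - x‖) ^ 2 := by
        rw [setIntegral_const, smul_eq_mul, mul_comm]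
      rw [this]
      refine setIntegral_mono_on (integrableOn_const measure_ball_lt_top.ne) hvi
        measurableSet_ball fun w hw => ?_
      rw [← sq_abs (v w)]
      have : 0 ≤ 2 * M * ‖y - x‖ := by positivity
      exact pow_le_pow_left₀ (by linarith) (hlow w hw) 2
    have h5 : (|v x| - M * ‖y - x‖) ^ 2 * V ≤ (2 * M * ‖y - x‖) ^ 2 * V := by
      refine (hlow2.trans hlim).trans (le_of_eq ?_)
      ring
    have h6 := le_of_mul_le_mul_right h5 hV
    have h7 : 0 ≤ 2 * M * ‖y - x‖ := by positivity
    nlinarith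
  by_contra hne
  have hpos : 0 < |v z| := abs_pos.2 hne
  -- With `x` and `y` both within `κ` of `z`, one gets $|v(z)|\le 3M\cdot2\kappa+M\kappa=7M\kappa$.
  -- This value of `κ` makes that smaller than $|v(z)|$.
  set κ := |v z| / (7 * M + 1) / 2
  have hκ : 0 < κ := by positivity
  obtain ⟨x, hx, hxz⟩ := Metric.mem_closure_iff.1 (hKs.subset_closure_interior hzK) κ hκ
  have hzc : z ∈ closure (unionHull T.elems)ᶜ := by
    rw [closure_compl]; exact hzd
  obtain ⟨y, hy, hyz⟩ := Metric.mem_closure_iff.1 hzc κ hκ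
  have h3 := key x hx y hy
  have h4 := (hM K hK).1 z hzK x (interior_subset hx)
  have h5 : ‖y - x‖ ≤ 2 * κ := by
    rw [← dist_eq_norm]
    have := dist_triangle_left y x z
    linarith
  have h6 : ‖z - x‖ ≤ κ := by rw [← dist_eq_norm]; exact hxz.le
  have h7 := abs_sub_abs_le_abs_sub (v z) (v x)
  have h8 : |v z| ≤ 7 * M * κ := by
    have := mul_le_mul_of_nonneg_left h5 (show 0 ≤ 3 * M by positivity)
    have := mul_le_mul_of_nonneg_left h6 hM0
    linarith
  have h9 : (7 * M + 1) * κ = |v z| / 2 := by simp only [κ]; field_simp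
  linarith

end SimplicialMesh

/-! ### Topology of simplicial meshes -/

namespace SimplicialMesh

variable {d ℓ : ℕ} (T : SimplicialMesh d)

theorem mem_faces {F : Finset (Euc d)} : F ∈ T.faces ↔ ∃ K ∈ T.elems, F ⊆ K ∧ F.card = d := by
  classical
  simp [faces, Finset.mem_powersetCard]

theorem mem_interiorFaces {F : Finset (Euc d)} :
    F ∈ T.interiorFaces ↔ F ∈ T.faces ∧ ¬ hull F ⊆ frontier T.domain := by
  classical
  simp [interiorFaces]

theorem hull_subset_closure_domain {K : Finset (Euc d)} (hK : K ∈ T.elems) :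
    hull K ⊆ closure T.domain :=
  (T.isSimplex hK).subset_closure_interior.trans (closure_mono (T.interior_hull_subset_domain hK))

/-- Every element has an interior face. -/
theorem exists_interiorFace (hconn : IsConnected T.domain) (hcard : 2 ≤ T.elems.card)
    {K : Finset (Euc d)} (hK : K ∈ T.elems) : ∃ F ∈ T.interiorFaces, F ⊆ K := by
  classical
  by_contra! hcon
  have hKs := T.isSimplex hK
  -- A point of $\Omega$ on the boundary of `K` has a vanishing coordinate and hence lies on a face
  -- of `K`, which would be an interior face. Otherwise `K` splits off from the connected $\Omega$,
  -- contradicting a second element.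
  have hsub : T.domain ⊆ interior (hull K) ∪ (hull K)ᶜ := by
    intro x hx
    by_contra hxn
    simp only [Set.mem_union, Set.mem_compl_iff, not_or, not_not] at hxn
    obtain ⟨hxi, hxK⟩ := hxn
    rw [hKs.mem_interior_iff] at hxi
    push Not at hxi
    obtain ⟨y, hy, hy0⟩ := hxi
    have hy0' : baryCoord K y x = 0 := le_antisymm hy0 (hKs.baryCoord_nonneg hxK)
    have hcF : (K.erase y).card = d := by rw [Finset.card_erase_of_mem hy, hKs.card_eq]; rfl
    refine hcon (K.erase y) ?_ (Finset.erase_subset y K)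
    refine T.mem_interiorFaces.2 ⟨T.mem_faces.2 ⟨K, hK, Finset.erase_subset y K, hcF⟩, fun h => ?_⟩
    have hxF : x ∈ hull (K.erase y) := by
      refine (hKs.mem_hull_subset_iff (Finset.erase_subset y K)).2 ⟨hxK, fun z hz hzn => ?_⟩
      have : z = y := by
        by_contra hne
        exact hzn (Finset.mem_erase.2 ⟨hne, hz⟩)
      rw [this, hy0']
    have := (h hxF).2
    rw [T.isOpen_domain.interior_eq] at this
    exact this hx
  have hne : (T.domain ∩ interior (hull K)).Nonempty := by
    obtain ⟨x, hx⟩ := hKs.interior_nonempty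
    exact ⟨x, T.interior_hull_subset_domain hK hx, hx⟩
  have hle := hconn.isPreconnected.subset_left_of_subset_union isOpen_interior
    (isClosed_hull K).isOpen_compl (Set.disjoint_left.2 fun x hx hx' => hx' (interior_subset hx))
    hsub hne
  obtain ⟨K', hK', hKK'⟩ := Finset.exists_mem_ne (Nat.lt_of_succ_le hcard) K
  obtain ⟨x, hx⟩ := (T.isSimplex hK').interior_nonempty
  exact hKK' (T.eq_of_mem_interior hK' hK hx
    (interior_subset (hle (T.interior_hull_subset_domain hK' hx))))

variable {T}

theorem baryCoord_eq_of_mem_face {K K' F : Finset (Euc d)} (hK : IsSimplex K)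
    (hK' : IsSimplex K') (hF : F ⊆ K) (hF' : F ⊆ K') {x : Euc d} (hx : x ∈ hull F) {b : Euc d}
    (hb : b ∈ F) : baryCoord K b x = baryCoord K' b x := by
  classical
  obtain ⟨w, -, hw1, hwx⟩ := Finset.mem_convexHull'.1 hx
  have : ∀ {L : Finset (Euc d)}, IsSimplex L → F ⊆ L → baryCoord L b x = w b := by
    intro L hL hFL
    have := hL.baryCoord_eq (w := fun y => if y ∈ F then w y else 0) (x := x) ?_ ?_ (hFL hb)
    · simpa [hb] using this
    · rw [← Finset.sum_filter, Finset.filter_mem_eq_inter, Finset.inter_eq_right.2 hFL, hw1]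
    · simp only [ite_smul, zero_smul]
      rw [← Finset.sum_filter, Finset.filter_mem_eq_inter, Finset.inter_eq_right.2 hFL, hwx]
  rw [this hK hF, this hK' hF']

/-- A neighbourhood of `z` meets only the elements that contain `z`. -/
theorem eventually_mem_hull (z : Euc d) :
    ∀ᶠ x in 𝓝 z, ∀ K ∈ T.elems, x ∈ hull K → z ∈ hull K := by
  refine (Finset.eventually_all T.elems).2 fun K _ => ?_
  by_cases hz : z ∈ hull K
  · exact Eventually.of_forall fun _ _ => hz
  · filter_upwards [(isClosed_hull K).isOpen_compl.mem_nhds hz] with x hx hxK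
    exact absurd hxK hx

/-- Conformity: an element that contains a point at which the coordinates of all vertices in `F` are
positive must have all these vertices. -/
theorem subset_of_mem_hull {K K' F : Finset (Euc d)} (hK : K ∈ T.elems) (hK' : K' ∈ T.elems)
    (hFK : F ⊆ K) {y : Euc d} (hy : y ∈ hull K) (hpos : ∀ b ∈ F, 0 < baryCoord K b y)
    (hyK' : y ∈ hull K') : F ⊆ K' := by
  classical
  intro b hb
  by_contra hb'
  have h1 : y ∈ hull (K ∩ K') := by rw [← T.hull_inter hK hK']; exact ⟨hy, hyK'⟩
  have h2 := ((T.isSimplex hK).mem_hull_subset_iff Finset.inter_subset_left).1 h1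
  exact (hpos b hb).ne' (h2.2 b (hFK hb) fun h => hb' (Finset.mem_inter.1 h).2)

/-- The relative interior of a subsimplex that meets the domain lies in the domain. -/
theorem mem_domain_of_mem_subsimplex {F K : Finset (Euc d)} (hK : K ∈ T.elems) (hFK : F ⊆ K)
    (hF : ¬ hull F ⊆ frontier T.domain) {y : Euc d} (hy : y ∈ hull F)
    (hpos : ∀ b ∈ F, 0 < baryCoord K b y) : y ∈ T.domain := by
  classical
  have hKs := T.isSimplex hK
  obtain ⟨x, hxF, hx⟩ := Set.not_subset.1 hF
  have hxd : x ∈ T.domain := by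
    by_contra hcon
    refine hx ⟨T.hull_subset_closure_domain hK (hull_mono hFK hxF), ?_⟩
    rwa [T.isOpen_domain.interior_eq]
  -- A point of the relative interior of `F` that lies in $\Omega$, found by moving slightly from
  -- `x` towards `y`. Around it the elements containing `F` fill a neighbourhood, and this local
  -- picture is then translated to `y`.
  obtain ⟨y₀, hy₀F, hy₀d, hy₀pos⟩ : ∃ y₀ ∈ hull F, y₀ ∈ T.domain ∧
      ∀ b ∈ F, 0 < baryCoord K b y₀ := by
    have hc : Tendsto (fun t : ℝ => x + t • (y - x)) (𝓝[>] 0) (𝓝 x) := by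
      have : Continuous fun t : ℝ => x + t • (y - x) := by fun_prop
      have h := this.tendsto 0
      simp only [zero_smul, add_zero] at h
      exact h.mono_left nhdsWithin_le_nhds
    have h1 := hc.eventually (T.isOpen_domain.mem_nhds hxd)
    have h2 : ∀ᶠ t : ℝ in 𝓝[>] 0, t ∈ Set.Ioo (0 : ℝ) 1 := Ioo_mem_nhdsGT zero_lt_one
    obtain ⟨t, ht1, ht0, ht2⟩ := (h1.and h2).exists
    refine ⟨_, (convex_hull F).add_smul_sub_mem hxF hy ⟨ht0.le, ht2.le⟩, ht1, fun b hb => ?_⟩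
    rw [baryCoord_add_smul, ← baryCoord_sub]
    have hx0 := hKs.baryCoord_nonneg (y := b) (hull_mono hFK hxF)
    nlinarith [hpos b hb]
  have hev₀ : ∀ᶠ w in 𝓝 y₀, ∃ K' ∈ T.elems, F ⊆ K' ∧ w ∈ hull K' := by
    filter_upwards [eventually_mem_hull (T := T) y₀, T.isOpen_domain.mem_nhds hy₀d] with w hw hwd
    obtain ⟨K', hK', hwK'⟩ := mem_unionHull.1 (T.domain_subset hwd)
    exact ⟨K', hK', subset_of_mem_hull hK hK' hFK (hull_mono hFK hy₀F) hy₀pos (hw K' hK' hwK'), hwK'⟩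
  have hev : ∀ᶠ w in 𝓝 y, ∀ K' ∈ T.elems, F ⊆ K' → ∀ b ∈ F, 0 < baryCoord K' b w := by
    refine (Finset.eventually_all T.elems).2 fun K' hK' => ?_
    by_cases hFK' : F ⊆ K'
    · have h1 : ∀ᶠ w in 𝓝 y, ∀ b ∈ F, 0 < baryCoord K' b w := by
        refine (Finset.eventually_all F).2 fun b hb => ?_
        refine (continuous_baryCoord K' b).continuousAt.eventually (lt_mem_nhds ?_)
        rw [← baryCoord_eq_of_mem_face hKs (T.isSimplex hK') hFK hFK' hy hb]
        exact hpos b hb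
      filter_upwards [h1] with w hw _ using hw
    · exact Eventually.of_forall fun w h => absurd h hFK'
  have htr : Tendsto (fun w => y₀ + (w - y)) (𝓝 y) (𝓝 y₀) := by
    have : Continuous fun w : Euc d => y₀ + (w - y) := by fun_prop
    simpa using this.tendsto y
  rw [domain_eq, mem_interior_iff_mem_nhds]
  filter_upwards [hev, htr.eventually hev₀] with w hw hw₀
  obtain ⟨K', hK', hFK', hwK'⟩ := hw₀
  have hKs' := T.isSimplex hK'
  refine mem_unionHull.2 ⟨K', hK', hKs'.mem_hull_iff.2 fun b hb => ?_⟩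
  by_cases hbF : b ∈ F
  · exact (hw K' hK' hFK' b hbF).le
  -- Coordinates outside `F` vanish at both `y` and `y₀`, so the same increment gives the same
  -- nonnegative value.
  · have e1 := ((hKs'.mem_hull_subset_iff hFK').1 hy).2 b hb hbF
    have e2 := ((hKs'.mem_hull_subset_iff hFK').1 hy₀F).2 b hb hbF
    have e3 := hKs'.baryCoord_nonneg (y := b) hwK'
    have e4 := baryCoord_sub K' b w y
    have e5 := baryCoord_sub K' b (y₀ + (w - y)) y₀
    rw [add_sub_cancel_left] at e5
    linarith

theorem affineSpan_ne_top_of_card_le {G : Finset (Euc d)} (hG : G.card ≤ d) (hne : G.Nonempty) :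
    affineSpan ℝ (G : Set (Euc d)) ≠ ⊤ := by
  intro h
  have h1 : Module.finrank ℝ (vectorSpan ℝ (G : Set (Euc d))) = d := by
    rw [← direction_affineSpan, h, AffineSubspace.direction_top, finrank_top,
      finrank_euclideanSpace_fin]
  have hpos := hne.card_pos
  have h2 := finrank_vectorSpan_range_le ℝ (fun x : G => (x : Euc d)) (n := G.card - 1)
    (by rw [Fintype.card_coe]; omega)
  have hr : Set.range (fun x : G => (x : Euc d)) = (G : Set (Euc d)) := Subtype.range_coe
  rw [hr] at h2
  have : Module.finrank ℝ (vectorSpan ℝ (G : Set (Euc d))) ≤ G.card - 1 := h2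
  omega

/-- A boundary point of an element lies in an element that has a face on the boundary. -/
theorem exists_boundaryFace {z : Euc d} (hz : z ∈ unionHull T.elems) (hzd : z ∉ T.domain) :
    ∃ K ∈ T.elems, z ∈ hull K ∧ ∃ F ∈ T.faces, F ⊆ K ∧ hull F ⊆ frontier T.domain := by
  classical
  by_contra! hcon
  obtain ⟨K, hK, hzK⟩ := mem_unionHull.1 hz
  have hKs := T.isSimplex hK
  obtain ⟨r, hr, hball⟩ := Metric.eventually_nhds_iff_ball.1 (eventually_mem_hull (T := T) z)
  have hzc : z ∈ closure (unionHull T.elems)ᶜ := by rw [closure_compl]; exact hzd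
  obtain ⟨q, hq, hqz⟩ := Metric.mem_closure_iff.1 hzc r hr
  have hqb : q ∈ Metric.ball z r := by rwa [Metric.mem_ball, dist_comm]
  -- Subsimplices of codimension at least two. Together with the exterior point `q` each of them
  -- spans a proper affine subspace, so a generic starting point `p` avoids all these null sets.
  set 𝒢 := (T.elems.biUnion Finset.powerset).filter fun G => G.card + 1 ≤ d
  set N : Set (Euc d) := ⋃ G ∈ 𝒢, (affineSpan ℝ ((insert q G : Finset (Euc d)) : Set (Euc d)) :
    Set (Euc d))
  have hN : volume N = 0 := by
    refine (measure_biUnion_null_iff 𝒢.countable_toSet).2 fun G hG => ?_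
    refine Measure.addHaar_affineSubspace _ _ (affineSpan_ne_top_of_card_le ?_
      (Finset.insert_nonempty q G))
    exact (Finset.card_insert_le q G).trans (Finset.mem_filter.1 hG).2
  obtain ⟨p, ⟨hpK, hpb⟩, hpN⟩ : ∃ p ∈ interior (hull K) ∩ Metric.ball z r, p ∉ N := by
    by_contra! hall
    have hne : (interior (hull K) ∩ Metric.ball z r).Nonempty := by
      obtain ⟨x, hx, hxz⟩ := Metric.mem_closure_iff.1 (hKs.subset_closure_interior hzK) r hr
      exact ⟨x, hx, by rwa [Metric.mem_ball, dist_comm]⟩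
    have := (isOpen_interior.inter Metric.isOpen_ball).measure_pos volume hne
    exact this.ne' (measure_mono_null hall hN)
  set γ : ℝ → Euc d := fun t => p + t • (q - p) with hγ
  have hγc : Continuous γ := by fun_prop
  set S := Set.Icc (0 : ℝ) 1 ∩ γ ⁻¹' unionHull T.elems
  have hSc : IsCompact S :=
    isCompact_Icc.inter_right ((isCompact_unionHull T.elems).isClosed.preimage hγc)
  have hSne : S.Nonempty := ⟨0, ⟨le_rfl, zero_le_one⟩, by
    simpa [γ] using hull_subset_unionHull hK (interior_subset hpK)⟩
  -- The last point of the segment from `p` to `q` that lies in the mesh. It is not in $\Omega$, so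
  -- the smallest subsimplex `G` carrying it is neither a full element nor a face that meets
  -- $\Omega$.
  obtain ⟨t, ⟨⟨ht0, ht1⟩, htU⟩, htmax⟩ := hSc.exists_isGreatest hSne
  have ht1' : t < 1 := by
    refine lt_of_le_of_ne ht1 fun h => hq ?_
    have : γ 1 = q := by simp [γ]
    rw [← this, ← h]
    exact htU
  have hyb : γ t ∈ Metric.ball z r :=
    (convex_ball z r).add_smul_sub_mem hpb hqb ⟨ht0, ht1⟩
  have hyd : γ t ∉ T.domain := by
    intro h
    have h1 : ∀ᶠ s in 𝓝[>] t, γ s ∈ T.domain :=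
      (hγc.continuousAt.eventually (T.isOpen_domain.mem_nhds h)).filter_mono nhdsWithin_le_nhds
    have h2 : ∀ᶠ s in 𝓝[>] t, s ∈ Set.Ioo t 1 := Ioo_mem_nhdsGT ht1'
    obtain ⟨s, hs1, hs2, hs3⟩ := (h1.and h2).exists
    exact absurd (htmax ⟨⟨ht0.trans hs2.le, hs3.le⟩, T.domain_subset hs1⟩) (not_le.2 hs2)
  obtain ⟨K', hK', hyK'⟩ := mem_unionHull.1 htU
  have hKs' := T.isSimplex hK'
  have hzK' : z ∈ hull K' := hball _ hyb K' hK' hyK'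
  set G := K'.filter fun b => 0 < baryCoord K' b (γ t) with hG
  have hGK : G ⊆ K' := Finset.filter_subset _ _
  have hyG : γ t ∈ hull G := by
    refine (hKs'.mem_hull_subset_iff hGK).2 ⟨hyK', fun b hb hbG => ?_⟩
    refine le_antisymm (not_lt.1 fun h => hbG (Finset.mem_filter.2 ⟨hb, h⟩)) ?_
    exact hKs'.baryCoord_nonneg hyK'
  have hGpos : ∀ b ∈ G, 0 < baryCoord K' b (γ t) := fun b hb => (Finset.mem_filter.1 hb).2
  have hGc : G.card ≤ d + 1 := (Finset.card_le_card hGK).trans hKs'.card_eq.le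
  rcases Nat.lt_or_ge d G.card with h | h
  · have hGe : G = K' := Finset.eq_of_subset_of_card_le hGK (by rw [hKs'.card_eq]; omega)
    refine hyd (T.interior_hull_subset_domain hK' (hKs'.mem_interior_iff.2 fun b hb => ?_))
    exact hGpos b (hGe ▸ hb)
  rcases h.eq_or_lt with h | h
  · exact hyd (mem_domain_of_mem_subsimplex hK' hGK
      (hcon K' hK' hzK' G (T.mem_faces.2 ⟨K', hK', hGK, h⟩) hGK) hyG hGpos)
  · refine hpN (Set.mem_biUnion (x := G) (Finset.mem_filter.2
      ⟨Finset.mem_biUnion.2 ⟨K', hK', Finset.mem_powerset.2 hGK⟩, h⟩) ?_)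
    set A := affineSpan ℝ ((insert q G : Finset (Euc d)) : Set (Euc d))
    have hqA : q ∈ A := mem_affineSpan ℝ (by simp)
    have hyA : γ t ∈ A := by
      have h1 : hull G ⊆ A := (convexHull_subset_affineSpan _).trans
        (affineSpan_mono ℝ (by simp))
      exact h1 hyG
    -- Extending the line from `q` through the exit point back to `p` puts `p` into an excluded
    -- span.
    have hp : p = AffineMap.lineMap (γ t) q (-t / (1 - t)) := by
      have hne : (1 : ℝ) - t ≠ 0 := by linarith
      rw [AffineMap.lineMap_apply_module']
      have : q - γ t = (1 - t) • (q - p) := by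
        simp only [hγ, sub_smul, one_smul]; abel
      rw [this, smul_smul, div_mul_cancel₀ _ hne]
      simp [hγ]
    rw [hp]
    exact AffineMap.lineMap_mem _ hyA hqA

end SimplicialMesh

/-! ### Shape regularity -/

namespace SimplicialMesh

variable {d : ℕ}

/-- Quantitative shape regularity: every element contains a ball whose radius is comparable with the
diameters of the touching elements. -/
def ShapeRegular (T : SimplicialMesh d) (κ : ℝ) : Prop :=
  ∀ K ∈ T.elems, ∃ (c : Euc d) (r : ℝ), 0 < r ∧ Metric.closedBall c r ⊆ hull K ∧
    ∀ K' ∈ T.elems, (hull K ∩ hull K').Nonempty → Metric.diam (hull K') ≤ κ * r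

/-- Antipodal points of the ball realize its diameter. A vector of norm `r` exists only in positive
dimension. -/
theorem two_mul_le_diam (hd : 1 ≤ d) {s : Set (Euc d)} (hs : Bornology.IsBounded s) {c : Euc d}
    {r : ℝ} (hr : 0 ≤ r) (h : Metric.closedBall c r ⊆ s) : 2 * r ≤ Metric.diam s := by
  have : Nonempty (Fin d) := ⟨⟨0, hd⟩⟩
  have : Nontrivial (Euc d) := inferInstance
  obtain ⟨e, he⟩ := exists_norm_eq (Euc d) hr
  have h1 : c + e ∈ s := h (by simp [he])
  have h2 : c - e ∈ s := h (by simp [he])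
  have h3 := Metric.dist_le_diam_of_mem hs h1 h2
  rw [dist_eq_norm] at h3
  have h4 : c + e - (c - e) = (2 : ℝ) • e := by rw [two_smul]; abel
  rw [h4, norm_smul, he] at h3
  simpa using h3

/-- The supremum defining `inscribedDiam` need not be shown to be attained: a ball with
$2r>\rho_K/2$ suffices and turns $\sigma$ into $4\sigma$. The maximum with one makes the parameter
usable as a comparison factor. -/
theorem shapeRegular_of_shapeParam_le (hd : 1 ≤ d) (T : SimplicialMesh d) {σ : ℝ}
    (hσ : T.shapeParam ≤ σ) : T.ShapeRegular (max 1 (4 * σ)) := by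
  intro K hK
  have hKs := T.isSimplex hK
  set S := {t : ℝ | ∃ (c : Euc d) (r : ℝ), 0 ≤ r ∧ t = 2 * r ∧
    Metric.closedBall c r ⊆ convexHull ℝ (K : Set (Euc d))} with hS
  have hρ : inscribedDiam K = sSup S := rfl
  have hbdd : BddAbove S := by
    refine ⟨Metric.diam (hull K), ?_⟩
    rintro _ ⟨c, r, hr, rfl, hc⟩
    exact two_mul_le_diam hd (isBounded_hull K) hr hc
  obtain ⟨x, hx⟩ := hKs.interior_nonempty
  obtain ⟨r₀, hr₀, hb₀⟩ := Metric.nhds_basis_closedBall.mem_iff.1 (isOpen_interior.mem_nhds hx)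
  have hmem : 2 * r₀ ∈ S := ⟨x, r₀, hr₀.le, rfl, hb₀.trans interior_subset⟩
  have hpos : 0 < sSup S := lt_of_lt_of_le (by linarith) (le_csSup hbdd hmem)
  obtain ⟨_, ⟨c, r, hr, rfl, hc⟩, hlt⟩ := exists_lt_of_lt_csSup ⟨_, hmem⟩ (half_lt_self hpos)
  have hr' : 0 < r := by linarith
  refine ⟨c, r, hr', hc, fun K' hK' hne => ?_⟩
  have hfin : BddAbove {t : ℝ | ∃ K ∈ T.elems, ∃ K' ∈ T.elems,
      (convexHull ℝ (K : Set (Euc d)) ∩ convexHull ℝ (K' : Set (Euc d))).Nonempty ∧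
        t = Metric.diam (convexHull ℝ (K' : Set (Euc d))) / inscribedDiam K} := by
    refine (((T.elems ×ˢ T.elems).image fun p => Metric.diam (hull p.2) /
      inscribedDiam p.1).finite_toSet.subset ?_).bddAbove
    rintro _ ⟨K, hK, K', hK', -, rfl⟩
    exact Finset.mem_coe.2 (Finset.mem_image.2 ⟨(K, K'), Finset.mem_product.2 ⟨hK, hK'⟩, rfl⟩)
  have h1 : Metric.diam (hull K') / inscribedDiam K ≤ σ :=
    (le_csSup hfin ⟨K, hK, K', hK', hne, rfl⟩).trans hσ
  rw [hρ, div_le_iff₀ hpos] at h1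
  have hσ0 : 0 ≤ σ := by
    have h2 : 0 ≤ σ * sSup S := Metric.diam_nonneg.trans h1
    exact nonneg_of_mul_nonneg_left h2 hpos
  calc Metric.diam (hull K') ≤ σ * sSup S := h1
    _ ≤ σ * (4 * r) := mul_le_mul_of_nonneg_left (by linarith) hσ0
    _ = 4 * σ * r := by ring
    _ ≤ max 1 (4 * σ) * r := by gcongr; exact le_max_right _ _

/-! ### Volume comparison and finite overlap. -/

open Classical in
/-- The elements that touch `K`. -/
noncomputable def touching (T : SimplicialMesh d) (K : Finset (Euc d)) :
    Finset (Finset (Euc d)) :=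
  T.elems.filter fun K' => (hull K ∩ hull K').Nonempty

theorem mem_touching {T : SimplicialMesh d} {K K' : Finset (Euc d)} :
    K' ∈ T.touching K ↔ K' ∈ T.elems ∧ (hull K ∩ hull K').Nonempty := by
  simp [touching]

theorem volume_closedBall_mul (x y : Euc d) {t r : ℝ} (ht : 0 ≤ t) (hr : 0 ≤ r) :
    volume.real (Metric.closedBall x (t * r)) = t ^ d * volume.real (Metric.closedBall y r) := by
  rw [Measure.real, Measure.addHaar_closedBall_mul volume x ht hr, ENNReal.toReal_mul,
    ENNReal.toReal_ofReal (by positivity), finrank_euclideanSpace_fin, Measure.real,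
    ← Measure.addHaar_closedBall_center volume y]

variable {T : SimplicialMesh d} {κ : ℝ}

/-- The element `K'` fits into a ball of radius $\kappa r$ around a common point, whereas `K`
contains one of radius $r$. -/
theorem ShapeRegular.volume_le (hT : T.ShapeRegular κ) (hκ : 1 ≤ κ) {K K' : Finset (Euc d)}
    (hK : K ∈ T.elems) (hK' : K' ∈ T.elems) (hne : (hull K ∩ hull K').Nonempty) :
    volume.real (hull K') ≤ κ ^ d * volume.real (hull K) := by
  obtain ⟨c, r, hr, hc, hdiam⟩ := hT K hK
  obtain ⟨x, hxK, hx⟩ := hne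
  have hsub : hull K' ⊆ Metric.closedBall x (κ * r) := fun y hy => by
    rw [Metric.mem_closedBall]
    exact (Metric.dist_le_diam_of_mem (isBounded_hull K') hy hx).trans (hdiam K' hK' ⟨x, hxK, hx⟩)
  calc volume.real (hull K') ≤ volume.real (Metric.closedBall x (κ * r)) :=
        measureReal_mono hsub measure_closedBall_lt_top.ne
    _ = κ ^ d * volume.real (Metric.closedBall c r) := volume_closedBall_mul x c (by linarith) hr.le
    _ ≤ _ := by
        gcongr
        exact (volume_hull_lt_top K).ne

/-- A packing argument. With $h$ the diameter of `K`, every touching element contains a ball of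
radius $h/\kappa$, the interiors are disjoint, and all of them lie in a ball of radius
$(\kappa+1)h$. -/
theorem ShapeRegular.card_touching_le (hd : 1 ≤ d) (hT : T.ShapeRegular κ) (hκ : 1 ≤ κ)
    {K : Finset (Euc d)} (hK : K ∈ T.elems) :
    ((T.touching K).card : ℝ) ≤ (κ * (κ + 1)) ^ d := by
  obtain ⟨c, r, hr, hc, hdiam⟩ := hT K hK
  set h := Metric.diam (hull K)
  have h2r : 2 * r ≤ h := two_mul_le_diam hd (isBounded_hull K) hr.le hc
  have hpos : 0 < h := by linarith
  have hκ0 : 0 < κ := by linarith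
  set B := volume.real (Metric.closedBall c h)
  have hB : 0 < B := ENNReal.toReal_pos (Metric.measure_closedBall_pos volume c hpos).ne'
    measure_closedBall_lt_top.ne
  have hlow : ∀ K' ∈ T.touching K, (κ⁻¹) ^ d * B ≤ volume.real (interior (hull K')) := by
    intro K' hK'
    obtain ⟨hK'e, x, hxK, hxK'⟩ := mem_touching.1 hK'
    obtain ⟨c', r', hr', hc', hdiam'⟩ := hT K' hK'e
    have h1 : h ≤ κ * r' := hdiam' K hK ⟨x, hxK', hxK⟩
    have h2 : κ⁻¹ * h ≤ r' := by rw [inv_mul_le_iff₀ hκ0]; exact h1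
    calc (κ⁻¹) ^ d * B = volume.real (Metric.closedBall c' (κ⁻¹ * h)) :=
          (volume_closedBall_mul c' c (by positivity) hpos.le).symm
      _ ≤ volume.real (hull K') := measureReal_mono
          ((Metric.closedBall_subset_closedBall h2).trans hc') (volume_hull_lt_top K').ne
      _ = volume.real (interior (hull K')) :=
          (measureReal_congr (hull_ae_eq_interior K')).symm
  have hup : ∑ K' ∈ T.touching K, volume.real (interior (hull K')) ≤ (κ + 1) ^ d * B := by
    rw [← measureReal_biUnion_finset ?_ (fun K' _ => isOpen_interior.measurableSet)
      (fun K' _ => ((measure_mono interior_subset).trans_lt (volume_hull_lt_top K')).ne)]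
    · calc volume.real (⋃ K' ∈ T.touching K, interior (hull K')) ≤
            volume.real (Metric.closedBall c ((κ + 1) * h)) := by
            refine measureReal_mono ?_ measure_closedBall_lt_top.ne
            refine Set.iUnion₂_subset fun K' hK' w hw => ?_
            obtain ⟨hK'e, x, hxK, hxK'⟩ := mem_touching.1 hK'
            have e1 := Metric.dist_le_diam_of_mem (isBounded_hull K') (interior_subset hw) hxK'
            have e2 := hdiam K' hK'e ⟨x, hxK, hxK'⟩
            have e3 := Metric.dist_le_diam_of_mem (isBounded_hull K) hxK
              (hc (Metric.mem_closedBall_self hr.le))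
            have e4 := dist_triangle w x c
            rw [Metric.mem_closedBall]
            nlinarith
        _ = (κ + 1) ^ d * B := volume_closedBall_mul c c (by linarith) hpos.le
    · intro K₁ h₁ K₂ h₂ hne
      refine Set.disjoint_left.2 fun x hx hx' => hne ?_
      exact T.eq_of_mem_interior (mem_touching.1 h₁).1 (mem_touching.1 h₂).1 hx
        (interior_subset hx')
  have hsum := (Finset.card_nsmul_le_sum _ _ _ hlow).trans hup
  rw [nsmul_eq_mul, inv_pow] at hsum
  have hκd : 0 < κ ^ d := by positivity
  have h3 : ((T.touching K).card : ℝ) * (κ ^ d)⁻¹ ≤ (κ + 1) ^ d :=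
    le_of_mul_le_mul_right (by linarith) hB
  rw [mul_inv_le_iff₀ hκd] at h3
  rw [mul_pow, mul_comm]
  exact h3

end SimplicialMesh

/-! ### Poincaré, Friedrichs and transfer inequalities for limits of smooth functions -/

theorem integral_norm_sq_le {α E : Type*} [MeasurableSpace α] [NormedAddCommGroup E]
    {μ : Measure α} {f g : α → E} (hf : MemLp f 2 μ) (hg : MemLp g 2 μ) :
    ∫ x, ‖f x‖ ^ 2 ∂μ ≤ 2 * (∫ x, ‖f x - g x‖ ^ 2 ∂μ) + 2 * ∫ x, ‖g x‖ ^ 2 ∂μ := by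
  have h1 : Integrable (fun x => ‖f x‖ ^ 2) μ := hf.integrable_norm_pow two_ne_zero
  have h2 : Integrable (fun x => ‖g x‖ ^ 2) μ := hg.integrable_norm_pow two_ne_zero
  have h3 : Integrable (fun x => ‖f x - g x‖ ^ 2) μ := (hf.sub hg).integrable_norm_pow two_ne_zero
  rw [← integral_const_mul, ← integral_const_mul, ← integral_add (h3.const_mul 2) (h2.const_mul 2)]
  refine integral_mono h1 ((h3.const_mul 2).add (h2.const_mul 2)) fun x => ?_
  have h4 : ‖f x‖ ≤ ‖f x - g x‖ + ‖g x‖ := by simpa using norm_add_le (f x - g x) (g x)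
  simp only
  nlinarith [sq_nonneg (‖f x - g x‖ - ‖g x‖), norm_nonneg (f x), norm_nonneg (f x - g x),
    norm_nonneg (g x)]

theorem integral_sq_le_two {α : Type*} [MeasurableSpace α] {μ : Measure α} {f g : α → ℝ}
    (hf : MemLp f 2 μ) (hg : MemLp g 2 μ) :
    ∫ x, f x ^ 2 ∂μ ≤ 2 * (∫ x, (f x - g x) ^ 2 ∂μ) + 2 * ∫ x, g x ^ 2 ∂μ := by
  simpa using integral_norm_sq_le hf hg

theorem le_of_forall_pos_le_add_const_mul {x a b : ℝ} (h : ∀ δ > 0, x ≤ a + b * δ) : x ≤ a := by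
  have hc : Tendsto (fun δ : ℝ => a + b * δ) (𝓝[>] 0) (𝓝 a) := by
    have : Continuous fun δ : ℝ => a + b * δ := by fun_prop
    have h := this.tendsto 0
    simp only [mul_zero, add_zero] at h
    exact h.mono_left nhdsWithin_le_nhds
  exact ge_of_tendsto hc (eventually_nhdsWithin_of_forall fun δ hδ => h δ hδ)

theorem memLp_of_continuous_isCompact {X E : Type*} [NormedAddCommGroup E] [TopologicalSpace X]
    [SecondCountableTopology X] [MeasurableSpace X] [BorelSpace X] [R1Space X] {μ : Measure X}
    [IsFiniteMeasureOnCompacts μ] {f : X → E} {K : Set X} (hf : Continuous f) (hK : IsCompact K)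
    (hKm : MeasurableSet K) : MemLp f 2 (μ.restrict K) := by
  have : IsFiniteMeasure (μ.restrict K) := ⟨by simpa using hK.measure_lt_top⟩
  obtain ⟨M, hM⟩ := hK.exists_bound_of_continuousOn hf.continuousOn
  exact MemLp.of_bound (hf.continuousOn.aestronglyMeasurable_of_isCompact hK hKm) M
    ((ae_restrict_iff' hKm).2 (Eventually.of_forall hM))

section Limits

variable {d : ℕ} {f : Euc d → ℝ} {h : Euc d → Euc d} {K K' F : Finset (Euc d)}

/-- The `C¹` function `G` is `δ`-close on `K` to `f`, and its gradient is `δ`-close to `h`. -/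
structure SmoothNear (K : Finset (Euc d)) (f : Euc d → ℝ) (h : Euc d → Euc d) (δ : ℝ)
    (G : Euc d → ℝ) : Prop where
  contDiff : ContDiff ℝ 1 G
  value : ∫ x in hull K, (f x - G x) ^ 2 ≤ δ
  grad : ∫ x in hull K, ‖h x - gradient G x‖ ^ 2 ≤ δ

theorem memLp_hull_of_continuous {E : Type*} [NormedAddCommGroup E] {G : Euc d → E}
    (hG : Continuous G) (K : Finset (Euc d)) : MemLp G 2 (volume.restrict (hull K)) :=
  memLp_of_continuous_isCompact hG (isCompact_hull K) (measurableSet_hull K)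

theorem ContDiff.continuous_gradient {G : Euc d → ℝ} (hG : ContDiff ℝ 1 G) :
    Continuous (gradient G) :=
  (InnerProductSpace.toDual ℝ (Euc d)).symm.continuous.comp (hG.continuous_fderiv one_ne_zero)

theorem SmoothNear.integral_fderiv_le {δ : ℝ} {G : Euc d → ℝ} (hG : SmoothNear K f h δ G)
    (hh : MemLp h 2 (volume.restrict (hull K))) :
    ∫ x in hull K, ‖fderiv ℝ G x‖ ^ 2 ≤ 2 * δ + 2 * ∫ x in hull K, ‖h x‖ ^ 2 := by
  have h1 := integral_norm_sq_le (memLp_hull_of_continuous hG.contDiff.continuous_gradient K) hh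
  simp only [norm_gradient, norm_sub_rev _ (h _)] at h1
  linarith [hG.grad]

theorem SmoothNear.integral_sub_const_le {δ : ℝ} {G : Euc d → ℝ} (hG : SmoothNear K f h δ G)
    (hf : MemLp f 2 (volume.restrict (hull K))) (b : ℝ) :
    ∫ x in hull K, (f x - b) ^ 2 ≤ 2 * δ + 2 * ∫ x in hull K, (G x - b) ^ 2 := by
  have h1 := integral_sq_le_two (hf.sub (memLp_hull_of_continuous (continuous_const (y := b)) K))
    (memLp_hull_of_continuous (hG.contDiff.continuous.sub (continuous_const (y := b))) K)
  simp only [Pi.sub_apply, sub_sub_sub_cancel_right] at h1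
  linarith [hG.value]

theorem SmoothNear.integral_sub_const_le' {δ : ℝ} {G : Euc d → ℝ} (hG : SmoothNear K f h δ G)
    (hf : MemLp f 2 (volume.restrict (hull K))) (b : ℝ) :
    ∫ x in hull K, (G x - b) ^ 2 ≤ 2 * δ + 2 * ∫ x in hull K, (f x - b) ^ 2 := by
  have h1 := integral_sq_le_two
    (memLp_hull_of_continuous (hG.contDiff.continuous.sub (continuous_const (y := b))) K)
    (hf.sub (memLp_hull_of_continuous (continuous_const (y := b)) K))
  simp only [Pi.sub_apply, sub_sub_sub_cancel_right] at h1
  have h2 : ∫ x in hull K, (G x - f x) ^ 2 = ∫ x in hull K, (f x - G x) ^ 2 := by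
    congr 1 with x; ring
  linarith [hG.value]

/-- The Poincaré inequality for limits of smooth functions. -/
theorem exists_const_poincare (hK : IsSimplex K) (hf : MemLp f 2 (volume.restrict (hull K)))
    (hh : MemLp h 2 (volume.restrict (hull K))) (happ : ∀ δ > 0, ∃ G, SmoothNear K f h δ G) :
    ∃ b : ℝ, b ^ 2 * volume.real (hull K) ≤ ∫ x in hull K, f x ^ 2 ∧
      ∫ x in hull K, (f x - b) ^ 2 ≤
        4 * 2 ^ d * Metric.diam (hull K) ^ 2 * ∫ x in hull K, ‖h x‖ ^ 2 := by
  have : IsFiniteMeasure (volume.restrict (hull K)) := ⟨by simpa using volume_hull_lt_top K⟩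
  set V := volume.real (hull K) with hV
  have hVpos : 0 < V := hK.measureReal_pos
  have hfi : Integrable f (volume.restrict (hull K)) := hf.integrable (by norm_num)
  have hf2 : Integrable (fun x => f x ^ 2) (volume.restrict (hull K)) := hf.integrable_sq
  have hexp : ∀ m : ℝ, ∫ x in hull K, (f x - m) ^ 2 =
      (∫ x in hull K, f x ^ 2) - 2 * m * (∫ x in hull K, f x) + V * m ^ 2 := by
    intro m
    have : ∀ x, (f x - m) ^ 2 = f x ^ 2 - 2 * m * f x + m ^ 2 := fun x => by ring
    simp only [this]
    rw [integral_add (f := fun x => f x ^ 2 - 2 * m * f x) (hf2.sub (hfi.const_mul _))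
      (integrable_const _), integral_sub hf2 (hfi.const_mul _), integral_const_mul, setIntegral_const, smul_eq_mul]
  set I := ∫ x in hull K, f x
  refine ⟨V⁻¹ * I, ?_, ?_⟩
  · have h1 := sq_integral_le hfi hf2
    rw [measureReal_restrict_apply_univ, ← hV] at h1
    rw [mul_pow, inv_pow]
    have : (V ^ 2)⁻¹ * I ^ 2 * V = V⁻¹ * I ^ 2 := by field_simp
    rw [this, inv_mul_le_iff₀ hVpos]
    exact h1
  · refine le_of_forall_pos_le_add_const_mul (b := 2 + 4 * 2 ^ d * Metric.diam (hull K) ^ 2)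
      fun δ hδ => ?_
    obtain ⟨G, hG⟩ := happ δ hδ
    set m := V⁻¹ * ∫ y in hull K, G y
    have h1 := poincare_convex hG.contDiff (isCompact_hull K) (convex_hull K) hVpos
    have h2 := hG.integral_fderiv_le hh
    have h3 := hG.integral_sub_const_le hf m
    -- The mean is the best constant in $L^2$. Hence the mean of `G`, which varies with the
    -- approximation, may be replaced by that of `f`, which does not.
    have h4 : ∫ x in hull K, (f x - V⁻¹ * I) ^ 2 ≤ ∫ x in hull K, (f x - m) ^ 2 := by
      rw [hexp, hexp]
      have e : I = V * (V⁻¹ * I) := by field_simp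
      set c := V⁻¹ * I
      rw [e]
      nlinarith [mul_nonneg hVpos.le (sq_nonneg (c - m))]
    have h5 := mul_le_mul_of_nonneg_left h2
      (show 0 ≤ 2 ^ d * Metric.diam (hull K) ^ 2 by positivity)
    linarith

/-- The Friedrichs inequality for limits of smooth functions vanishing on a face. -/
theorem friedrichs_of_approx (hK : IsSimplex K) (hf : MemLp f 2 (volume.restrict (hull K)))
    (hh : MemLp h 2 (volume.restrict (hull K))) {a : Euc d} {ha : a ∉ F} (haK : K = F.cons a ha)
    (hF : F.Nonempty)
    (happ : ∀ δ > 0, ∃ G, SmoothNear K f h δ G ∧ ∀ x ∈ hull F, G x = 0) :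
    ∫ x in hull K, f x ^ 2 ≤ 4 * Metric.diam (hull K) ^ 2 * ∫ x in hull K, ‖h x‖ ^ 2 := by
  refine le_of_forall_pos_le_add_const_mul (b := 2 + 4 * Metric.diam (hull K) ^ 2) fun δ hδ => ?_
  obtain ⟨G, hG, hG0⟩ := happ δ hδ
  have h1 := friedrichs_simplex hG.contDiff hK haK hF hG0
  have h2 := mul_le_mul_of_nonneg_left (hG.integral_fderiv_le hh)
    (sq_nonneg (Metric.diam (hull K)))
  have h3 := hG.integral_sub_const_le hf 0
  simp only [sub_zero] at h3
  linarith

/-- Transfer across a common face for limits of smooth functions. -/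
theorem transfer_of_approx (hK : IsSimplex K) (hK' : IsSimplex K')
    (hf : MemLp f 2 (volume.restrict (hull K))) (hh : MemLp h 2 (volume.restrict (hull K)))
    (hf' : MemLp f 2 (volume.restrict (hull K'))) (hh' : MemLp h 2 (volume.restrict (hull K')))
    {a a' : Euc d} {ha : a ∉ F} {ha' : a' ∉ F} (haK : K = F.cons a ha) (haK' : K' = F.cons a' ha')
    (hF : F.Nonempty) (happ : ∀ δ > 0, ∃ G G', SmoothNear K f h δ G ∧ SmoothNear K' f h δ G' ∧
      ∀ x ∈ hull F, G x = G' x) (b : ℝ) {c : Euc d} {r κ : ℝ} (hr : 0 < r)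
    (hc : Metric.closedBall c r ⊆ hull K) (hκ : Metric.diam (hull K') ≤ κ * r) :
    ∫ x in hull K', (f x - b) ^ 2 ≤
      2 * (volume.real (hull K') / volume.real (hull K) *
        (4 * (∫ x in hull K, (f x - b) ^ 2) +
          8 * Metric.diam (hull K) ^ 2 * ∫ x in hull K, ‖h x‖ ^ 2) +
        8 * Metric.diam (hull K) ^ 2 * ((d + 1) * κ / 2) ^ 2 * ∫ x in hull K', ‖h x‖ ^ 2) := by
  set D := Metric.diam (hull K)
  set R := volume.real (hull K') / volume.real (hull K)
  have hR : 0 ≤ R := by positivity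
  set Q := ((d + 1 : ℝ) * κ / 2) ^ 2
  have hQ : 0 ≤ Q := sq_nonneg _
  refine le_of_forall_pos_le_add_const_mul
    (b := 2 + 2 * (R * (4 + 8 * D ^ 2) + 8 * D ^ 2 * Q)) fun δ hδ => ?_
  obtain ⟨G, G', hG, hG', heq⟩ := happ δ hδ
  have h1 : ∫ x in hull K', (G' x - b) ^ 2 ≤ R * (2 * (∫ x in hull K, (G x - b) ^ 2) +
      4 * D ^ 2 * ∫ x in hull K, ‖fderiv ℝ G x‖ ^ 2) +
      4 * D ^ 2 * Q * ∫ x in hull K', ‖fderiv ℝ G' x‖ ^ 2 :=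
    transfer_across_face hG.contDiff hG'.contDiff hK hK' haK haK' hF heq b hr hc hκ
  have h2 := mul_le_mul_of_nonneg_left (hG.integral_fderiv_le hh)
    (show 0 ≤ 4 * D ^ 2 by positivity)
  have h3 := mul_le_mul_of_nonneg_left (hG'.integral_fderiv_le hh')
    (show 0 ≤ 4 * D ^ 2 * Q by positivity)
  have h4 := hG'.integral_sub_const_le hf' b
  have h5 := hG.integral_sub_const_le' hf b
  have h6 := mul_le_mul_of_nonneg_left (add_le_add (mul_le_mul_of_nonneg_left h5 zero_le_two) h2) hR
  linarith

end Limits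

theorem exists_eq_cons_of_subset {α : Type*} {F K : Finset α} (h : F ⊆ K)
    (hc : K.card = F.card + 1) : ∃ (a : α) (ha : a ∉ F), K = F.cons a ha := by
  classical
  have : (K \ F).card = 1 := by rw [Finset.card_sdiff_of_subset h]; omega
  obtain ⟨a, ha⟩ := Finset.card_eq_one.1 this
  have haF : a ∉ F := (Finset.mem_sdiff.1 (ha ▸ Finset.mem_singleton_self a : a ∈ K \ F)).2
  refine ⟨a, haF, ?_⟩
  rw [Finset.cons_eq_insert, Finset.insert_eq, ← ha, Finset.sdiff_union_of_subset h]

/-! ### Energies on the elements -/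

/-- The squared reaction-diffusion norm on the simplex with vertex set `K` of a function `f` with
gradient `h`. -/
noncomputable def elemEnergy {d : ℕ} (ε : ℝ) (K : Finset (Euc d)) (f : Euc d → ℝ)
    (h : Euc d → Euc d) : ℝ :=
  (∫ x in hull K, f x ^ 2) + ε * ∫ x in hull K, ‖h x‖ ^ 2

/-- The energy on an element, augmented by the squared `L²` norm scaled like the gradient. -/
noncomputable def scaledEnergy {d : ℕ} (ε : ℝ) (K : Finset (Euc d)) (f : Euc d → ℝ)
    (h : Euc d → Euc d) : ℝ :=
  elemEnergy ε K f h + ε / Metric.diam (hull K) ^ 2 * ∫ x in hull K, f x ^ 2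

theorem elemEnergy_nonneg {d : ℕ} {ε : ℝ} (hε : 0 ≤ ε) (K : Finset (Euc d)) (f : Euc d → ℝ)
    (h : Euc d → Euc d) : 0 ≤ elemEnergy ε K f h := by
  unfold elemEnergy; positivity

theorem elemEnergy_le_scaledEnergy {d : ℕ} {ε : ℝ} (hε : 0 ≤ ε) (K : Finset (Euc d))
    (f : Euc d → ℝ) (h : Euc d → Euc d) : elemEnergy ε K f h ≤ scaledEnergy ε K f h := by
  unfold scaledEnergy
  have : 0 ≤ ε / Metric.diam (hull K) ^ 2 * ∫ x in hull K, f x ^ 2 := by positivity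
  linarith

theorem gradient_sub_apply {d : ℕ} {f g : Euc d → ℝ} {x : Euc d} (hf : DifferentiableAt ℝ f x)
    (hg : DifferentiableAt ℝ g x) : gradient (f - g) x = gradient f x - gradient g x := by
  simp only [gradient, fderiv_sub hf hg, map_sub]

theorem gradient_add_const {d : ℕ} (f : Euc d → ℝ) (b : ℝ) :
    gradient (fun x => f x + b) = gradient f := by
  ext1 x
  simp only [gradient, fderiv_add_const]

namespace SimplicialMesh

variable {d ℓ : ℕ} {T : SimplicialMesh d} {F : Finset (Euc d)} {u w : Euc d → ℝ}
  {g : Euc d → Euc d} {ε κ : ℝ}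

/-- The elements that have `F` as a face. -/
noncomputable def elemsAt (T : SimplicialMesh d) (F : Finset (Euc d)) : Finset (Finset (Euc d)) :=
  T.elems.filter fun K => F ⊆ K

theorem mem_elemsAt {K : Finset (Euc d)} : K ∈ T.elemsAt F ↔ K ∈ T.elems ∧ F ⊆ K := by
  simp [elemsAt]

open Classical in
/-- The global finite element functions whose restrictions make up the local space at `F`. -/
noncomputable def extensionSpace (T : SimplicialMesh d) (ℓ : ℕ) (F : Finset (Euc d)) :
    Set (Euc d → ℝ) :=
  if T.PairHasBoundaryFace F then T.feSpaceZero ℓ else T.feSpace ℓ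

theorem mem_localSpace {P : Euc d → ℝ} :
    P ∈ T.localSpace ℓ F ↔ ∃ w ∈ T.extensionSpace ℓ F, Set.EqOn P w (T.pair F) := Iff.rfl

theorem mem_feSpace_of_mem_extensionSpace (hw : w ∈ T.extensionSpace ℓ F) :
    w ∈ T.feSpace ℓ := by
  unfold extensionSpace at hw
  split_ifs at hw
  exacts [hw.1, hw]

theorem mem_feSpaceZero_of_mem_extensionSpace (hw : w ∈ T.extensionSpace ℓ F)
    (h : T.PairHasBoundaryFace F) : w ∈ T.feSpaceZero ℓ := by
  rwa [extensionSpace, if_pos h] at hw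

theorem mem_extensionSpace_of_mem_feSpaceZero (hw : w ∈ T.feSpaceZero ℓ) :
    w ∈ T.extensionSpace ℓ F := by
  unfold extensionSpace
  split_ifs
  exacts [hw, hw.1]

theorem memLp_hull {E : Type*} [NormedAddCommGroup E] {f : Euc d → E}
    (hf : MemLp f 2 (volume.restrict T.domain)) {K : Finset (Euc d)} (hK : K ∈ T.elems) :
    MemLp f 2 (volume.restrict (hull K)) := by
  rw [← Measure.restrict_congr_set (hull_ae_eq_interior K)]
  exact hf.mono_measure (Measure.restrict_mono (T.interior_hull_subset_domain hK) le_rfl)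

theorem setIntegral_hull_le {f : Euc d → ℝ} (hf : IntegrableOn f T.domain) (h0 : ∀ x, 0 ≤ f x)
    {K : Finset (Euc d)} (hK : K ∈ T.elems) : ∫ x in hull K, f x ≤ ∫ x in T.domain, f x := by
  rw [← setIntegral_congr_set (hull_ae_eq_interior K)]
  exact setIntegral_mono_set hf (Eventually.of_forall h0)
    (T.interior_hull_subset_domain hK).eventuallyLE

/-- Element boundaries are null sets and the piecewise gradient of `w` is weak on all of $\Omega$,
so the norm on a patch splits into element contributions. Serves both for the pairs and for the
whole mesh. -/
theorem rdNorm_sub_sq (hu : MemLp u 2 (volume.restrict T.domain))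
    (hg : IsWeakGradient T.domain u g) (hw : w ∈ T.feSpace ℓ) {S : Finset (Finset (Euc d))}
    (hS : S ⊆ T.elems) {P : Euc d → ℝ} (hP : Set.EqOn P w (unionHull S)) (hε : 0 ≤ ε) :
    rdNorm ε (interior (unionHull S)) (u - P) ^ 2 =
      ∑ K ∈ S, elemEnergy ε K (u - w) (g - gradient w) := by
  have hsub : interior (unionHull S) ⊆ T.domain := interior_mono (unionHull_mono hS)
  have hU : MeasurableSet (interior (unionHull S)) := isOpen_interior.measurableSet
  have hwL := memLp_feSpace hw
  have h1 := (hg.sub (isWeakGradient_feSpace hw) hu hwL).mono hsub T.isOpen_domain.measurableSet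
  have heq : Set.EqOn (u - w) (u - P) (interior (unionHull S)) := fun x hx => by
    simp [hP (interior_subset hx)]
  rw [(h1.congr hU heq).rdNorm_sq isOpen_interior ((measure_mono hsub).trans_lt
    T.volume_domain_lt_top) hε]
  have h2 : ∫ x in interior (unionHull S), (u - P) x ^ 2 =
      ∫ x in interior (unionHull S), (u - w) x ^ 2 :=
    setIntegral_congr_fun hU fun x hx => by simp only [heq hx]
  rw [h2, T.integral_interior_unionHull (hu.sub hwL).integrable_sq hS,
    T.integral_interior_unionHull
      ((hg.1.sub (memLp_gradient_feSpace hw)).integrable_norm_pow two_ne_zero) hS,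
    Finset.mul_sum, ← Finset.sum_add_distrib]
  rfl

/-! ### Smooth approximation of the difference of a Sobolev and a finite element function -/

/-- Subtract from one test function near `u` the polynomial of `w` on each element. The pieces match
at common points because `w` is single valued; this replaces equality of traces on a face. -/
theorem exists_smoothNear_feSpace (hu : MemH10 T.domain u) (hg : IsWeakGradient T.domain u g)
    (hw : w ∈ T.feSpace ℓ) {δ : ℝ} (hδ : 0 < δ) :
    ∃ G : Finset (Euc d) → Euc d → ℝ,
      (∀ K ∈ T.elems, SmoothNear K (u - w) (g - gradient w) δ (G K)) ∧
        ∀ K ∈ T.elems, ∀ K' ∈ T.elems, ∀ x ∈ hull K, x ∈ hull K' → G K x = G K' x := by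
  obtain ⟨φ, hφ, h1, h2⟩ := exists_approx_of_memH10 T.isOpen_domain T.volume_domain_lt_top hu hg
  obtain ⟨n, hn1, hn2⟩ := ((h1.eventually (gt_mem_nhds hδ)).and
    (h2.eventually (gt_mem_nhds hδ))).exists
  choose! q hq hwq using fun K (hK : K ∈ T.elems) => exists_polyFun hw hK
  have hφd : Differentiable ℝ (φ n) := (hφ n).1.differentiable (by simp)
  refine ⟨fun K => φ n - q K, fun K hK => ⟨?_, ?_, ?_⟩, fun K hK K' hK' x hx hx' => ?_⟩
  · exact ((hφ n).1.sub (hq K hK).contDiff).of_le (by simp)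
  · have e : ∫ x in hull K, ((u - w) x - (φ n - q K) x) ^ 2 =
        ∫ x in hull K, (u x - φ n x) ^ 2 := by
      refine setIntegral_congr_fun (measurableSet_hull K) fun x hx => ?_
      simp only [Pi.sub_apply, hwq K hK hx]
      ring
    rw [e]
    exact (setIntegral_hull_le (hu.1.1.sub (hφ n).memLp).integrable_sq
      (fun x => sq_nonneg _) hK).trans hn1.le
  · have e : ∫ x in hull K, ‖(g - gradient w) x - gradient (φ n - q K) x‖ ^ 2 =
        ∫ x in hull K, ‖g x - gradient (φ n) x‖ ^ 2 := by
      rw [← setIntegral_congr_set (hull_ae_eq_interior K),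
        ← setIntegral_congr_set (hull_ae_eq_interior K)]
      refine setIntegral_congr_fun isOpen_interior.measurableSet fun x hx => ?_
      simp only [Pi.sub_apply]
      rw [gradient_sub_apply (hφd x) ((hq K hK).contDiff.differentiable (by simp) x),
        gradient_eq_of_eqOn (hwq K hK) hx, sub_sub_sub_cancel_right]
    rw [e]
    exact (setIntegral_hull_le ((hg.1.sub (hφ n).memLp_gradient).integrable_norm_pow two_ne_zero)
      (fun x => sq_nonneg _) hK).trans hn2.le
  · simp only [Pi.sub_apply]
    rw [← hwq K hK hx, ← hwq K' hK' hx']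

/-- Here `w` too is a limit of test functions, so a single smooth difference works on all elements
and vanishes outside $\Omega$, in particular on boundary faces. -/
theorem exists_smoothNear_feSpaceZero (hu : MemH10 T.domain u) (hg : IsWeakGradient T.domain u g)
    (hw : w ∈ T.feSpaceZero ℓ) {δ : ℝ} (hδ : 0 < δ) :
    ∃ G : Euc d → ℝ, (∀ K ∈ T.elems, SmoothNear K (u - w) (g - gradient w) δ G) ∧
      ∀ x, x ∉ T.domain → G x = 0 := by
  obtain ⟨φ, hφ, h1, h2⟩ := exists_approx_of_memH10 T.isOpen_domain T.volume_domain_lt_top hu hg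
  have hwg := isWeakGradient_feSpace hw.1
  obtain ⟨ψ, hψ, h3, h4⟩ := exists_approx_of_memH10 T.isOpen_domain T.volume_domain_lt_top hw.2 hwg
  have hδ4 : 0 < δ / 4 := by positivity
  obtain ⟨n, ⟨hn1, hn2⟩, hn3, hn4⟩ := (((h1.eventually (gt_mem_nhds hδ4)).and
    (h2.eventually (gt_mem_nhds hδ4))).and ((h3.eventually (gt_mem_nhds hδ4)).and
    (h4.eventually (gt_mem_nhds hδ4)))).exists
  have hφd : Differentiable ℝ (φ n) := (hφ n).1.differentiable (by simp)
  have hψd : Differentiable ℝ (ψ n) := (hψ n).1.differentiable (by simp)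
  refine ⟨φ n - ψ n, fun K hK => ⟨?_, ?_, ?_⟩, fun x hx => ?_⟩
  · exact ((hφ n).1.sub (hψ n).1).of_le (by simp)
  · have m1 := (hu.1.1.sub hw.2.1.1).sub ((hφ n).memLp.sub (hψ n).memLp)
    have m2 := (hψ n).memLp.sub hw.2.1.1
    have e := integral_sq_le_two m1 m2
    have e1 : ∀ x, ((u - w - (φ n - ψ n)) x - (ψ n - w) x) ^ 2 = (u x - φ n x) ^ 2 := fun x => by
      simp only [Pi.sub_apply]; ring
    have e2 : ∀ x, (ψ n - w) x ^ 2 = (w x - ψ n x) ^ 2 := fun x => by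
      simp only [Pi.sub_apply]; ring
    simp only [e1, e2] at e
    refine (setIntegral_hull_le m1.integrable_sq (fun x => sq_nonneg _) hK).trans ?_
    linarith
  · have m1 := (hg.1.sub hwg.1).sub ((hφ n).memLp_gradient.sub (hψ n).memLp_gradient)
    have m2 := (hψ n).memLp_gradient.sub hwg.1
    have e := integral_norm_sq_le m1 m2
    have e1 : ∀ x, ‖(g - gradient w - (gradient (φ n) - gradient (ψ n))) x -
        (gradient (ψ n) - gradient w) x‖ ^ 2 = ‖g x - gradient (φ n) x‖ ^ 2 := fun x => by
      simp only [Pi.sub_apply]; congr 2; abel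
    have e2 : ∀ x, ‖(gradient (ψ n) - gradient w) x‖ ^ 2 =
        ‖gradient w x - gradient (ψ n) x‖ ^ 2 := fun x => by
      rw [Pi.sub_apply, norm_sub_rev]
    simp only [e1, e2] at e
    simp only [gradient_sub_apply (hφd _) (hψd _)]
    refine (setIntegral_hull_le (m1.integrable_norm_pow two_ne_zero)
      (fun x => sq_nonneg _) hK).trans ?_
    linarith
  · simp [image_eq_zero_of_notMem_tsupport fun h => hx ((hφ n).2.2 h),
      image_eq_zero_of_notMem_tsupport fun h => hx ((hψ n).2.2 h)]

/-! ### The local estimate on a pair of elements -/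

/-- The constant in the estimate that transfers mean deviations between adjacent elements. -/
noncomputable def transferConst (d : ℕ) (κ : ℝ) : ℝ :=
  2 * κ ^ 2 * (κ ^ d * (16 * 2 ^ d + 8) + 8 * ((d + 1) * κ / 2) ^ 2)

theorem ShapeRegular.diam_le (hd : 1 ≤ d) (hT : T.ShapeRegular κ) (hκ : 1 ≤ κ)
    {K K' : Finset (Euc d)} (hK : K ∈ T.elems) (hK' : K' ∈ T.elems)
    (hne : (hull K ∩ hull K').Nonempty) :
    Metric.diam (hull K') ≤ κ * Metric.diam (hull K) := by
  obtain ⟨c, r, hr, hc, hdiam⟩ := hT K hK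
  have h1 := hdiam K' hK' hne
  have h2 := two_mul_le_diam hd (isBounded_hull K) hr.le hc
  have h3 : κ * r ≤ κ * Metric.diam (hull K) := by gcongr; linarith
  linarith

/-- Once a constant is good on one element of the pair, it is good on the others sharing `F`. Shape
regularity replaces the volume ratio by $\kappa^d$ and the diameter ratio by $\kappa$. -/
theorem integral_sub_const_le_of_pair (hd : 1 ≤ d) (hT : T.ShapeRegular κ) (hκ : 1 ≤ κ)
    {K K' : Finset (Euc d)} (hK : K ∈ T.elems) (hK' : K' ∈ T.elems) (hF : F.card = d)
    (hFK : F ⊆ K) (hFK' : F ⊆ K') {f : Euc d → ℝ} {h : Euc d → Euc d}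
    (hf : MemLp f 2 (volume.restrict T.domain)) (hh : MemLp h 2 (volume.restrict T.domain))
    (happ : ∀ δ > 0, ∃ G G', SmoothNear K f h δ G ∧ SmoothNear K' f h δ G' ∧
      ∀ x ∈ hull F, G x = G' x) {b : ℝ}
    (hb : ∫ x in hull K, (f x - b) ^ 2 ≤
      4 * 2 ^ d * Metric.diam (hull K) ^ 2 * ∫ x in hull K, ‖h x‖ ^ 2) :
    ∫ x in hull K', (f x - b) ^ 2 ≤ transferConst d κ * Metric.diam (hull K') ^ 2 *
      ((∫ x in hull K, ‖h x‖ ^ 2) + ∫ x in hull K', ‖h x‖ ^ 2) := by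
  have hFne : F.Nonempty := Finset.card_pos.1 (by omega)
  obtain ⟨y, hy⟩ := hFne
  have hyK := mem_hull_of_mem (hFK hy)
  have hyK' := mem_hull_of_mem (hFK' hy)
  obtain ⟨a, ha, haK⟩ := exists_eq_cons_of_subset hFK (by rw [T.card_eq K hK, hF])
  obtain ⟨a', ha', haK'⟩ := exists_eq_cons_of_subset hFK' (by rw [T.card_eq K' hK', hF])
  obtain ⟨c, r, hr, hc, hdiam⟩ := hT K hK
  have hVpos := (T.isSimplex hK).measureReal_pos
  have key := transfer_of_approx (T.isSimplex hK) (T.isSimplex hK') (memLp_hull hf hK)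
    (memLp_hull hh hK) (memLp_hull hf hK') (memLp_hull hh hK') haK haK' ⟨y, hy⟩ happ b hr hc
    (hdiam K' hK' ⟨y, hyK, hyK'⟩)
  have hR : volume.real (hull K') / volume.real (hull K) ≤ κ ^ d :=
    (div_le_iff₀ hVpos).2 (hT.volume_le hκ hK hK' ⟨y, hyK, hyK'⟩)
  have hD := hT.diam_le hd hκ hK' hK ⟨y, hyK', hyK⟩
  have hD2 : Metric.diam (hull K) ^ 2 ≤ κ ^ 2 * Metric.diam (hull K') ^ 2 := by
    rw [← mul_pow]
    exact pow_le_pow_left₀ Metric.diam_nonneg hD 2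
  set R := volume.real (hull K') / volume.real (hull K)
  have hR0 : 0 ≤ R := by positivity
  set D := Metric.diam (hull K) ^ 2
  have hD0 : 0 ≤ D := by positivity
  set D' := Metric.diam (hull K') ^ 2
  set X := ∫ x in hull K, (f x - b) ^ 2
  have hX0 : 0 ≤ X := by positivity
  set E := ∫ x in hull K, ‖h x‖ ^ 2
  have hE0 : 0 ≤ E := by positivity
  set E' := ∫ x in hull K', ‖h x‖ ^ 2
  have hE'0 : 0 ≤ E' := by positivity
  set Q := ((d + 1 : ℝ) * κ / 2) ^ 2 with hQ
  have hQ0 : 0 ≤ Q := sq_nonneg _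
  have hκd : 0 ≤ κ ^ d := by positivity
  calc ∫ x in hull K', (f x - b) ^ 2 ≤ 2 * (R * (4 * X + 8 * D * E) + 8 * D * Q * E') := key
    _ ≤ 2 * (κ ^ d * (4 * (4 * 2 ^ d * D * E) + 8 * D * E) + 8 * D * Q * E') := by gcongr
    _ = 2 * D * (κ ^ d * (16 * 2 ^ d + 8) * E + 8 * Q * E') := by ring
    _ ≤ 2 * D * (κ ^ d * (16 * 2 ^ d + 8) * (E + E') + 8 * Q * (E + E')) := by
        gcongr <;> linarith
    _ ≤ 2 * (κ ^ 2 * D') * (κ ^ d * (16 * 2 ^ d + 8) * (E + E') + 8 * Q * (E + E')) := by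
        gcongr
    _ = transferConst d κ * D' * (E + E') := by rw [transferConst, ← hQ]; ring

theorem ShapeRegular.card_elemsAt_le (hd : 1 ≤ d) (hT : T.ShapeRegular κ) (hκ : 1 ≤ κ)
    (hF : F.Nonempty) : ((T.elemsAt F).card : ℝ) ≤ (κ * (κ + 1)) ^ d := by
  rcases (T.elemsAt F).eq_empty_or_nonempty with h | ⟨K, hK⟩
  · rw [h, Finset.card_empty, Nat.cast_zero]
    positivity
  · obtain ⟨y, hy⟩ := hF
    refine le_trans ?_ (hT.card_touching_le hd hκ (mem_elemsAt.1 hK).1)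
    refine Nat.cast_le.2 (Finset.card_le_card fun K' hK' => mem_touching.2
      ⟨(mem_elemsAt.1 hK').1, y, mem_hull_of_mem ((mem_elemsAt.1 hK).2 hy),
        mem_hull_of_mem ((mem_elemsAt.1 hK').2 hy)⟩)

/-- The constant in the local estimate. -/
noncomputable def pairConst (d : ℕ) (κ : ℝ) : ℝ :=
  (2 + 2 * κ ^ d + 1 + transferConst d κ) * ((κ * (κ + 1)) ^ d + 1)

theorem pairConst_pos (hκ : 1 ≤ κ) : 0 < pairConst d κ := by
  unfold pairConst transferConst
  positivity

/-- The robust local estimate, with `hb` the Poincaré or Friedrichs bound. The scaled $L^2$ term is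
absorbed by $\varepsilon\|h\|^2$ alone, and the plain $L^2$ term by $\|f\|^2$ alone thanks to `hbm`.
No powers of $\varepsilon$ and mesh size mix, so the constant sees neither. -/
theorem sum_scaledEnergy_sub_const_le (hd : 1 ≤ d) (hT : T.ShapeRegular κ) (hκ : 1 ≤ κ)
    (hε : 0 ≤ ε) {K : Finset (Euc d)} (hK : K ∈ T.elems) (hF : F.card = d) (hFK : F ⊆ K)
    {f : Euc d → ℝ} {h : Euc d → Euc d} (hf : MemLp f 2 (volume.restrict T.domain))
    (hh : MemLp h 2 (volume.restrict T.domain))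
    (happ : ∀ K' ∈ T.elemsAt F, ∀ δ > 0, ∃ G G', SmoothNear K f h δ G ∧ SmoothNear K' f h δ G' ∧
      ∀ x ∈ hull F, G x = G' x) {b : ℝ}
    (hbm : b ^ 2 * volume.real (hull K) ≤ ∫ x in hull K, f x ^ 2)
    (hb : ∫ x in hull K, (f x - b) ^ 2 ≤
      4 * 2 ^ d * Metric.diam (hull K) ^ 2 * ∫ x in hull K, ‖h x‖ ^ 2) :
    ∑ K' ∈ T.elemsAt F, scaledEnergy ε K' (fun x => f x - b) h ≤
      pairConst d κ * ∑ K' ∈ T.elemsAt F, elemEnergy ε K' f h := by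
  have hFne : F.Nonempty := Finset.card_pos.1 (by omega)
  have hKF : K ∈ T.elemsAt F := mem_elemsAt.2 ⟨hK, hFK⟩
  have hC0 : 0 ≤ transferConst d κ := by unfold transferConst; positivity
  have hstep : ∀ K' ∈ T.elemsAt F, scaledEnergy ε K' (fun x => f x - b) h ≤
      (2 + 2 * κ ^ d + 1 + transferConst d κ) * (elemEnergy ε K f h + elemEnergy ε K' f h) := by
    intro K' hK'F
    obtain ⟨hK', hFK'⟩ := mem_elemsAt.1 hK'F
    have : IsFiniteMeasure (volume.restrict (hull K')) := ⟨by simpa using volume_hull_lt_top K'⟩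
    obtain ⟨y, hy⟩ := hFne
    have hne : (hull K ∩ hull K').Nonempty :=
      ⟨y, mem_hull_of_mem (hFK hy), mem_hull_of_mem (hFK' hy)⟩
    have h1 := integral_sub_const_le_of_pair hd hT hκ hK hK' hF hFK hFK' hf hh (happ K' hK'F) hb
    have h2 : ∫ x in hull K', (f x - b) ^ 2 ≤
        2 * (∫ x in hull K', f x ^ 2) + 2 * (b ^ 2 * volume.real (hull K')) := by
      have e := integral_sq_le_two ((memLp_hull hf hK').sub (memLp_const b))
        (memLp_const (μ := volume.restrict (hull K')) (p := 2) (-b))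
      simp only [Pi.sub_apply, sub_neg_eq_add, sub_add_cancel, neg_sq, setIntegral_const,
        smul_eq_mul] at e
      linarith
    have h3 : b ^ 2 * volume.real (hull K') ≤ κ ^ d * ∫ x in hull K, f x ^ 2 := by
      calc b ^ 2 * volume.real (hull K') ≤ b ^ 2 * (κ ^ d * volume.real (hull K)) := by
            gcongr; exact hT.volume_le hκ hK hK' hne
        _ = κ ^ d * (b ^ 2 * volume.real (hull K)) := by ring
        _ ≤ _ := by gcongr
    set D := Metric.diam (hull K') ^ 2
    have h4 : ε / D * (∫ x in hull K', (f x - b) ^ 2) ≤ ε * (transferConst d κ *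
        ((∫ x in hull K, ‖h x‖ ^ 2) + ∫ x in hull K', ‖h x‖ ^ 2)) := by
      rcases (show 0 ≤ D by positivity).eq_or_lt with hD | hD
      · rw [← hD, div_zero, zero_mul]; positivity
      · calc ε / D * (∫ x in hull K', (f x - b) ^ 2) ≤ ε / D * (transferConst d κ * D *
            ((∫ x in hull K, ‖h x‖ ^ 2) + ∫ x in hull K', ‖h x‖ ^ 2)) := by gcongr
          _ = _ := by field_simp
    unfold scaledEnergy elemEnergy
    set X := ∫ x in hull K, f x ^ 2
    have hX : 0 ≤ X := by positivity
    set X' := ∫ x in hull K', f x ^ 2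
    have hX' : 0 ≤ X' := by positivity
    have hE : 0 ≤ ε * ∫ x in hull K, ‖h x‖ ^ 2 := by positivity
    have hE' : 0 ≤ ε * ∫ x in hull K', ‖h x‖ ^ 2 := by positivity
    have hκd : 0 ≤ κ ^ d := by positivity
    have p1 := mul_nonneg hC0 hX
    have p2 := mul_nonneg hC0 hX'
    have p3 := mul_nonneg hκd hX
    have p4 := mul_nonneg hκd hX'
    have p5 := mul_nonneg hκd hE
    have p6 := mul_nonneg hκd hE'
    linarith
  have hsum := Finset.sum_le_sum hstep
  rw [← Finset.mul_sum, Finset.sum_add_distrib, Finset.sum_const, nsmul_eq_mul] at hsum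
  refine hsum.trans ?_
  have hcard := hT.card_elemsAt_le hd hκ hFne
  have hle : elemEnergy ε K f h ≤ ∑ K' ∈ T.elemsAt F, elemEnergy ε K' f h :=
    Finset.single_le_sum (f := fun K' => elemEnergy ε K' f h)
      (fun K' _ => elemEnergy_nonneg hε K' f h) hKF
  have h0 := elemEnergy_nonneg hε K f h
  have hm : ((T.elemsAt F).card : ℝ) * elemEnergy ε K f h ≤
      (κ * (κ + 1)) ^ d * ∑ K' ∈ T.elemsAt F, elemEnergy ε K' f h := by gcongr
  rw [pairConst, mul_assoc]
  refine mul_le_mul_of_nonneg_left ?_ (by positivity)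
  linarith

/-- Every function of the local space can be modified such that its error is also controlled in
the `L²` norm that is scaled like the gradient. -/
theorem exists_scaledEnergy_le (hd : 1 ≤ d) (hT : T.ShapeRegular κ) (hκ : 1 ≤ κ) (hε : 0 ≤ ε)
    (hu : MemH10 T.domain u) (hg : IsWeakGradient T.domain u g) (hF : F ∈ T.faces)
    (hw : w ∈ T.extensionSpace ℓ F) :
    ∃ w' ∈ T.extensionSpace ℓ F,
      ∑ K ∈ T.elemsAt F, scaledEnergy ε K (u - w') (g - gradient w') ≤
        pairConst d κ * ∑ K ∈ T.elemsAt F, elemEnergy ε K (u - w) (g - gradient w) := by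
  have hwf := mem_feSpace_of_mem_extensionSpace hw
  have hfL := hu.1.1.sub (memLp_feSpace hwf)
  have hhL := hg.1.sub (memLp_gradient_feSpace hwf)
  obtain ⟨K, hK, hFK, hFc⟩ := T.mem_faces.1 hF
  by_cases hB : T.PairHasBoundaryFace F
  · have hw0 := mem_feSpaceZero_of_mem_extensionSpace hw hB
    -- The base element is now the one with the boundary face. Friedrichs there provides the
    -- required bound with the constant $b=0$, so `w` stays unchanged and remains in $S_0$.
    obtain ⟨K, hK, hFK, F', hF', hF'K, hF'b⟩ := hB
    obtain ⟨-, -, -, hF'c⟩ := T.mem_faces.1 hF'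
    obtain ⟨a, ha, haK⟩ := exists_eq_cons_of_subset hF'K (by rw [T.card_eq K hK, hF'c])
    have hfr := friedrichs_of_approx (T.isSimplex hK) (memLp_hull hfL hK) (memLp_hull hhL hK) haK
      (Finset.card_pos.1 (by omega)) fun δ hδ => by
        obtain ⟨G, hG, hG0⟩ := exists_smoothNear_feSpaceZero hu hg hw0 hδ
        refine ⟨G, hG K hK, fun x hx => hG0 x fun hxd => ?_⟩
        have := (hF'b hx).2
        rw [T.isOpen_domain.interior_eq] at this
        exact this hxd
    have key := sum_scaledEnergy_sub_const_le hd hT hκ hε hK hFc hFK hfL hhL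
      (fun K' hK' δ hδ => by
        obtain ⟨G, hG, -⟩ := exists_smoothNear_feSpaceZero hu hg hw0 hδ
        exact ⟨G, G, hG K hK, hG K' (mem_elemsAt.1 hK').1, fun _ _ => rfl⟩) (b := 0)
      (by simp only [ne_eq, OfNat.ofNat_ne_zero, not_false_eq_true, zero_pow, zero_mul]; positivity)
      (by
        simp only [sub_zero]
        refine hfr.trans ?_
        have h1 : (1 : ℝ) ≤ 2 ^ d := one_le_pow₀ one_le_two
        gcongr
        linarith)
    simp only [sub_zero] at key
    exact ⟨w, hw, key⟩
  -- Without boundary faces the local space contains the constants, and the mean of the error over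
  -- one element may be added to `w`.
  · obtain ⟨b, hbm, hb⟩ := exists_const_poincare (T.isSimplex hK) (memLp_hull hfL hK)
      (memLp_hull hhL hK) fun δ hδ => by
        obtain ⟨G, hG, -⟩ := exists_smoothNear_feSpace hu hg hwf hδ
        exact ⟨G K, hG K hK⟩
    have key := sum_scaledEnergy_sub_const_le hd hT hκ hε hK hFc hFK hfL hhL
      (fun K' hK' δ hδ => by
        obtain ⟨G, hG, hGe⟩ := exists_smoothNear_feSpace hu hg hwf hδ
        have hK'e := mem_elemsAt.1 hK'
        exact ⟨G K, G K', hG K hK, hG K' hK'e.1, fun x hx =>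
          hGe K hK K' hK'e.1 x (hull_mono hFK hx) (hull_mono hK'e.2 hx)⟩) hbm hb
    refine ⟨fun x => w x + b, ?_, ?_⟩
    · rw [extensionSpace, if_neg hB, mem_feSpace_iff]
      refine ⟨hwf.1.add continuousOn_const, fun K hK => ?_⟩
      obtain ⟨q, hq, hwq⟩ := exists_polyFun hwf hK
      exact ⟨_, hq.add (PolyFun.const ℓ b), fun x hx => by simp only [hwq hx]⟩
    · have e : (u - fun x => w x + b) = fun x => (u - w) x - b := by
        ext x; simp only [Pi.sub_apply]; ring
      rw [gradient_add_const, e]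
      exact key

end SimplicialMesh

/-! ### Lagrange interpolation on a mesh -/

namespace SimplicialMesh

variable {d ℓ : ℕ} {T : SimplicialMesh d} {κ ε : ℝ}

theorem notMem_domain_of_mem_frontier {x : Euc d} (hx : x ∈ frontier T.domain) :
    x ∉ T.domain := by
  have := hx.2
  rwa [T.isOpen_domain.interior_eq] at this

open Classical in
/-- The finite element function with the prescribed nodal values `c`. -/
noncomputable def interpolant (T : SimplicialMesh d) (ℓ : ℕ) (c : Euc d → ℝ) (x : Euc d) : ℝ :=
  if h : ∃ K ∈ T.elems, x ∈ hull K then interp ℓ h.choose c x else 0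

/-- The element chosen in `interpolant` is irrelevant: two elements containing `x` meet in a common
subsimplex, on which interpolation uses only its own nodes. -/
theorem interpolant_eqOn (c : Euc d → ℝ) {K : Finset (Euc d)} (hK : K ∈ T.elems) :
    Set.EqOn (T.interpolant ℓ c) (interp ℓ K c) (hull K) := by
  classical
  intro x hx
  have h : ∃ K ∈ T.elems, x ∈ hull K := ⟨K, hK, hx⟩
  have h1 := h.choose_spec.1
  have hx' : x ∈ hull (h.choose ∩ K) := by
    rw [← T.hull_inter h1 hK]
    exact ⟨h.choose_spec.2, hx⟩
  obtain ⟨w, -, hw1, hwx⟩ := Finset.mem_convexHull'.1 hx'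
  rw [interpolant, dif_pos h,
    interp_eq_of_subset ℓ (T.isSimplex h1) Finset.inter_subset_left c hw1 hwx,
    interp_eq_of_subset ℓ (T.isSimplex hK) Finset.inter_subset_right c hw1 hwx]

theorem interpolant_mem_feSpace (c : Euc d → ℝ) : T.interpolant ℓ c ∈ T.feSpace ℓ := by
  refine mem_feSpace_iff.2 ⟨?_, fun K hK => ⟨_, polyFun_interp ℓ K c, interpolant_eqOn c hK⟩⟩
  have h1 : ContinuousOn (T.interpolant ℓ c) (⋃ K : T.elems, hull (K : Finset (Euc d))) :=
    (locallyFinite_of_finite _).continuousOn_iUnion (fun K => isClosed_hull _) fun K =>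
      ((polyFun_interp ℓ (K : Finset (Euc d)) c).contDiff.continuous.continuousOn).congr
        (interpolant_eqOn c K.2)
  refine h1.mono fun x hx => ?_
  obtain ⟨K, hK, hxK⟩ := mem_unionHull.1 (T.domain_subset hx)
  exact Set.mem_iUnion.2 ⟨⟨K, hK⟩, hxK⟩

/-- For a mesh point outside $\Omega$, take the smallest subsimplex `G` carrying it. No node of `G`
lies in $\Omega$, since otherwise the relative interior of `G` would. The interpolant on `G` sees
only those nodes. -/
theorem interpolant_mem_feSpaceZero (hd : 1 ≤ d) (hℓ : 1 ≤ ℓ) {c : Euc d → ℝ}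
    (hc : ∀ z ∈ unionHull T.elems, z ∉ T.domain → c z = 0) :
    T.interpolant ℓ c ∈ T.feSpaceZero ℓ := by
  refine mem_feSpaceZero_of_eq_zero hd (interpolant_mem_feSpace c) fun x hx hxd => ?_
  obtain ⟨K, hK, hxK⟩ := mem_unionHull.1 hx
  have hKs := T.isSimplex hK
  set G := K.filter fun b => 0 < baryCoord K b x
  have hGK : G ⊆ K := Finset.filter_subset _ _
  have hxG : x ∈ hull G := by
    refine (hKs.mem_hull_subset_iff hGK).2 ⟨hxK, fun b hb hbG => ?_⟩
    refine le_antisymm (not_lt.1 fun h => hbG (Finset.mem_filter.2 ⟨hb, h⟩)) ?_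
    exact hKs.baryCoord_nonneg hxK
  obtain ⟨w, -, hw1, hwx⟩ := Finset.mem_convexHull'.1 hxG
  rw [interpolant_eqOn c hK hxK, interp_eq_of_subset ℓ hKs hGK c hw1 hwx]
  refine Finset.sum_eq_zero fun a ha => ?_
  have hz : lagrangeNode ℓ a ∈ hull G := lagrangeNode_mem_hull hℓ ha
  rw [hc _ (hull_subset_unionHull hK (hull_mono hGK hz)) fun hzd => hxd ?_, zero_mul]
  exact mem_domain_of_mem_subsimplex hK hGK
    (fun h => notMem_domain_of_mem_frontier (h hz) hzd) hxG
    fun b hb => (Finset.mem_filter.1 hb).2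

/-! ### Summation over neighbourhoods -/

/-- The sum of `A` over the interior faces of the elements that touch `K`. -/
noncomputable def nearSum (T : SimplicialMesh d) (A : Finset (Euc d) → ℝ) (K : Finset (Euc d)) :
    ℝ :=
  ∑ K' ∈ T.touching K, ∑ F ∈ T.interiorFaces.filter (fun F => F ⊆ K'), A F

theorem nonempty_of_mem_interiorFaces (hd : 1 ≤ d) {F : Finset (Euc d)}
    (hF : F ∈ T.interiorFaces) : F.Nonempty := by
  obtain ⟨-, -, -, hc⟩ := T.mem_faces.1 (T.mem_interiorFaces.1 hF).1
  exact Finset.card_pos.1 (by omega)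

theorem le_nearSum {A : Finset (Euc d) → ℝ} (hA : ∀ F ∈ T.interiorFaces, 0 ≤ A F)
    {K K' F : Finset (Euc d)} (hK' : K' ∈ T.touching K) (hF : F ∈ T.interiorFaces) (hFK : F ⊆ K') :
    A F ≤ T.nearSum A K := by
  have h1 : A F ≤ ∑ F ∈ T.interiorFaces.filter (fun F => F ⊆ K'), A F :=
    Finset.single_le_sum (f := A) (fun F hF => hA F (Finset.mem_filter.1 hF).1)
      (Finset.mem_filter.2 ⟨hF, hFK⟩)
  refine h1.trans ?_
  exact Finset.single_le_sum
    (f := fun K' => ∑ F ∈ T.interiorFaces.filter (fun F => F ⊆ K'), A F)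
    (fun K' _ => Finset.sum_nonneg fun F hF => hA F (Finset.mem_filter.1 hF).1) hK'

/-- Finite overlap, used twice: touching is symmetric and each element touches boundedly many
others, and each face belongs to boundedly many elements. Each exchange of sums costs one factor
`N`. -/
theorem sum_nearSum_le (hd : 1 ≤ d) (hT : T.ShapeRegular κ) (hκ : 1 ≤ κ)
    {A : Finset (Euc d) → ℝ} (hA : ∀ F ∈ T.interiorFaces, 0 ≤ A F) :
    ∑ K ∈ T.elems, T.nearSum A K ≤ ((κ * (κ + 1)) ^ d) ^ 2 * ∑ F ∈ T.interiorFaces, A F := by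
  set N := (κ * (κ + 1)) ^ d with hN
  have hN0 : 0 ≤ N := by positivity
  unfold nearSum
  rw [Finset.sum_comm' (t' := T.elems) (s' := fun K' => T.touching K') fun K K' => by
    rw [mem_touching, mem_touching, Set.inter_comm]; tauto]
  have h1 : ∀ K' ∈ T.elems, ∑ _K ∈ T.touching K', ∑ F ∈ T.interiorFaces.filter (fun F => F ⊆ K'),
      A F ≤ N * ∑ F ∈ T.interiorFaces.filter (fun F => F ⊆ K'), A F := by
    intro K' hK'
    rw [Finset.sum_const, nsmul_eq_mul]
    exact mul_le_mul_of_nonneg_right (hT.card_touching_le hd hκ hK')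
      (Finset.sum_nonneg fun F hF => hA F (Finset.mem_filter.1 hF).1)
  refine (Finset.sum_le_sum h1).trans ?_
  rw [← Finset.mul_sum, Finset.sum_comm' (t' := T.interiorFaces) (s' := fun F => T.elemsAt F)
    fun K F => by rw [Finset.mem_filter, mem_elemsAt]; tauto, sq, mul_assoc]
  refine mul_le_mul_of_nonneg_left ?_ hN0
  rw [Finset.mul_sum]
  refine Finset.sum_le_sum fun F hF => ?_
  rw [Finset.sum_const, nsmul_eq_mul]
  exact mul_le_mul_of_nonneg_right
    (hT.card_elemsAt_le hd hκ (nonempty_of_mem_interiorFaces hd hF)) (hA F hF)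

/-! ### Comparison of nodal values -/

/-- The weight of a squared point value on an element. -/
noncomputable def pointWeight (ε : ℝ) (K : Finset (Euc d)) : ℝ :=
  volume.real (hull K) * (1 + ε / Metric.diam (hull K) ^ 2)

theorem pointWeight_pos (hε : 0 ≤ ε) {K : Finset (Euc d)} (hK : K ∈ T.elems) :
    0 < pointWeight ε K := by
  have := (T.isSimplex hK).measureReal_pos
  unfold pointWeight
  positivity

theorem ShapeRegular.diam_pos (hd : 1 ≤ d) (hT : T.ShapeRegular κ) {K : Finset (Euc d)}
    (hK : K ∈ T.elems) : 0 < Metric.diam (hull K) := by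
  obtain ⟨c, r, hr, hc, -⟩ := hT K hK
  have := two_mul_le_diam hd (isBounded_hull K) hr.le hc
  linarith

/-- The volumes contribute $\kappa^d$ and the squared diameters $\kappa^2$; since $\kappa\ge1$, the
term one in the weight is covered too, for every $\varepsilon$. -/
theorem ShapeRegular.pointWeight_le (hd : 1 ≤ d) (hT : T.ShapeRegular κ) (hκ : 1 ≤ κ)
    (hε : 0 ≤ ε) {K K' : Finset (Euc d)} (hK : K ∈ T.elems) (hK' : K' ∈ T.elems)
    (hne : (hull K ∩ hull K').Nonempty) :
    pointWeight ε K ≤ κ ^ (d + 2) * pointWeight ε K' := by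
  have hne' : (hull K' ∩ hull K).Nonempty := by rwa [Set.inter_comm]
  have h1 := hT.volume_le hκ hK' hK hne'
  have h2 := hT.diam_le hd hκ hK hK' hne
  have hD := hT.diam_pos hd hK
  have hD' := hT.diam_pos hd hK'
  have h3 : ε / Metric.diam (hull K) ^ 2 ≤ κ ^ 2 * (ε / Metric.diam (hull K') ^ 2) := by
    rw [mul_div_assoc', div_le_div_iff₀ (by positivity) (by positivity)]
    have : Metric.diam (hull K') ^ 2 ≤ κ ^ 2 * Metric.diam (hull K) ^ 2 := by
      rw [← mul_pow]
      exact pow_le_pow_left₀ hD'.le h2 2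
    nlinarith
  have h4 : (1 : ℝ) ≤ κ ^ 2 := one_le_pow₀ hκ
  unfold pointWeight
  calc volume.real (hull K) * (1 + ε / Metric.diam (hull K) ^ 2) ≤
        (κ ^ d * volume.real (hull K')) * (κ ^ 2 * (1 + ε / Metric.diam (hull K') ^ 2)) := by
        gcongr
        linarith
    _ = _ := by ring

theorem mul_integral_sq_le_scaledEnergy (hε : 0 ≤ ε) (K : Finset (Euc d)) (f : Euc d → ℝ)
    (h : Euc d → Euc d) :
    (1 + ε / Metric.diam (hull K) ^ 2) * ∫ x in hull K, f x ^ 2 ≤ scaledEnergy ε K f h := by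
  unfold scaledEnergy elemEnergy
  have : 0 ≤ ε * ∫ x in hull K, ‖h x‖ ^ 2 := by positivity
  linarith

/-- Two finite element functions that are close to `u` on an element are pointwise close there. -/
theorem pointWeight_mul_sub_sq_le {C : ℝ} (hC : 0 ≤ C)
    (hinv : ∀ K : Finset (Euc d), IsSimplex K → ∀ q, PolyFun ℓ q → ∀ x ∈ hull K,
      volume.real (hull K) * q x ^ 2 ≤ C * ∫ x in hull K, q x ^ 2) (hε : 0 ≤ ε)
    {u w w' : Euc d → ℝ} {h h' : Euc d → Euc d} (hu : MemLp u 2 (volume.restrict T.domain))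
    (hw : w ∈ T.feSpace ℓ) (hw' : w' ∈ T.feSpace ℓ) {K : Finset (Euc d)} (hK : K ∈ T.elems)
    {x : Euc d} (hx : x ∈ hull K) :
    pointWeight ε K * (w x - w' x) ^ 2 ≤
      C * (2 * scaledEnergy ε K (u - w) h + 2 * scaledEnergy ε K (u - w') h') := by
  obtain ⟨q, hq, hwq⟩ := exists_polyFun hw hK
  obtain ⟨q', hq', hwq'⟩ := exists_polyFun hw' hK
  have h1 := hinv K (T.isSimplex hK) _ (hq.sub hq') x hx
  have h2 : ∫ x in hull K, (q x - q' x) ^ 2 = ∫ x in hull K, (w - w') x ^ 2 :=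
    setIntegral_congr_fun (measurableSet_hull K) fun y hy => by
      simp only [Pi.sub_apply, hwq hy, hwq' hy]
  have h3 := integral_sq_le_two (memLp_hull ((memLp_feSpace hw).sub (memLp_feSpace hw')) hK)
    (memLp_hull (hu.sub (memLp_feSpace hw')) hK)
  have h4 : ∀ y, ((w - w') y - (u - w') y) ^ 2 = (u - w) y ^ 2 := fun y => by
    simp only [Pi.sub_apply]; ring
  simp only [h4] at h3
  rw [h2] at h1
  have h5 := mul_integral_sq_le_scaledEnergy hε K (u - w) h
  have h6 := mul_integral_sq_le_scaledEnergy hε K (u - w') h'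
  set θ := 1 + ε / Metric.diam (hull K) ^ 2 with hθ
  have hθ0 : 0 ≤ θ := by positivity
  calc pointWeight ε K * (w x - w' x) ^ 2
      = θ * (volume.real (hull K) * (q x - q' x) ^ 2) := by
        rw [pointWeight, hwq hx, hwq' hx, ← hθ]; ring
    _ ≤ θ * (C * (2 * (∫ y in hull K, (u - w) y ^ 2) + 2 * ∫ y in hull K, (u - w') y ^ 2)) := by
        exact mul_le_mul_of_nonneg_left (h1.trans (mul_le_mul_of_nonneg_left h3 hC)) hθ0
    _ = C * (2 * (θ * ∫ y in hull K, (u - w) y ^ 2) + 2 * (θ * ∫ y in hull K, (u - w') y ^ 2)) := by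
        ring
    _ ≤ _ := by gcongr

/-- Comparison of nodal values along a path of adjacent elements. -/
theorem pointWeight_mul_nodal_sub_sq_le (hd : 1 ≤ d) (hT : T.ShapeRegular κ) (hκ : 1 ≤ κ)
    (hfc : T.FaceConnected ℓ) {C : ℝ} (hC : 0 ≤ C)
    (hinv : ∀ K : Finset (Euc d), IsSimplex K → ∀ q, PolyFun ℓ q → ∀ x ∈ hull K,
      volume.real (hull K) * q x ^ 2 ≤ C * ∫ x in hull K, q x ^ 2) (hε : 0 ≤ ε)
    {u : Euc d → ℝ} (hu : MemLp u 2 (volume.restrict T.domain)) {g : Euc d → Euc d}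
    {w : Finset (Euc d) → Euc d → ℝ} (hw : ∀ F ∈ T.interiorFaces, w F ∈ T.feSpace ℓ)
    {face : Finset (Euc d) → Finset (Euc d)}
    (hface : ∀ K ∈ T.elems, face K ∈ T.interiorFaces ∧ face K ⊆ K)
    {A : Finset (Euc d) → ℝ}
    (hA : ∀ F ∈ T.interiorFaces, ∀ K ∈ T.elems, F ⊆ K →
      scaledEnergy ε K (u - w F) (g - gradient (w F)) ≤ A F) (hA0 : ∀ F ∈ T.interiorFaces, 0 ≤ A F)
    {K K' : Finset (Euc d)} (hK : K ∈ T.elems) (hK' : K' ∈ T.elems) {z : Euc d}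
    (hz : z ∈ T.nodes ℓ) (hzK : z ∈ hull K) (hzK' : z ∈ hull K') :
    pointWeight ε K * (w (face K) z - w (face K') z) ^ 2 ≤
      16 * C * κ ^ (d + 2) * ((κ * (κ + 1)) ^ d) ^ 2 * T.nearSum A K := by
  obtain ⟨n, p, hinj, hp, hp0, hpn, hadj⟩ := hfc z hz K hK K' hK' hzK hzK'
  have hzp : ∀ i, z ∈ hull (p i) := by
    intro i
    rcases Fin.eq_zero_or_eq_succ i with h | ⟨j, rfl⟩
    · rw [h, hp0]; exact hzK
    · obtain ⟨F, -, hzF, hF⟩ := hadj j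
      refine hull_mono ?_ hzF
      intro y hy
      have : y ∈ (p j.castSucc : Set (Euc d)) ∩ (p j.succ : Set (Euc d)) := by
        rw [hF]; exact hy
      exact this.2
  have htouch : ∀ i, p i ∈ T.touching K := fun i => mem_touching.2 ⟨hp i, z, hzK, hzp i⟩
  -- All elements of the path contain `z`, so they touch `K`. Being distinct, they are bounded in
  -- number.
  have hn : (n : ℝ) ≤ (κ * (κ + 1)) ^ d := by
    refine le_trans ?_ (hT.card_touching_le hd hκ hK)
    have : (Finset.univ.map ⟨p, hinj⟩).card ≤ (T.touching K).card :=
      Finset.card_le_card fun L hL => by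
        obtain ⟨i, -, rfl⟩ := Finset.mem_map.1 hL
        exact htouch i
    rw [Finset.card_map, Finset.card_univ, Fintype.card_fin] at this
    exact Nat.cast_le.2 (by omega)
  set m := pointWeight ε K
  have hm : 0 < m := pointWeight_pos hε hK
  set B := T.nearSum A K
  have hB : 0 ≤ B := Finset.sum_nonneg fun K' _ => Finset.sum_nonneg fun F hF => hA0 F
    (Finset.mem_filter.1 hF).1
  have hloc : ∀ i, ∀ F ∈ T.interiorFaces, F ⊆ p i →
      m * (w (face (p i)) z - w F z) ^ 2 ≤ 4 * C * κ ^ (d + 2) * B := by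
    intro i F hF hFp
    obtain ⟨hf1, hf2⟩ := hface _ (hp i)
    have h1 := pointWeight_mul_sub_sq_le hC hinv hε (h := g - gradient (w (face (p i))))
      (h' := g - gradient (w F)) hu (hw _ hf1) (hw F hF) (hp i) (hzp i)
    have h2 := (hA _ hf1 _ (hp i) hf2).trans (le_nearSum hA0 (htouch i) hf1 hf2)
    have h3 := (hA F hF _ (hp i) hFp).trans (le_nearSum hA0 (htouch i) hF hFp)
    calc m * (w (face (p i)) z - w F z) ^ 2
        ≤ κ ^ (d + 2) * pointWeight ε (p i) * (w (face (p i)) z - w F z) ^ 2 := by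
          gcongr
          exact hT.pointWeight_le hd hκ hε hK (hp i) ⟨z, hzK, hzp i⟩
      _ = κ ^ (d + 2) * (pointWeight ε (p i) * (w (face (p i)) z - w F z) ^ 2) := by ring
      _ ≤ κ ^ (d + 2) * (C * (2 * B + 2 * B)) := by
          exact mul_le_mul_of_nonneg_left
            (h1.trans (mul_le_mul_of_nonneg_left (by linarith) hC)) (by positivity)
      _ = _ := by ring
  set s := √(16 * C * κ ^ (d + 2) * B / m)
  have hs : s ^ 2 = 16 * C * κ ^ (d + 2) * B / m := Real.sq_sqrt (by positivity)
  have hstep : ∀ j : Fin n, |w (face (p j.castSucc)) z - w (face (p j.succ)) z| ≤ s := by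
    intro j
    -- The function of the shared face `F` is compared with both neighbours, since its pair contains
    -- both elements. The two comparisons with factor 4 combine through
    -- $(a-c)^2\le2(a-b)^2+2(c-b)^2$ to the factor 16.
    obtain ⟨F, hF, -, hFe⟩ := hadj j
    have hF1 : F ⊆ p j.castSucc := fun y hy => by
      have : y ∈ (p j.castSucc : Set (Euc d)) ∩ (p j.succ : Set (Euc d)) := by rw [hFe]; exact hy
      exact this.1
    have hF2 : F ⊆ p j.succ := fun y hy => by
      have : y ∈ (p j.castSucc : Set (Euc d)) ∩ (p j.succ : Set (Euc d)) := by rw [hFe]; exact hy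
      exact this.2
    have h1 := hloc _ F hF hF1
    have h2 := hloc _ F hF hF2
    refine Real.abs_le_sqrt ?_
    rw [le_div_iff₀ hm]
    set a := w (face (p j.castSucc)) z
    set b := w F z
    set c := w (face (p j.succ)) z
    nlinarith [mul_nonneg hm.le (sq_nonneg (a - b + (c - b)))]
  have hpath : ∀ i : ℕ, ∀ hi : i < n + 1,
      |w (face (p 0)) z - w (face (p ⟨i, hi⟩)) z| ≤ i * s := by
    intro i
    induction i with
    | zero => intro hi; simp
    | succ i ih =>
      intro hi
      have h1 := ih (by omega)
      have h2 := hstep ⟨i, by omega⟩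
      have h3 := abs_sub_le (w (face (p 0)) z) (w (face (p ⟨i, by omega⟩)) z)
        (w (face (p ⟨i + 1, hi⟩)) z)
      have h4 : |w (face (p ⟨i, by omega⟩)) z - w (face (p ⟨i + 1, hi⟩)) z| ≤ s := h2
      push_cast
      linarith
  have hfin := hpath n (by omega)
  have hlast : (⟨n, by omega⟩ : Fin (n + 1)) = Fin.last n := rfl
  rw [hlast, hp0, hpn] at hfin
  have hs0 : 0 ≤ s := Real.sqrt_nonneg _
  have h5 : (w (face K) z - w (face K') z) ^ 2 ≤ ((κ * (κ + 1)) ^ d * s) ^ 2 := by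
    rw [← sq_abs]
    exact pow_le_pow_left₀ (abs_nonneg _) (hfin.trans (by gcongr)) 2
  calc m * (w (face K) z - w (face K') z) ^ 2 ≤ m * ((κ * (κ + 1)) ^ d * s) ^ 2 := by gcongr
    _ = ((κ * (κ + 1)) ^ d) ^ 2 * (m * s ^ 2) := by ring
    _ = ((κ * (κ + 1)) ^ d) ^ 2 * (16 * C * κ ^ (d + 2) * B) := by
        rw [hs, mul_div_cancel₀ _ hm.ne']
    _ = _ := by ring

end SimplicialMesh

/-! ### The localized error bound -/

namespace SimplicialMesh

variable {d ℓ : ℕ} {T : SimplicialMesh d} {κ ε : ℝ}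

/-- Energy of a finite element function with small nodal values. -/
theorem elemEnergy_le_of_nodal {C : ℝ} (hC : 0 ≤ C)
    (hinv : ∀ K : Finset (Euc d), IsSimplex K → ∀ q : Euc d → ℝ, PolyFun ℓ q → ∀ M,
      (∀ a ∈ nodeIndex ℓ K, q (lagrangeNode ℓ a) ^ 2 ≤ M) → ∀ x ∈ hull K, q x ^ 2 ≤ C * M ∧
        ∀ c r, 0 < r → Metric.closedBall c r ⊆ hull K → r ^ 2 * ‖fderiv ℝ q x‖ ^ 2 ≤ C * M)
    (hℓ : 1 ≤ ℓ) (hT : T.ShapeRegular κ) (hκ : 1 ≤ κ) (hd : 1 ≤ d) (hε : 0 ≤ ε)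
    {w v : Euc d → ℝ} (hw : w ∈ T.feSpace ℓ) (hv : v ∈ T.feSpace ℓ) {K : Finset (Euc d)}
    (hK : K ∈ T.elems) {M : ℝ} (hM0 : 0 ≤ M)
    (hM : ∀ a ∈ nodeIndex ℓ K, (w (lagrangeNode ℓ a) - v (lagrangeNode ℓ a)) ^ 2 ≤ M) :
    elemEnergy ε K (w - v) (gradient w - gradient v) ≤ κ ^ 2 * C * (pointWeight ε K * M) := by
  obtain ⟨q, hq, hwq⟩ := exists_polyFun hw hK
  obtain ⟨q', hq', hvq⟩ := exists_polyFun hv hK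
  obtain ⟨c, r, hr, hc, hdiam⟩ := hT K hK
  have key := hinv K (T.isSimplex hK) _ (hq.sub hq') M fun a ha => by
    have hz := lagrangeNode_mem_hull hℓ ha
    rw [← hwq hz, ← hvq hz]
    exact hM a ha
  have hD := hT.diam_pos hd hK
  obtain ⟨x₀, hx₀⟩ := (T.isSimplex hK).interior_nonempty
  -- Converts the gradient bound scaled by the inscribed radius into one scaled by the diameter, as
  -- in `pointWeight`.
  have hDr := hdiam K hK ⟨x₀, interior_subset hx₀, interior_subset hx₀⟩
  set V := volume.real (hull K) with hV
  have hV0 : 0 ≤ V := measureReal_nonneg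
  have hfin : volume (hull K) ≠ ⊤ := (volume_hull_lt_top K).ne
  have h1 : ∫ x in hull K, (w - v) x ^ 2 ≤ V * (C * M) := by
    have := setIntegral_mono_on
      (memLp_hull ((memLp_feSpace hw).sub (memLp_feSpace hv)) hK).integrable_sq
      (integrableOn_const (C := C * M) hfin) (measurableSet_hull K) fun x hx => by
        rw [Pi.sub_apply, hwq hx, hvq hx]
        exact (key x hx).1
    rwa [setIntegral_const, smul_eq_mul] at this
  have h2 : ∫ x in hull K, ‖(gradient w - gradient v) x‖ ^ 2 ≤
      V * (κ ^ 2 * (C * M) / Metric.diam (hull K) ^ 2) := by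
    have hi := (memLp_hull ((memLp_gradient_feSpace hw).sub (memLp_gradient_feSpace hv))
      hK).integrable_norm_pow two_ne_zero
    have := integral_mono_ae hi
      (integrableOn_const (C := κ ^ 2 * (C * M) / Metric.diam (hull K) ^ 2) hfin) (by
        refine (ae_restrict_iff' (measurableSet_hull K)).2 ?_
        filter_upwards [ae_mem_interior_of_mem_hull T.elems] with x hx hxK
        have e : (gradient w - gradient v) x = gradient (fun x => q x - q' x) x := by
          rw [Pi.sub_apply, gradient_eq_of_eqOn hwq (hx K hK hxK),
            gradient_eq_of_eqOn hvq (hx K hK hxK)]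
          exact (gradient_sub_apply (hq.contDiff.differentiable (by simp) x)
            (hq'.contDiff.differentiable (by simp) x)).symm
        have h3 := (key x hxK).2 c r hr hc
        rw [e, norm_gradient, le_div_iff₀ (by positivity)]
        calc ‖fderiv ℝ (fun x => q x - q' x) x‖ ^ 2 * Metric.diam (hull K) ^ 2 ≤
              ‖fderiv ℝ (fun x => q x - q' x) x‖ ^ 2 * (κ * r) ^ 2 := by gcongr
          _ = κ ^ 2 * (r ^ 2 * ‖fderiv ℝ (fun x => q x - q' x) x‖ ^ 2) := by ring
          _ ≤ _ := by gcongr)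
    rwa [setIntegral_const, smul_eq_mul] at this
  have hκ2 : (1 : ℝ) ≤ κ ^ 2 := one_le_pow₀ hκ
  unfold elemEnergy
  calc (∫ x in hull K, (w - v) x ^ 2) + ε * ∫ x in hull K, ‖(gradient w - gradient v) x‖ ^ 2
      ≤ κ ^ 2 * (V * (C * M)) + ε * (V * (κ ^ 2 * (C * M) / Metric.diam (hull K) ^ 2)) := by
        refine add_le_add (h1.trans (le_mul_of_one_le_left (by positivity) hκ2)) ?_
        gcongr
    _ = _ := by rw [pointWeight, ← hV]; ring

theorem elemEnergy_add_le {f f' : Euc d → ℝ} {h h' : Euc d → Euc d} (hε : 0 ≤ ε)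
    (hf : MemLp f 2 (volume.restrict T.domain)) (hf' : MemLp f' 2 (volume.restrict T.domain))
    (hh : MemLp h 2 (volume.restrict T.domain)) (hh' : MemLp h' 2 (volume.restrict T.domain))
    {K : Finset (Euc d)} (hK : K ∈ T.elems) :
    elemEnergy ε K (f + f') (h + h') ≤ 2 * elemEnergy ε K f h + 2 * elemEnergy ε K f' h' := by
  have h1 := integral_sq_le_two (memLp_hull (hf.add hf') hK) (memLp_hull hf' hK)
  have h2 := integral_norm_sq_le (memLp_hull (hh.add hh') hK) (memLp_hull hh' hK)
  simp only [Pi.add_apply, add_sub_cancel_right] at h1 h2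
  unfold elemEnergy
  have h3 := mul_le_mul_of_nonneg_left h2 hε
  simp only [Pi.add_apply]
  linarith

/-- A family of local approximations can be merged into a finite element function that vanishes on
the boundary. -/
theorem exists_global_approximation (d ℓ : ℕ) (hd : 1 ≤ d) (hℓ : 1 ≤ ℓ) {κ : ℝ} (hκ : 1 ≤ κ) :
    ∃ C : ℝ, 0 < C ∧ ∀ T : SimplicialMesh d, T.ShapeRegular κ → IsConnected T.domain →
      2 ≤ T.elems.card → T.FaceConnected ℓ → ∀ ε : ℝ, 0 ≤ ε → ∀ (u : Euc d → ℝ)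
      (g : Euc d → Euc d), MemLp u 2 (volume.restrict T.domain) →
      MemLp g 2 (volume.restrict T.domain) → ∀ w : Finset (Euc d) → Euc d → ℝ,
      (∀ F ∈ T.interiorFaces, w F ∈ T.extensionSpace ℓ F) → ∃ v ∈ T.feSpaceZero ℓ,
        ∑ K ∈ T.elems, elemEnergy ε K (u - v) (g - gradient v) ≤
          C * ∑ F ∈ T.interiorFaces, ∑ K ∈ T.elemsAt F,
            scaledEnergy ε K (u - w F) (g - gradient (w F)) := by
  obtain ⟨C, hC, hinv⟩ := inverse_estimates d ℓ hℓ
  set N := (κ * (κ + 1)) ^ d with hN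
  have hN0 : 0 ≤ N := by positivity
  -- Splitting $u-v=(u-w)+(w-v)$ gives the two summands: the local error itself, and the merging
  -- error from nodal comparison followed by the inverse estimate.
  set L := 2 + 2 * (κ ^ 2 * C * (16 * C * κ ^ (d + 2) * N ^ 2))
  have hL : 0 < L := by positivity
  refine ⟨L * N ^ 2 + 1, by positivity, ?_⟩
  intro T hT hconn hcard hfc ε hε u g hu hg w hw
  have hwf : ∀ F ∈ T.interiorFaces, w F ∈ T.feSpace ℓ := fun F hF =>
    mem_feSpace_of_mem_extensionSpace (hw F hF)
  choose! face hface using fun K (hK : K ∈ T.elems) => T.exists_interiorFace hconn hcard hK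
  set A : Finset (Euc d) → ℝ := fun F => ∑ K ∈ T.elemsAt F,
    scaledEnergy ε K (u - w F) (g - gradient (w F))
  have hs0 : ∀ F K, 0 ≤ scaledEnergy ε K (u - w F) (g - gradient (w F)) := fun F K =>
    (elemEnergy_nonneg hε _ _ _).trans (elemEnergy_le_scaledEnergy hε _ _ _)
  have hA : ∀ F ∈ T.interiorFaces, ∀ K ∈ T.elems, F ⊆ K →
      scaledEnergy ε K (u - w F) (g - gradient (w F)) ≤ A F := fun F _ K hK hFK =>
    Finset.single_le_sum (f := fun K => scaledEnergy ε K (u - w F) (g - gradient (w F)))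
      (fun K _ => hs0 F K) (mem_elemsAt.2 ⟨hK, hFK⟩)
  have hA0 : ∀ F ∈ T.interiorFaces, 0 ≤ A F := fun F _ => Finset.sum_nonneg fun K _ => hs0 F K
  -- At points outside $\Omega$ an element with a boundary face is selected. Its owned face then has
  -- a pair touching $\partial\Omega$ in a face, so the attached function lies in $S_0$ and vanishes
  -- at `z`.
  have hchoice : ∀ z ∈ unionHull T.elems, ∃ K ∈ T.elems, z ∈ hull K ∧
      (z ∉ T.domain → w (face K) z = 0) := by
    intro z hz
    by_cases hzd : z ∈ T.domain
    · obtain ⟨K, hK, hzK⟩ := mem_unionHull.1 hz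
      exact ⟨K, hK, hzK, fun h => absurd hzd h⟩
    · obtain ⟨K, hK, hzK, F', hF', hF'K, hF'b⟩ := exists_boundaryFace hz hzd
      refine ⟨K, hK, hzK, fun _ => ?_⟩
      exact eq_zero_of_mem_feSpaceZero (mem_feSpaceZero_of_mem_extensionSpace
        (hw _ (hface K hK).1) ⟨K, hK, (hface K hK).2, F', hF', hF'K, hF'b⟩) hz hzd
  choose! Kz hKz hzKz hKz0 using hchoice
  -- A Scott–Zhang type selection: each nodal value comes from one local approximation, without
  -- averaging.
  set c : Euc d → ℝ := fun z => w (face (Kz z)) z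
  set v := T.interpolant ℓ c
  have hv0 : v ∈ T.feSpaceZero ℓ := interpolant_mem_feSpaceZero hd hℓ hKz0
  refine ⟨v, hv0, ?_⟩
  have helem : ∀ K ∈ T.elems,
      elemEnergy ε K (u - v) (g - gradient v) ≤ L * T.nearSum A K := by
    intro K hK
    obtain ⟨hf1, hf2⟩ := hface K hK
    have hm := pointWeight_pos hε hK
    have hwK := hwf _ hf1
    obtain ⟨x₀, hx₀⟩ := (T.isSimplex hK).interior_nonempty
    have hKK : K ∈ T.touching K :=
      mem_touching.2 ⟨hK, x₀, interior_subset hx₀, interior_subset hx₀⟩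
    set B := 16 * C * κ ^ (d + 2) * N ^ 2 * T.nearSum A K with hB
    have hAB := le_nearSum hA0 hKK hf1 hf2
    have hB0 : 0 ≤ B := by
      have := (hA0 _ hf1).trans hAB
      positivity
    have hnode : ∀ a ∈ nodeIndex ℓ K, (w (face K) (lagrangeNode ℓ a) -
        v (lagrangeNode ℓ a)) ^ 2 ≤ B / pointWeight ε K := by
      intro a ha
      have hz := T.lagrangeNode_mem_nodes hK ha
      have hzK := lagrangeNode_mem_hull hℓ ha
      have hzU := hull_subset_unionHull hK hzK
      have hve : v (lagrangeNode ℓ a) = _ := interpolant_eqOn c hK hzK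
      rw [hve, interp_node hℓ (T.isSimplex hK) c ha, le_div_iff₀' hm]
      exact pointWeight_mul_nodal_sub_sq_le hd hT hκ hfc hC.le
        (fun K hK q hq => (hinv K hK q hq).1) hε hu hwf hface hA hA0 hK (hKz _ hzU) hz hzK
        (hzKz _ hzU)
    have h1 := elemEnergy_le_of_nodal hC.le (fun K hK q hq => (hinv K hK q hq).2) hℓ hT hκ hd hε
      hwK hv0.1 hK (by positivity) hnode
    rw [mul_div_cancel₀ _ hm.ne'] at h1
    have h2 := elemEnergy_add_le hε (hu.sub (memLp_feSpace hwK))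
      ((memLp_feSpace hwK).sub (memLp_feSpace hv0.1)) (hg.sub (memLp_gradient_feSpace hwK))
      ((memLp_gradient_feSpace hwK).sub (memLp_gradient_feSpace hv0.1)) hK
    rw [sub_add_sub_cancel, sub_add_sub_cancel] at h2
    have h3 := (elemEnergy_le_scaledEnergy hε K (u - w (face K))
      (g - gradient (w (face K)))).trans (hA _ hf1 K hK hf2)
    calc elemEnergy ε K (u - v) (g - gradient v) ≤
          2 * T.nearSum A K + 2 * (κ ^ 2 * C * B) := by linarith
      _ = L * T.nearSum A K := by rw [hB]; ring
  have hS0 : 0 ≤ ∑ F ∈ T.interiorFaces, A F := Finset.sum_nonneg hA0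
  calc ∑ K ∈ T.elems, elemEnergy ε K (u - v) (g - gradient v) ≤
        ∑ K ∈ T.elems, L * T.nearSum A K := Finset.sum_le_sum helem
    _ = L * ∑ K ∈ T.elems, T.nearSum A K := by rw [Finset.mul_sum]
    _ ≤ L * (N ^ 2 * ∑ F ∈ T.interiorFaces, A F) := by
        gcongr
        exact sum_nearSum_le hd hT hκ hA0
    _ ≤ (L * N ^ 2 + 1) * ∑ F ∈ T.interiorFaces, A F := by linarith

/-! ### Counting faces and assembling the two bounds. -/

/-- The faces of an element number at most `d + 1`. -/
theorem card_filter_subset_le {K : Finset (Euc d)} (hK : K ∈ T.elems) :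
    (T.interiorFaces.filter fun F => F ⊆ K).card ≤ d + 1 := by
  have h : (T.interiorFaces.filter fun F => F ⊆ K) ⊆ K.powersetCard d := fun F hF => by
    obtain ⟨hF1, hF2⟩ := Finset.mem_filter.1 hF
    obtain ⟨-, -, -, hc⟩ := T.mem_faces.1 (T.mem_interiorFaces.1 hF1).1
    exact Finset.mem_powersetCard.2 ⟨hF2, hc⟩
  refine (Finset.card_le_card h).trans ?_
  rw [Finset.card_powersetCard, T.card_eq K hK, Nat.choose_succ_self_right]

/-- After exchanging the sums, each element is counted once for each of its interior faces. This
alone gives the constant of the second inequality. -/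
theorem sum_interiorFaces_sum_le {e : Finset (Euc d) → ℝ} (he : ∀ K ∈ T.elems, 0 ≤ e K) :
    ∑ F ∈ T.interiorFaces, ∑ K ∈ T.elemsAt F, e K ≤ (d + 1) * ∑ K ∈ T.elems, e K := by
  rw [Finset.sum_comm' (t' := T.elems) (s' := fun K => T.interiorFaces.filter fun F => F ⊆ K)
    fun F K => by rw [Finset.mem_filter, mem_elemsAt]; tauto, Finset.mul_sum]
  refine Finset.sum_le_sum fun K hK => ?_
  rw [Finset.sum_const, nsmul_eq_mul]
  exact mul_le_mul_of_nonneg_right (by exact_mod_cast card_filter_subset_le hK) (he K hK)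

theorem zero_mem_feSpaceZero (hd : 1 ≤ d) : (0 : Euc d → ℝ) ∈ T.feSpaceZero ℓ :=
  mem_feSpaceZero_of_eq_zero hd (mem_feSpace_iff.2 ⟨continuousOn_const, fun _ _ =>
    ⟨_, PolyFun.const ℓ 0, fun _ _ => rfl⟩⟩) fun _ _ _ => rfl

theorem rdNorm_domain_sq {u v : Euc d → ℝ} {g : Euc d → Euc d}
    (hu : MemLp u 2 (volume.restrict T.domain)) (hg : IsWeakGradient T.domain u g)
    (hv : v ∈ T.feSpace ℓ) (hε : 0 ≤ ε) :
    rdNorm ε T.domain (u - v) ^ 2 = ∑ K ∈ T.elems, elemEnergy ε K (u - v) (g - gradient v) :=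
  rdNorm_sub_sq hu hg hv subset_rfl (fun _ _ => rfl) hε

theorem rdNorm_pair_sq {u w P : Euc d → ℝ} {g : Euc d → Euc d} {F : Finset (Euc d)}
    (hu : MemLp u 2 (volume.restrict T.domain)) (hg : IsWeakGradient T.domain u g)
    (hw : w ∈ T.feSpace ℓ) (hP : Set.EqOn P w (T.pair F)) (hε : 0 ≤ ε) :
    rdNorm ε (interior (T.pair F)) (u - P) ^ 2 =
      ∑ K ∈ T.elemsAt F, elemEnergy ε K (u - w) (g - gradient w) :=
  rdNorm_sub_sq hu hg hw (Finset.filter_subset _ _) hP hε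

theorem bddBelow_range_sq {ι : Type*} (f : ι → ℝ) : BddBelow (Set.range fun i => f i ^ 2) :=
  ⟨0, by rintro _ ⟨i, rfl⟩; exact sq_nonneg _⟩

theorem bddBelow_range_rdNorm {ι : Type*} (U : Set (Euc d)) (f : ι → Euc d → ℝ) :
    BddBelow (Set.range fun i => rdNorm ε U (f i)) :=
  ⟨0, by rintro _ ⟨i, rfl⟩; exact rdNorm_nonneg⟩

end SimplicialMesh

open SimplicialMesh

theorem mainTheorem5 (d ℓ : ℕ) (hd : 1 ≤ d) (hℓ : 1 ≤ ℓ) (σ : ℝ) :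
    ∃ C : ℝ, 0 < C ∧
      ∀ T : SimplicialMesh d, IsConnected T.domain → 2 ≤ T.elems.card →
        T.FaceConnected ℓ → T.shapeParam ≤ σ →
        ∀ ε : ℝ, 0 < ε → ∀ u : Euc d → ℝ, MemH10 T.domain u →
          (⨅ v : T.feSpaceZero ℓ, rdNorm ε T.domain (u - v)) ≤
              C * √(∑ F ∈ T.interiorFaces,
                ⨅ P : T.localSpace ℓ F, rdNorm ε (interior (T.pair F)) (u - P) ^ 2) ∧
          √(∑ F ∈ T.interiorFaces,
                ⨅ P : T.localSpace ℓ F, rdNorm ε (interior (T.pair F)) (u - P) ^ 2) ≤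
              C * ⨅ v : T.feSpaceZero ℓ, rdNorm ε T.domain (u - v) := by
  set κ := max 1 (4 * σ)
  have hκ : 1 ≤ κ := le_max_left _ _
  obtain ⟨C₁, hC₁, hglob⟩ := exists_global_approximation d ℓ hd hℓ hκ
  have hC₂ : 0 < pairConst d κ := pairConst_pos hκ
  -- One root for each inequality; their sum serves both.
  refine ⟨√(C₁ * pairConst d κ) + √(d + 1), by positivity, ?_⟩
  intro T hconn hcard hfc hσ ε hε u hu
  have hT := shapeRegular_of_shapeParam_le hd T hσ
  obtain ⟨g, hg⟩ := hu.1.2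
  have hne : Nonempty (T.feSpaceZero ℓ) := ⟨⟨0, zero_mem_feSpaceZero hd⟩⟩
  have hneF : ∀ F, Nonempty (T.localSpace ℓ F) := fun F =>
    ⟨⟨0, mem_localSpace.2 ⟨0, mem_extensionSpace_of_mem_feSpaceZero (zero_mem_feSpaceZero hd),
      fun _ _ => rfl⟩⟩⟩
  set I : Finset (Euc d) → ℝ := fun F =>
    ⨅ P : T.localSpace ℓ F, rdNorm ε (interior (T.pair F)) (u - P) ^ 2
  have hI0 : ∀ F, 0 ≤ I F := fun F => Real.iInf_nonneg fun P => sq_nonneg _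
  set S := ∑ F ∈ T.interiorFaces, I F
  have hS0 : 0 ≤ S := Finset.sum_nonneg fun F _ => hI0 F
  set J := ⨅ v : T.feSpaceZero ℓ, rdNorm ε T.domain (u - v)
  have hJ0 : 0 ≤ J := Real.iInf_nonneg fun v => rdNorm_nonneg
  constructor
  · have hJ2 : J ^ 2 ≤ C₁ * pairConst d κ * S := by
      -- Local minimizers are not shown to exist, so each infimum is approached up to `δ`. The slack
      -- is multiplied by the number of faces, but it vanishes with `δ` and leaves the constant
      -- independent of the mesh.
      refine le_of_forall_pos_le_add_const_mul
        (b := C₁ * pairConst d κ * T.interiorFaces.card) fun δ hδ => ?_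
      have hloc : ∀ F ∈ T.interiorFaces, ∃ w ∈ T.extensionSpace ℓ F,
          ∑ K ∈ T.elemsAt F, scaledEnergy ε K (u - w) (g - gradient w) ≤
            pairConst d κ * (I F + δ) := by
        intro F hF
        obtain ⟨⟨P, hP⟩, hlt⟩ := exists_lt_of_ciInf_lt (show I F < I F + δ by linarith)
        obtain ⟨w, hw, hPw⟩ := mem_localSpace.1 hP
        rw [rdNorm_pair_sq hu.1.1 hg (mem_feSpace_of_mem_extensionSpace hw) hPw hε.le] at hlt
        obtain ⟨w', hw', hle⟩ := exists_scaledEnergy_le hd hT hκ hε.le hu hg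
          (T.mem_interiorFaces.1 hF).1 hw
        exact ⟨w', hw', hle.trans (mul_le_mul_of_nonneg_left hlt.le hC₂.le)⟩
      choose! w hw hwle using hloc
      obtain ⟨v, hv, hle⟩ := hglob T hT hconn hcard hfc ε hε.le u g hu.1.1 hg.1 w hw
      rw [← rdNorm_domain_sq hu.1.1 hg hv.1 hε.le] at hle
      have hJv : J ≤ rdNorm ε T.domain (u - v) :=
        ciInf_le (bddBelow_range_rdNorm _ _) (⟨v, hv⟩ : T.feSpaceZero ℓ)
      calc J ^ 2 ≤ rdNorm ε T.domain (u - v) ^ 2 := pow_le_pow_left₀ hJ0 hJv 2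
        _ ≤ C₁ * ∑ F ∈ T.interiorFaces, pairConst d κ * (I F + δ) :=
            hle.trans (mul_le_mul_of_nonneg_left (Finset.sum_le_sum hwle) hC₁.le)
        _ = _ := by
            rw [← Finset.mul_sum, Finset.sum_add_distrib, Finset.sum_const, nsmul_eq_mul]
            ring
    calc J = √(J ^ 2) := (Real.sqrt_sq hJ0).symm
      _ ≤ √(C₁ * pairConst d κ * S) := Real.sqrt_le_sqrt hJ2
      _ = √(C₁ * pairConst d κ) * √S := Real.sqrt_mul (by positivity) _
      _ ≤ (√(C₁ * pairConst d κ) + √(d + 1)) * √S := by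
          gcongr
          exact le_add_of_nonneg_right (Real.sqrt_nonneg _)
  · have hSv : ∀ v : T.feSpaceZero ℓ, √S ≤ √(d + 1) * rdNorm ε T.domain (u - v) := by
      rintro ⟨v, hv⟩
      rw [← Real.sqrt_sq (rdNorm_nonneg (ε := ε) (U := T.domain) (u := u - v)),
        ← Real.sqrt_mul (by positivity)]
      refine Real.sqrt_le_sqrt ?_
      rw [rdNorm_domain_sq hu.1.1 hg hv.1 hε.le]
      refine le_trans (Finset.sum_le_sum fun F _ => ?_)
        (sum_interiorFaces_sum_le fun K _ => elemEnergy_nonneg hε.le K _ _)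
      -- A function of $S_0$ competes in every local problem, with or without the boundary
      -- condition.
      rw [← rdNorm_pair_sq hu.1.1 hg hv.1 (Set.eqOn_refl v (T.pair F)) hε.le]
      exact ciInf_le (bddBelow_range_sq _) (⟨v, mem_localSpace.2
        ⟨v, mem_extensionSpace_of_mem_feSpaceZero hv, Set.eqOn_refl _ _⟩⟩ : T.localSpace ℓ F)
    have h1 : √S ≤ √(d + 1) * J := by
      rw [Real.mul_iInf_of_nonneg (Real.sqrt_nonneg _)]
      exact le_ciInf hSv
    refine h1.trans (mul_le_mul_of_nonneg_right ?_ hJ0)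
    exact le_add_of_nonneg_left (Real.sqrt_nonneg _)
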